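/- Let $m,n,r\ge 0$ be integers, $W=\mathfrak S_r$ the symmetric group with length function $\ell$ with respect to the basic transpositions, $\mathcal Z=\mathbb Z[\upsilon,\upsilon^{-1}]$, $q=\upsilon^2$, and let $\mathcal H$ be the Hecke algebra of $W$: the free $\mathcal Z$-module with basis $T_w$ ($w\in W$), with $T_wT_s=T_{ws}$ if $\ell(ws)>\ell(w)$ and $T_wT_s=(q-1)T_w+qT_{ws}$ otherwise, for $s$ a basic transposition. For a composition $\lambda=(\lambda^{(0)}|\lambda^{(1)})$ of $r$ into $m+n$ parts (zero parts allowed; $m$ even parts $\lambda^{(0)}$, then $n$ odd parts $\lambda^{(1)}$), let $N^\lambda_i$ be its $i$-th block of consecutive letters of $\{1,\dots,r\}$, let $W_\lambda=W_{\lambda^{(0)}}\times W_{\lambda^{(1)}}$ be the subgroup of $W$ preserving all blocks, with its even and odd parts, and put $[xy]_\lambda=\sum_{w\in W_{\lambda^{(0)}}}T_w\cdot\sum_{w\in W_{\lambda^{(1)}}}(-q)^{-\ell(w)}T_w$. The $q$-Schur superalgebra is $\mathcal S(m|n,r)=\operatorname{End}_{\mathcal H}\bigl(\bigoplus_\lambda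 [xy]_\lambda\mathcal H\bigr)$, endomorphisms of right $\mathcal H$-modules. For a subgroup $K\le W$ let $\mathcal D_K$ be the set of shortest representatives of the right cosets $Kw$. Let $\mathcal D_{\lambda\mu}=\mathcal D_{W_\lambda}\cap\mathcal D_{W_\mu}^{-1}$, and let $\mathcal D^\circ_{\lambda\mu}$ be the set of all $d\in\mathcal D_{\lambda\mu}$ such that $d^{-1}W_{\lambda^{(0)}}d\cap W_{\mu^{(1)}}$ and $d^{-1}W_{\lambda^{(1)}}d\cap W_{\mu^{(0)}}$ are trivial. For $d\in\mathcal D^\circ_{\lambda\mu}$ put $\jmath(\lambda,d,\mu)=(|N^\lambda_i\cap d(N^\mu_j)|)_{i,j}$ and $$T_{W_\lambda dW_\mu}=[xy]_\lambda\, T_d\sum_{w_0\in D\cap W_{\mu^{(0)}}}T_{w_0}\sum_{w_1\in D\cap W_{\mu^{(1)}}}(-q)^{-\ell(w_1)}T_{w_1},$$ where $D=\mathcal D_{d^{-1}W_\lambda d\cap W_\mu}\cap W_\mu$. Let $M(m|n,r)$ be the set of all matrices $\jmath(\lambda,d,\mu)$ with $d\in\mathcal D^\circ_{\lambda\mu}$.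 Then for every $A=\jmath(\lambda,d,\mu)\in M(m|n,r)$ there is a well-defined element $\phi_A\in\mathcal S(m|n,r)$, depending only on $A$, with $\phi_A([xy]_\alpha h)=\delta_{\mu,\alpha}T_{W_\lambda dW_\mu}h$ for all $\alpha$ and all $h\in\mathcal H$. Put $\phi_B=0$ for matrices $B\notin M(m|n,r)$. For $1\le i\le m$ let $\dot q_i=1$, $\ddot q_i=q$, $q_i=q$; for $m<i\le m+n$ let $\dot q_i=-q^{-1}$, $\ddot q_i=-1$, $q_i=q^{-1}$. Let $[\![a]\!]_x=1+x+\cdots+x^{a-1}$, let $E_{i,j}$ be the matrix units, and put $A^+_{h,k}=A+E_{h,k}-E_{h+1,k}$ if $a_{h+1,k}\ge1$ and $A^-_{h,k}=A-E_{h,k}+E_{h+1,k}$ if $a_{h,k}\ge1$. Let $A=(a_{i,j})\in M(m|n,r)$ and $1\le h<m+n$. (1) If $D_h^+\in M(m|n,r)$ is such that $D_h^+-E_{h,h+1}$ is diagonal and the column sums of $D_h^+$ are the row sums of $A$, then $$\phi_{D_h^+}\phi_A=\sum_{1\le k\le m+n,\ a_{h+1,k}\ge1}\dot q_{h+1}^{\sum_{j<k}a_{h+1,j}}\,\ddot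 q_h^{\sum_{j>k}a_{h,j}}\,[\![a_{h,k}+1]\!]_{q_h}\,\phi_{A^+_{h,k}}.$$ (2) If $D_h^-\in M(m|n,r)$ is such that $D_h^--E_{h+1,h}$ is diagonal and the column sums of $D_h^-$ are the row sums of $A$, then $$\phi_{D_h^-}\phi_A=\sum_{1\le k\le m+n,\ a_{h,k}\ge1}\dot q_h^{\sum_{j>k}a_{h,j}}\,\ddot q_{h+1}^{\sum_{j<k}a_{h+1,j}}\,[\![a_{h+1,k}+1]\!]_{q_{h+1}}\,\phi_{A^-_{h,k}}.$$ -/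

import Mathlib

open scoped DirectSum LaurentPolynomial

namespace QSchur

section SymmetricGroup

/-- The basic transposition exchanging the neighbouring letters `k` and `k + 1` of `Fin r`. -/
def adj (r : ℕ) (k : Fin (r - 1)) : Equiv.Perm (Fin r) :=
  Equiv.swap ⟨k, by omega⟩ ⟨k + 1, by omega⟩

/-- The Coxeter length: the smallest number of basic transpositions with product `w`. -/
noncomputable def length {r : ℕ} (w : Equiv.Perm (Fin r)) : ℕ :=
  sInf {a : ℕ | ∃ l : List (Fin (r - 1)), (l.map (adj r)).prod = w ∧ l.length = a}

/-- The set of inversions of a permutation. -/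
def inversions {r : ℕ} (w : Equiv.Perm (Fin r)) : Finset (Fin r × Fin r) :=
  Finset.univ.filter fun p => p.1 < p.2 ∧ w p.2 < w p.1

variable {r : ℕ}

theorem mem_inversions {w : Equiv.Perm (Fin r)} {i j : Fin r} :
    (i, j) ∈ inversions w ↔ i < j ∧ w j < w i := by
  simp [inversions]

theorem inversions_one : inversions (1 : Equiv.Perm (Fin r)) = ∅ := by
  ext ⟨i, j⟩
  simp only [mem_inversions, Equiv.Perm.one_apply, Finset.notMem_empty, iff_false]
  exact fun h => lt_asymm h.1 h.2

theorem adj_mul_adj (k : Fin (r - 1)) : adj r k * adj r k = 1 := Equiv.swap_mul_self _ _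

theorem adj_inv (k : Fin (r - 1)) : (adj r k)⁻¹ = adj r k := Equiv.swap_inv _ _

theorem adj_lt (k : Fin (r - 1)) {i j : Fin r} (hij : i < j)
    (hne : ¬ (i = ⟨k, by omega⟩ ∧ j = ⟨k + 1, by omega⟩)) : adj r k i < adj r k j := by
  simp only [adj, Equiv.swap_apply_def, Fin.lt_def, Fin.ext_iff] at *
  split_ifs <;> simp_all <;> omega

theorem inversions_mul_adj (w : Equiv.Perm (Fin r)) (k : Fin (r - 1))
    (h : w ⟨k, by omega⟩ < w ⟨k + 1, by omega⟩) :
    (inversions (w * adj r k)).card = (inversions w).card + 1 := by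
  have key : inversions (w * adj r k) =
      insert ((⟨k, by omega⟩, ⟨k + 1, by omega⟩) : Fin r × Fin r)
        ((inversions w).map ((adj r k).prodCongr (adj r k)).toEmbedding) := by
    ext ⟨i, j⟩
    have e : ((i, j) ∈ (inversions w).map ((adj r k).prodCongr (adj r k)).toEmbedding) ↔
        (adj r k i < adj r k j ∧ w (adj r k j) < w (adj r k i)) := by
      rw [Finset.mem_map_equiv]
      refine Iff.trans (mem_inversions (i := (adj r k)⁻¹ i) (j := (adj r k)⁻¹ j)) ?_
      rw [adj_inv]
    rw [Finset.mem_insert, e, mem_inversions]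
    simp only [Prod.mk.injEq, Equiv.Perm.mul_apply]
    by_cases hp : i = ⟨k, by omega⟩ ∧ j = ⟨k + 1, by omega⟩
    · obtain ⟨rfl, rfl⟩ := hp
      simp only [and_self, true_or, iff_true]
      refine ⟨Nat.lt_succ_self _, ?_⟩
      simpa [adj] using h
    · simp only [hp, false_or]
      refine and_congr_left fun h2 => ⟨fun h1 => adj_lt k h1 hp, fun h1 => ?_⟩
      by_cases hq : adj r k i = ⟨k, by omega⟩ ∧ adj r k j = ⟨k + 1, by omega⟩
      · rw [hq.1, hq.2] at h2
        exact absurd h2 (not_lt.mpr h.le)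
      · have := adj_lt k h1 hq
        rwa [← Equiv.Perm.mul_apply, ← Equiv.Perm.mul_apply, adj_mul_adj] at this
  rw [key, Finset.card_insert_of_notMem, Finset.card_map]
  rw [Finset.mem_map_equiv]
  intro hm
  have h2 := (mem_inversions (i := (adj r k)⁻¹ _) (j := (adj r k)⁻¹ _)).1 hm
  rw [adj_inv] at h2
  simp [adj] at h2

theorem inversions_mul_adj' (w : Equiv.Perm (Fin r)) (k : Fin (r - 1))
    (h : w ⟨k + 1, by omega⟩ < w ⟨k, by omega⟩) :
    (inversions (w * adj r k)).card + 1 = (inversions w).card := by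
  rw [← inversions_mul_adj (w * adj r k) k (by simpa [adj] using h), mul_assoc, adj_mul_adj,
    mul_one]

theorem adj_trichotomy (w : Equiv.Perm (Fin r)) (k : Fin (r - 1)) :
    w ⟨k, by omega⟩ < w ⟨k + 1, by omega⟩ ∨ w ⟨k + 1, by omega⟩ < w ⟨k, by omega⟩ := by
  apply lt_or_gt_of_ne
  intro h
  have := w.injective h
  simp at this

theorem eq_one_of_no_descent (w : Equiv.Perm (Fin r))
    (h : ∀ k : Fin (r - 1), w ⟨k, by omega⟩ < w ⟨k + 1, by omega⟩) : w = 1 := by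
  obtain _ | r := r
  · exact Subsingleton.elim _ _
  have hm : StrictMono w := by
    rw [Fin.strictMono_iff_lt_succ]
    intro i
    exact h ⟨i, by omega⟩
  have : (StrictMono.orderIsoOfSurjective w hm w.surjective) = OrderIso.refl (Fin (r + 1)) :=
    Subsingleton.elim _ _
  ext i
  have h2 := congrArg (fun f : Fin (r + 1) ≃o Fin (r + 1) => f i) this
  simpa [Fin.ext_iff] using h2

theorem exists_word (w : Equiv.Perm (Fin r)) :
    ∃ l : List (Fin (r - 1)), (l.map (adj r)).prod = w ∧ l.length = (inversions w).card := by
  induction hn : (inversions w).card generalizing w with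
  | zero =>
    refine ⟨[], ?_, rfl⟩
    rw [eq_one_of_no_descent w]
    · rfl
    · intro k
      refine (adj_trichotomy w k).resolve_right fun hk => ?_
      have := inversions_mul_adj' w k hk
      omega
  | succ a ih =>
    have : ∃ k : Fin (r - 1), w ⟨k + 1, by omega⟩ < w ⟨k, by omega⟩ := by
      by_contra hc
      have h1 : w = 1 := eq_one_of_no_descent w fun k =>
        (adj_trichotomy w k).resolve_right fun hk => hc ⟨k, hk⟩
      subst h1
      rw [inversions_one] at hn
      simp at hn
    obtain ⟨k, hk⟩ := this
    have h1 := inversions_mul_adj' w k hk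
    obtain ⟨l, hl, hl'⟩ := ih (w * adj r k) (by omega)
    refine ⟨l ++ [k], ?_, by simp [hl']⟩
    rw [List.map_append, List.prod_append, hl]
    simp [mul_assoc, adj_mul_adj]

theorem inversions_prod_le (l : List (Fin (r - 1))) :
    (inversions (l.map (adj r)).prod).card ≤ l.length := by
  induction l using List.reverseRecOn with
  | nil =>
    simp [inversions_one]
  | append_singleton l k ih =>
    simp only [List.map_append, List.prod_append, List.map_cons, List.map_nil, List.prod_cons,
      List.prod_nil, mul_one, List.length_append, List.length_cons, List.length_nil]
    rcases adj_trichotomy (l.map (adj r)).prod k with h | h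
    · have := inversions_mul_adj _ k h
      omega
    · have := inversions_mul_adj' _ k h
      omega

theorem length_eq_card_inversions (w : Equiv.Perm (Fin r)) :
    length w = (inversions w).card := by
  obtain ⟨l, hl, hl'⟩ := exists_word w
  apply le_antisymm
  · exact Nat.sInf_le ⟨l, hl, hl'⟩
  · refine le_csInf ⟨_, l, hl, rfl⟩ ?_
    rintro a ⟨l', rfl, rfl⟩
    exact inversions_prod_le l'

theorem exists_reduced_word (w : Equiv.Perm (Fin r)) :
    ∃ l : List (Fin (r - 1)), (l.map (adj r)).prod = w ∧ l.length = length w := by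
  rw [length_eq_card_inversions]
  exact exists_word w

theorem length_prod_le (l : List (Fin (r - 1))) :
    length (l.map (adj r)).prod ≤ l.length := Nat.sInf_le ⟨l, rfl, rfl⟩

theorem length_one : length (1 : Equiv.Perm (Fin r)) = 0 :=
  Nat.eq_zero_of_le_zero (Nat.sInf_le ⟨[], rfl, rfl⟩)

theorem length_inv_le (w : Equiv.Perm (Fin r)) : length w⁻¹ ≤ length w := by
  obtain ⟨l, rfl, hl⟩ := exists_reduced_word w
  rw [← hl, List.prod_inv_reverse, List.map_map]
  have : (fun x : Equiv.Perm (Fin r) => x⁻¹) ∘ adj r = adj r := funext adj_inv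
  rw [this, ← List.map_reverse]
  simpa using length_prod_le l.reverse

theorem length_inv (w : Equiv.Perm (Fin r)) : length w⁻¹ = length w :=
  le_antisymm (length_inv_le w) (by simpa using length_inv_le w⁻¹)

theorem length_lt_mul_adj (w : Equiv.Perm (Fin r)) (k : Fin (r - 1)) :
    length w < length (w * adj r k) ↔ w ⟨k, by omega⟩ < w ⟨k + 1, by omega⟩ := by
  simp only [length_eq_card_inversions]
  rcases adj_trichotomy w k with h | h
  · have := inversions_mul_adj _ k h
    simp only [h, iff_true]
    omega
  · have := inversions_mul_adj' _ k h
    simp only [h.not_gt, iff_false]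
    omega

theorem length_lt_adj_mul (w : Equiv.Perm (Fin r)) (k : Fin (r - 1)) :
    length w < length (adj r k * w) ↔ w⁻¹ ⟨k, by omega⟩ < w⁻¹ ⟨k + 1, by omega⟩ := by
  rw [← length_lt_mul_adj, ← length_inv w, ← length_inv (adj r k * w), mul_inv_rev, adj_inv]

theorem adj_mul_eq_mul_adj (w : Equiv.Perm (Fin r)) (j k : Fin (r - 1))
    (h : (w ⟨k, by omega⟩ = ⟨j, by omega⟩ ∧ w ⟨k + 1, by omega⟩ = ⟨j + 1, by omega⟩) ∨
      (w ⟨k + 1, by omega⟩ = ⟨j, by omega⟩ ∧ w ⟨k, by omega⟩ = ⟨j + 1, by omega⟩)) :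
    adj r j * w = w * adj r k := by
  rw [adj, adj, Equiv.mul_swap_eq_swap_mul]
  rcases h with h | h
  · rw [h.1, h.2]
  · rw [h.1, h.2, Equiv.swap_comm]

theorem length_lt_mul_adj_comm (w : Equiv.Perm (Fin r)) (j k : Fin (r - 1))
    (hne : adj r j * w ≠ w * adj r k) :
    length (adj r j * w) < length (adj r j * w * adj r k) ↔ length w < length (w * adj r k) := by
  rw [length_lt_mul_adj, length_lt_mul_adj]
  rcases adj_trichotomy w k with h | h
  · exact iff_of_true
      (adj_lt j h fun hc => hne (adj_mul_eq_mul_adj w j k (Or.inl hc))) h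
  · exact iff_of_false
      (adj_lt j h fun hc => hne (adj_mul_eq_mul_adj w j k (Or.inr hc))).not_gt h.not_gt

theorem length_lt_adj_mul_comm (w : Equiv.Perm (Fin r)) (j k : Fin (r - 1))
    (hne : adj r j * w ≠ w * adj r k) :
    length (w * adj r k) < length (adj r j * (w * adj r k)) ↔
      length w < length (adj r j * w) := by
  have h := length_lt_mul_adj_comm w⁻¹ k j (fun hc => hne (by
    have := congrArg (fun x => x⁻¹) hc
    simpa [mul_inv_rev, adj_inv] using this.symm))
  rw [← length_inv (w * adj r k), ← length_inv (adj r j * (w * adj r k)), ← length_inv w,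
    ← length_inv (adj r j * w)]
  simpa [mul_inv_rev, adj_inv, mul_assoc] using h

end SymmetricGroup

section HeckeAlgebra

variable {R : Type*} [CommRing R]

/-- The underlying free module of the Hecke algebra of the symmetric group on `r` letters with
parameter `q`; the basis vector `T_w` is `Finsupp.single w 1`. -/
def Hecke (_q : Rˣ) (r : ℕ) : Type _ := Equiv.Perm (Fin r) →₀ R

namespace Hecke

variable (q : Rˣ) (r : ℕ)

noncomputable instance : AddCommGroup (Hecke q r) :=
  inferInstanceAs (AddCommGroup (Equiv.Perm (Fin r) →₀ R))

noncomputable instance : Module R (Hecke q r) :=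
  inferInstanceAs (Module R (Equiv.Perm (Fin r) →₀ R))

/-- The standard basis of the Hecke algebra. -/
noncomputable def basis : Module.Basis (Equiv.Perm (Fin r)) R (Hecke q r) :=
  ⟨LinearEquiv.refl R (Equiv.Perm (Fin r) →₀ R)⟩

variable {q r}

variable (q) in
/-- The basis element `T_w`. -/
noncomputable def T (w : Equiv.Perm (Fin r)) : Hecke q r := basis q r w

variable (q r) in
/-- The operator that is right multiplication by `T_s`, `s = adj r k`. -/
noncomputable def opR (k : Fin (r - 1)) : Hecke q r →ₗ[R] Hecke q r :=
  (basis q r).constr R fun w =>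
    if length w < length (w * adj r k) then T q (w * adj r k)
    else ((q : R) - 1) • T q w + (q : R) • T q (w * adj r k)

variable (q r) in
/-- The operator that is left multiplication by `T_s`, `s = adj r k`. -/
noncomputable def opL (k : Fin (r - 1)) : Hecke q r →ₗ[R] Hecke q r :=
  (basis q r).constr R fun w =>
    if length w < length (adj r k * w) then T q (adj r k * w)
    else ((q : R) - 1) • T q w + (q : R) • T q (adj r k * w)

theorem opR_T (k : Fin (r - 1)) (w : Equiv.Perm (Fin r)) :
    opR q r k (T q w) = if length w < length (w * adj r k) then T q (w * adj r k)
      else ((q : R) - 1) • T q w + (q : R) • T q (w * adj r k) :=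
  (basis q r).constr_basis R _ w

theorem opL_T (k : Fin (r - 1)) (w : Equiv.Perm (Fin r)) :
    opL q r k (T q w) = if length w < length (adj r k * w) then T q (adj r k * w)
      else ((q : R) - 1) • T q w + (q : R) • T q (adj r k * w) :=
  (basis q r).constr_basis R _ w

theorem opL_opR (j k : Fin (r - 1)) (x : Hecke q r) :
    opL q r j (opR q r k x) = opR q r k (opL q r j x) := by
  suffices h : opL q r j ∘ₗ opR q r k = opR q r k ∘ₗ opL q r j from LinearMap.congr_fun h x
  refine (basis q r).ext fun w => ?_
  change opL q r j (opR q r k (T q w)) = opR q r k (opL q r j (T q w))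
  by_cases he : adj r j * w = w * adj r k
  · have h1 : adj r j * (w * adj r k) = w := by rw [← he, ← mul_assoc, adj_mul_adj, one_mul]
    have h2 : w * adj r k * adj r k = w := by rw [mul_assoc, adj_mul_adj, mul_one]
    rw [opR_T, opL_T, he]
    split_ifs <;> simp only [map_add, map_smul, opR_T, opL_T, he, h1, h2]
  · have h1 := length_lt_mul_adj_comm w j k he
    have h2 := length_lt_adj_mul_comm w j k he
    rw [opR_T, opL_T]
    by_cases ha : length w < length (w * adj r k) <;>
      by_cases hb : length w < length (adj r j * w) <;>
      simp only [ha, hb, iff_true, iff_false, if_true, if_false, map_add, map_smul, opR_T, opL_T,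
        mul_assoc] at h1 h2 ⊢ <;>
      simp only [h1, h2, if_true, if_false, smul_add, smul_smul] <;>
      (try simp only [mul_comm, add_assoc, add_left_comm])

/-- Left multiplication by `T_w`, as a product of operators along a reduced expression of `w`. -/
noncomputable def mulLeft (w : Equiv.Perm (Fin r)) : Hecke q r →ₗ[R] Hecke q r :=
  ((exists_reduced_word w).choose.map (opL q r)).prod

/-- Right multiplication by `T_w`, as a product of operators along a reduced expression. -/
noncomputable def mulRight (w : Equiv.Perm (Fin r)) : Hecke q r →ₗ[R] Hecke q r :=
  ((exists_reduced_word w).choose.reverse.map (opR q r)).prod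

theorem prod_opL_comm (l l' : List (Fin (r - 1))) (x : Hecke q r) :
    (l.map (opL q r)).prod ((l'.map (opR q r)).prod x) =
      (l'.map (opR q r)).prod ((l.map (opL q r)).prod x) := by
  have h1 : ∀ (j : Fin (r - 1)) (l' : List (Fin (r - 1))) (x : Hecke q r),
      opL q r j ((l'.map (opR q r)).prod x) = (l'.map (opR q r)).prod (opL q r j x) := by
    intro j l'
    induction l' with
    | nil => intro x; rfl
    | cons a l' ih =>
      intro x
      simp only [List.map_cons, List.prod_cons, Module.End.mul_apply, opL_opR, ih]
  induction l with
  | nil => rfl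
  | cons a l ih => simp only [List.map_cons, List.prod_cons, Module.End.mul_apply, ih, h1]

theorem prod_opL_one (l : List (Fin (r - 1))) (hl : l.length = length (l.map (adj r)).prod) :
    (l.map (opL q r)).prod (T q 1) = T q (l.map (adj r)).prod := by
  induction l with
  | nil => rfl
  | cons a l ih =>
    have h1 := length_prod_le l
    have h2 : length (adj r a * (l.map (adj r)).prod) ≤ length (l.map (adj r)).prod + 1 := by
      obtain ⟨l', h', h''⟩ := exists_reduced_word (l.map (adj r)).prod
      have := length_prod_le (a :: l')
      simpa [h', h''] using this
    simp only [List.map_cons, List.prod_cons, List.length_cons, Module.End.mul_apply] at hl ⊢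
    rw [ih (by omega), opL_T, if_pos (by omega)]

theorem prod_opR_one (l : List (Fin (r - 1))) (hl : l.length = length (l.map (adj r)).prod) :
    (l.reverse.map (opR q r)).prod (T q 1) = T q (l.map (adj r)).prod := by
  induction l using List.reverseRecOn with
  | nil => rfl
  | append_singleton l a ih =>
    have h1 := length_prod_le l
    have h2 : length ((l.map (adj r)).prod * adj r a) ≤ length (l.map (adj r)).prod + 1 := by
      obtain ⟨l', h', h''⟩ := exists_reduced_word (l.map (adj r)).prod
      have := length_prod_le (l' ++ [a])
      simpa [h', h''] using this
    simp only [List.map_append, List.prod_append, List.map_cons, List.map_nil, List.prod_cons,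
      List.prod_nil, mul_one, List.length_append, List.length_cons, List.length_nil,
      List.reverse_append, List.reverse_cons, List.reverse_nil, List.nil_append,
      List.cons_append, Module.End.mul_apply] at hl ⊢
    rw [ih (by omega), opR_T, if_pos (by omega)]

theorem mulLeft_one (w : Equiv.Perm (Fin r)) : mulLeft w (T q 1) = T q w := by
  obtain ⟨h1, h2⟩ := (exists_reduced_word w).choose_spec
  exact (prod_opL_one _ (by rw [h1, h2])).trans (by rw [h1])

theorem mulRight_one (w : Equiv.Perm (Fin r)) : mulRight w (T q 1) = T q w := by
  obtain ⟨h1, h2⟩ := (exists_reduced_word w).choose_spec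
  exact (prod_opR_one _ (by rw [h1, h2])).trans (by rw [h1])

theorem mulLeft_mulRight (u w : Equiv.Perm (Fin r)) (x : Hecke q r) :
    mulLeft u (mulRight w x) = mulRight w (mulLeft u x) := prod_opL_comm _ _ _

theorem mulLeft_T (u w : Equiv.Perm (Fin r)) : mulLeft u (T q w) = mulRight w (T q u) := by
  rw [← mulRight_one w, mulLeft_mulRight, mulLeft_one]

/-- The bilinear multiplication. -/
noncomputable def mulHom : Hecke q r →ₗ[R] Hecke q r →ₗ[R] Hecke q r :=
  (basis q r).constr R mulLeft

theorem mulHom_T_left (w : Equiv.Perm (Fin r)) (x : Hecke q r) :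
    mulHom (T q w) x = mulLeft w x :=
  LinearMap.congr_fun ((basis q r).constr_basis R mulLeft w) x

theorem mulHom_T_right (w : Equiv.Perm (Fin r)) (x : Hecke q r) :
    mulHom x (T q w) = mulRight w x := by
  suffices h : mulHom.flip (T q w) = mulRight w from LinearMap.congr_fun h x
  refine (basis q r).ext fun u => ?_
  exact (mulHom_T_left u (T q w)).trans (mulLeft_T u w)

noncomputable instance : Mul (Hecke q r) := ⟨fun x y => mulHom x y⟩

noncomputable instance : One (Hecke q r) := ⟨T q 1⟩

protected theorem mul_def (x y : Hecke q r) : x * y = mulHom x y := rfl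

protected theorem one_def : (1 : Hecke q r) = T q 1 := rfl

theorem mulHom_assoc (x y z : Hecke q r) :
    mulHom (mulHom x y) z = mulHom x (mulHom y z) := by
  have hx : ∀ (u w : Equiv.Perm (Fin r)) (y : Hecke q r),
      mulHom (mulHom (T q u) y) (T q w) = mulHom (T q u) (mulHom y (T q w)) := by
    intro u w y
    simp only [mulHom_T_left, mulHom_T_right, mulLeft_mulRight]
  have hz : ∀ (u : Equiv.Perm (Fin r)),
      mulHom (mulHom (T q u) y) = (mulHom (T q u)).comp (mulHom y) := fun u =>
    (basis q r).ext fun w => hx u w y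
  have h : (mulHom.flip z).comp (mulHom.flip y) = mulHom.flip (mulHom y z) :=
    (basis q r).ext fun u => LinearMap.congr_fun (hz u) z
  exact LinearMap.congr_fun h x

noncomputable instance : Ring (Hecke q r) where
  left_distrib x y z := map_add (mulHom x) y z
  right_distrib x y z := by
    simp only [Hecke.mul_def, map_add, LinearMap.add_apply]
  zero_mul x := by
    simp only [Hecke.mul_def, map_zero, LinearMap.zero_apply]
  mul_zero x := map_zero (mulHom x)
  mul_assoc := mulHom_assoc
  one_mul x := by
    have h : mulHom (T q (1 : Equiv.Perm (Fin r))) = LinearMap.id :=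
      (basis q r).ext fun w => (mulHom_T_right w _).trans (mulRight_one w)
    exact LinearMap.congr_fun h x
  mul_one x := by
    have h : mulHom.flip (T q (1 : Equiv.Perm (Fin r))) = LinearMap.id :=
      (basis q r).ext fun w => (mulHom_T_left w _).trans (mulLeft_one w)
    exact LinearMap.congr_fun h x
  neg_add_cancel := neg_add_cancel
  zsmul := fun a x => a • x
  zsmul_zero' := SubNegMonoid.zsmul_zero'
  zsmul_succ' := SubNegMonoid.zsmul_succ'
  zsmul_neg' := SubNegMonoid.zsmul_neg'
  nsmul := fun a x => a • x
  nsmul_zero := AddMonoid.nsmul_zero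
  nsmul_succ := AddMonoid.nsmul_succ
  sub_eq_add_neg := sub_eq_add_neg

noncomputable instance : Algebra R (Hecke q r) :=
  Algebra.ofModule
    (fun a x y => by simp only [Hecke.mul_def, map_smul, LinearMap.smul_apply])
    (fun a x y => by simp only [Hecke.mul_def, map_smul])

/-- The defining multiplication rule of the Hecke algebra. -/
theorem T_mul_T_adj (w : Equiv.Perm (Fin r)) (k : Fin (r - 1)) :
    T q w * T q (adj r k) = if length w < length (w * adj r k) then T q (w * adj r k)
      else ((q : R) - 1) • T q w + (q : R) • T q (w * adj r k) := by
  have h1 : opR q r k (T q 1) = T q (adj r k) := by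
    rw [opR_T, if_pos, one_mul]
    rw [length_lt_mul_adj]
    exact Nat.lt_succ_self _
  rw [Hecke.mul_def, mulHom_T_left, ← h1, ← opR_T, ← mulLeft_one w]
  exact prod_opL_comm (exists_reduced_word w).choose [k] (T q 1)

end Hecke

end HeckeAlgebra

section Parabolic

/-- The compositions of `r` with `N` (possibly zero) parts. -/
abbrev Composition (N r : ℕ) : Type := {l : Fin N → ℕ // ∑ i, l i = r}

variable {N r : ℕ}

/-- The `i`-th block of consecutive letters `l_0 + ⋯ + l_{i-1} ≤ p < l_0 + ⋯ + l_i`. -/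
def block (l : Composition N r) (i : Fin N) : Finset (Fin r) :=
  Finset.univ.filter fun p =>
    ∑ j ∈ Finset.Iio i, l.1 j ≤ (p : ℕ) ∧ (p : ℕ) < ∑ j ∈ Finset.Iic i, l.1 j

/-- The parabolic subgroup of permutations leaving every block invariant. -/
def parabolic (l : Composition N r) : Subgroup (Equiv.Perm (Fin r)) where
  carrier := {w | ∀ i p, w p ∈ block l i ↔ p ∈ block l i}
  one_mem' _ _ := Iff.rfl
  mul_mem' ha hb i p := (ha i _).trans (hb i p)
  inv_mem' {w} hw i p := by
    have := hw i (w⁻¹ p)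
    rwa [← Equiv.Perm.mul_apply, mul_inv_cancel, Equiv.Perm.one_apply, iff_comm] at this

/-- The permutations that fix every letter outside the set `X`. -/
def supportedOn (X : Set (Fin r)) : Subgroup (Equiv.Perm (Fin r)) where
  carrier := {w | ∀ p, p ∉ X → w p = p}
  one_mem' _ _ := rfl
  mul_mem' {a b} ha hb p hp := by rw [Equiv.Perm.mul_apply, hb p hp, ha p hp]
  inv_mem' {w} hw p hp := by rw [Equiv.Perm.inv_eq_iff_eq, hw p hp]

/-- The size of the even part of a composition with `m` even and `n` odd parts. -/
def evenSize {m n : ℕ} (l : Composition (m + n) r) : ℕ := ∑ i : Fin m, l.1 (Fin.castAdd n i)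

/-- The even part of the parabolic subgroup, acting on the first `evenSize l` letters. -/
def evenParabolic {m n : ℕ} (l : Composition (m + n) r) : Subgroup (Equiv.Perm (Fin r)) :=
  parabolic l ⊓ supportedOn {p | (p : ℕ) < evenSize l}

/-- The odd part of the parabolic subgroup, acting on the remaining letters. -/
def oddParabolic {m n : ℕ} (l : Composition (m + n) r) : Subgroup (Equiv.Perm (Fin r)) :=
  parabolic l ⊓ supportedOn {p | evenSize l ≤ (p : ℕ)}

/-- The conjugate `d⁻¹ K d` of a subgroup `K`. -/
def conjBy (K : Subgroup (Equiv.Perm (Fin r))) (d : Equiv.Perm (Fin r)) :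
    Subgroup (Equiv.Perm (Fin r)) :=
  K.comap (MulAut.conj d).toMonoidHom

/-- The shortest representatives of the right cosets `K w` of a subgroup `K`. -/
def shortest (K : Subgroup (Equiv.Perm (Fin r))) : Set (Equiv.Perm (Fin r)) :=
  {d | ∀ w ∈ K, length d ≤ length (w * d)}

/-- The shortest representatives of the double cosets `W_l w W_u`. -/
def doubleShortest (l u : Composition N r) : Set (Equiv.Perm (Fin r)) :=
  {d | d ∈ shortest (parabolic l) ∧ d⁻¹ ∈ shortest (parabolic u)}

/-- The shortest double coset representatives `d` for which the even part of `d⁻¹ W_l d` meets the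
odd part of `W_u` trivially, and the odd part of `d⁻¹ W_l d` meets the even part of `W_u`
trivially. -/
def superShortest {m n : ℕ} (l u : Composition (m + n) r) : Set (Equiv.Perm (Fin r)) :=
  {d | d ∈ doubleShortest l u ∧ conjBy (evenParabolic l) d ⊓ oddParabolic u = ⊥ ∧
    conjBy (oddParabolic l) d ⊓ evenParabolic u = ⊥}

/-- The matrix of a double coset: its `(i, j)` entry counts the letters of the `i`-th block of `l`
that lie in the image under `d` of the `j`-th block of `u`. -/
def cosetMatrix (l : Composition N r) (d : Equiv.Perm (Fin r)) (u : Composition N r) :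
    Matrix (Fin N) (Fin N) ℕ :=
  Matrix.of fun i j => (block l i ∩ (block u j).image d).card

/-- The matrices of the double cosets with representative in `superShortest`. -/
def superMatrices (m n r : ℕ) : Set (Matrix (Fin (m + n)) (Fin (m + n)) ℕ) :=
  {A | ∃ (l u : Composition (m + n) r) (d : Equiv.Perm (Fin r)),
    d ∈ superShortest l u ∧ cosetMatrix l d u = A}

end Parabolic

section SchurSuperalgebra

variable {R : Type*} [CommRing R] (q : Rˣ) {m n r : ℕ}

open scoped Classical in
/-- The sum of `T_w` over `w ∈ X`. -/
noncomputable def plainSum (X : Set (Equiv.Perm (Fin r))) : Hecke q r :=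
  ∑ w ∈ Finset.univ.filter (fun w => w ∈ X), Hecke.T q w

open scoped Classical in
/-- The sum of `(-q)^{-ℓ(w)} T_w` over `w ∈ X`. -/
noncomputable def signedSum (X : Set (Equiv.Perm (Fin r))) : Hecke q r :=
  ∑ w ∈ Finset.univ.filter (fun w => w ∈ X), (((-q)⁻¹ ^ length w : Rˣ) : R) • Hecke.T q w

/-- The generator `x_{l^{(0)}} y_{l^{(1)}}` of the module attached to `l`. -/
noncomputable def xy (l : Composition (m + n) r) : Hecke q r :=
  plainSum q (evenParabolic l : Set (Equiv.Perm (Fin r))) *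
    signedSum q (oddParabolic l : Set (Equiv.Perm (Fin r)))

/-- The right ideal of the Hecke algebra generated by `xy q l`, as a right module. -/
noncomputable abbrev xyIdeal (l : Composition (m + n) r) : Submodule (Hecke q r)ᵐᵒᵖ (Hecke q r) :=
  Submodule.span (Hecke q r)ᵐᵒᵖ {xy q l}

variable (m n r) in
/-- The tensor space, a right module over the Hecke algebra. -/
abbrev TensorSpace : Type _ := ⨁ l : Composition (m + n) r, xyIdeal q l

variable (m n r) in
/-- The `q`-Schur superalgebra: the endomorphism algebra of the tensor space. -/
abbrev SchurSuperalgebra : Type _ := Module.End (Hecke q r)ᵐᵒᵖ (TensorSpace q m n r)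

/-- For `D` the set of shortest representatives in `W_u` of the right cosets of
`d⁻¹ W_l d ∩ W_u`, the sum of `T_{w₀} (-q)^{-ℓ(w₁)} T_{w₁}` over the pairs of an element `w₀` of
the even part of `D` and an element `w₁` of the odd part of `D`. -/
noncomputable def tailSum (l : Composition (m + n) r) (d : Equiv.Perm (Fin r))
    (u : Composition (m + n) r) : Hecke q r :=
  plainSum q (shortest (conjBy (parabolic l) d ⊓ parabolic u) ∩ evenParabolic u) *
    signedSum q (shortest (conjBy (parabolic l) d ⊓ parabolic u) ∩ oddParabolic u)

/-- The element `T_{W_l d W_u}` of the Hecke algebra. -/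
noncomputable def cosetSum (l : Composition (m + n) r) (d : Equiv.Perm (Fin r))
    (u : Composition (m + n) r) : Hecke q r :=
  xy q l * Hecke.T q d * tailSum q l d u

theorem xy_mul_mem (l : Composition (m + n) r) (x : Hecke q r) : xy q l * x ∈ xyIdeal q l :=
  Submodule.mem_span_singleton.mpr ⟨MulOpposite.op x, rfl⟩

theorem cosetSum_mul_mem (l : Composition (m + n) r) (d : Equiv.Perm (Fin r))
    (u : Composition (m + n) r) (x : Hecke q r) : cosetSum q l d u * x ∈ xyIdeal q l := by
  rw [cosetSum, mul_assoc, mul_assoc]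
  exact xy_mul_mem q l _

open scoped Classical in
/-- The endomorphism `f` sends `[xy]_a h` to `T_{W_l d W_u} h` if `a = u` and to `0` otherwise. -/
def IsCosetMap (l : Composition (m + n) r) (d : Equiv.Perm (Fin r))
    (u : Composition (m + n) r) (f : SchurSuperalgebra q m n r) : Prop :=
  ∀ (a : Composition (m + n) r) (x : Hecke q r),
    f (DirectSum.of (fun l => xyIdeal q l) a ⟨xy q a * x, xy_mul_mem q a x⟩) =
      if u = a then
        DirectSum.of (fun l => xyIdeal q l) l ⟨cosetSum q l d u * x, cosetSum_mul_mem q l d u x⟩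
      else 0

/-- There is at most one such endomorphism. -/
theorem IsCosetMap.unique {l u : Composition (m + n) r} {d : Equiv.Perm (Fin r)}
    {f g : SchurSuperalgebra q m n r} (hf : IsCosetMap q l d u f) (hg : IsCosetMap q l d u g) :
    f = g := by
  refine LinearMap.toAddMonoidHom_injective (DirectSum.addHom_ext fun a y => ?_)
  obtain ⟨y, hy⟩ := y
  obtain ⟨c, rfl⟩ := Submodule.mem_span_singleton.mp hy
  exact (hf a c.unop).trans (hg a c.unop).symm

open scoped Classical in
/-- The double coset map: the (unique) endomorphism `f` with `IsCosetMap q l d u f`. -/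
noncomputable def cosetMap (l : Composition (m + n) r) (d : Equiv.Perm (Fin r))
    (u : Composition (m + n) r) : SchurSuperalgebra q m n r :=
  if h : ∃ f : SchurSuperalgebra q m n r, IsCosetMap q l d u f then h.choose else 0

open scoped Classical in
/-- The basis element `φ_A` for `A ∈ superMatrices m n r`, that is, the double coset map of the
triple with matrix `A`; by convention `φ_A = 0` for all other matrices. -/
noncomputable def phi (r : ℕ) (A : Matrix (Fin (m + n)) (Fin (m + n)) ℕ) :
    SchurSuperalgebra q m n r :=
  if h : ∃ t : Composition (m + n) r × Equiv.Perm (Fin r) × Composition (m + n) r,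
      t.2.1 ∈ superShortest t.1 t.2.2 ∧ cosetMatrix t.1 t.2.1 t.2.2 = A then
    cosetMap q h.choose.1 h.choose.2.1 h.choose.2.2
  else 0

end SchurSuperalgebra

section Coefficients

/-- The indeterminate `υ` of `ℤ[υ, υ⁻¹]`, as a unit. -/
noncomputable def upsilon : ℤ[T;T⁻¹]ˣ where
  val := LaurentPolynomial.T 1
  inv := LaurentPolynomial.T (-1)
  val_inv := by rw [← LaurentPolynomial.T_add]; simp
  inv_val := by rw [← LaurentPolynomial.T_add]; simp

/-- The parameter `q = υ ^ 2`. -/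
noncomputable def qq : ℤ[T;T⁻¹]ˣ := upsilon ^ 2

variable {m n : ℕ}

/-- `1` at an even index, `-q⁻¹` at an odd index. -/
noncomputable def qDot (i : Fin (m + n)) : ℤ[T;T⁻¹]ˣ := if (i : ℕ) < m then 1 else -qq⁻¹

/-- `q` at an even index, `-1` at an odd index. -/
noncomputable def qDDot (i : Fin (m + n)) : ℤ[T;T⁻¹]ˣ := if (i : ℕ) < m then qq else -1

/-- `υ` at an even index, `υ⁻¹` at an odd index. -/
noncomputable def upsilonAt (i : Fin (m + n)) : ℤ[T;T⁻¹]ˣ :=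
  if (i : ℕ) < m then upsilon else upsilon⁻¹

/-- `υ_i ^ 2`. -/
noncomputable def qAt (i : Fin (m + n)) : ℤ[T;T⁻¹]ˣ := upsilonAt i ^ 2

/-- The Gaussian integer `1 + x + ⋯ + x ^ (a - 1)`. -/
noncomputable def gaussInt (a : ℕ) (x : ℤ[T;T⁻¹]) : ℤ[T;T⁻¹] := ∑ i ∈ Finset.range a, x ^ i

/-- `A - E_{g,k} + E_{h,k}`: one unit moves from row `g` to row `h` in column `k`. Used only if the
`(g, k)` entry of `A` is positive. -/
def moveUnit {N : ℕ} (A : Matrix (Fin N) (Fin N) ℕ) (g h k : Fin N) : Matrix (Fin N) (Fin N) ℕ :=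
  A + Matrix.single h k 1 - Matrix.single g k 1

/-- The matrix `D` is `E_{h,g}` plus a diagonal matrix. -/
def IsDiagPlus {N : ℕ} (D : Matrix (Fin N) (Fin N) ℕ) (h g : Fin N) : Prop :=
  (D.map (Nat.cast : ℕ → ℤ) - Matrix.single h g 1).IsDiag

end Coefficients

end QSchur

/-!
The Hecke algebra acts on the permutation basis so simply that every element in sight can be
described by its coefficients. Call `z` a bi-eigenvector for the compositions `l` and `u` if
`T_s z = q z` or `T_s z = -z` for the basic transpositions `s` of the even or odd part of `W_l`,
and likewise on the right for `u` (`leftEigen`, `rightEigen`). These conditions say how the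
coefficient changes along `w ↦ s w` and `w ↦ w s`, so a bi-eigenvector is determined by its
coefficients at the shortest double coset representatives. At a representative that violates the
parity condition the two rules contradict each other and the coefficient vanishes, because `1 + q` is not a zero divisor
(`eq_of_leftEigen_of_rightEigen`).

The element `T_{W_l d W_u}` is the bi-eigenvector with coefficient `1` at `d` and support
`W_l d W_u`; its coefficient at `v` is `(-q)^{-a}`, where `a` counts the inversions of `v` inside
odd blocks, of `u` before or of `l` after applying `v` (`cosetSum_eq_superSum`). Every element with
the right-hand eigenvector property for `u` is a left multiple `h [xy]_u` with an explicit `h`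
(`leftFactor_mul_xy`), and left multiplication by `h` is the double coset map. It depends on the
matrix only, since the matrix determines `l`, `d` and `u` (`eq_of_cosetMatrix_eq`).

For the multiplication formulas, `D` is the matrix of the trivial permutation between two
compositions that differ by moving one letter `b` from one block to a neighbouring one
(`MoveLetter`). The product of the two maps is represented by the bi-eigenvector
`h T_{W_e d W_u}`, with `h` the factor of `D`, and both sides of a formula agree as soon as their
coefficients at shortest representatives `d'` agree. Here `h` is a sum over the cycles `cyc b t`
that take `b` to a letter `t` of the enlarged block, and at a shortest `d'` the product
`T_{cyc b t} z` has the coefficient `q^{length (cyc b t)}` times that of `z` at `(cyc b t)⁻¹ d'`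
(`coeff_T_mul`). The letter `t` lies in one column `k` of the matrix; the coefficient is nonzero
only if the matrix of `d'` is that of the `k`-th summand, and counting inversions
(`length_cyc_eq`, `card_oddInv_cyc`) gives the powers in the formula, while the letters `t` of a
common column contribute the successive terms of the Gaussian integer (`coeff_product`).
-/

open scoped DirectSum LaurentPolynomial

namespace QSchur

/-! ### Lengths and Young subgroups -/

section Young

variable {r : ℕ}

theorem inv_apply_self (d : Equiv.Perm (Fin r)) (p : Fin r) : d⁻¹ (d p) = p :=
  d.symm_apply_apply p

theorem apply_inv_self (d : Equiv.Perm (Fin r)) (p : Fin r) : d (d⁻¹ p) = p :=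
  d.apply_symm_apply p

/-- Lengths add up as soon as no pair of letters is inverted both by `x` and by `w⁻¹`. -/
theorem length_mul_of_forall (x w : Equiv.Perm (Fin r))
    (h : ∀ i j, i < j → x j < x i → w⁻¹ i < w⁻¹ j) :
    length (x * w) = length x + length w := by
  have key : inversions (x * w) =
      (inversions x).map ((w⁻¹).prodCongr w⁻¹).toEmbedding ∪ inversions w := by
    ext ⟨i, j⟩
    have e : ((i, j) ∈ (inversions x).map ((w⁻¹).prodCongr w⁻¹).toEmbedding) ↔
        (w i < w j ∧ x (w j) < x (w i)) := by
      rw [Finset.mem_map_equiv]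
      exact mem_inversions
    rw [Finset.mem_union, e, mem_inversions, mem_inversions, Equiv.Perm.mul_apply,
      Equiv.Perm.mul_apply]
    constructor
    · rintro ⟨h1, h2⟩
      rcases lt_trichotomy (w i) (w j) with h3 | h3 | h3
      · exact Or.inl ⟨h3, h2⟩
      · exact absurd (w.injective h3) h1.ne
      · exact Or.inr ⟨h1, h3⟩
    · rintro (⟨h1, h2⟩ | ⟨h1, h2⟩)
      · have := h _ _ h1 h2
        simp only [inv_apply_self] at this
        exact ⟨this, h2⟩
      · refine ⟨h1, ?_⟩
        by_contra h3
        have h4 : x (w i) < x (w j) :=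
          lt_of_le_of_ne (not_lt.1 h3) fun h5 => h1.ne (w.injective (x.injective h5))
        have := h _ _ h2 h4
        simp only [inv_apply_self] at this
        exact lt_asymm this h1
  rw [length_eq_card_inversions, key, Finset.card_union_of_disjoint, Finset.card_map,
    ← length_eq_card_inversions, ← length_eq_card_inversions]
  rw [Finset.disjoint_left]
  rintro ⟨i, j⟩ h1 h2
  rw [Finset.mem_map_equiv] at h1
  exact lt_asymm (mem_inversions.1 h1).1 (mem_inversions.1 h2).2

theorem eq_one_of_length_eq_zero {w : Equiv.Perm (Fin r)} (h : length w = 0) : w = 1 := by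
  obtain ⟨l, hl, hl'⟩ := exists_reduced_word w
  rw [h, List.length_eq_zero_iff] at hl'
  subst hl'
  exact hl.symm

/-- The subgroup `K` consists of the permutations preserving the labelling `c`, whose fibres are
intervals. -/
structure IsYoung {X : Type*} (K : Subgroup (Equiv.Perm (Fin r))) (c : Fin r → X) : Prop where
  mem_iff : ∀ w, w ∈ K ↔ ∀ p, c (w p) = c p
  convex : ∀ i j k, i ≤ j → j ≤ k → c i = c k → c i = c j

namespace IsYoung

variable {X : Type*} {K : Subgroup (Equiv.Perm (Fin r))} {c : Fin r → X}

theorem lt_of_ne (hK : IsYoung K c) {w : Equiv.Perm (Fin r)} (hw : w ∈ K) {i j : Fin r}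
    (hij : i < j) (hc : c i ≠ c j) : w i < w j := by
  have hi := (hK.mem_iff w).1 hw i
  have hj := (hK.mem_iff w).1 hw j
  by_contra h
  rw [not_lt] at h
  rcases le_total (w j) i with h1 | h1
  · exact hc ((hK.convex _ _ _ h1 hij.le hj).symm.trans hj)
  · exact hc ((hK.convex _ _ _ h1 h hi.symm).trans hj)

theorem adj_mem (hK : IsYoung K c) (k : Fin (r - 1))
    (h : c ⟨k, by omega⟩ = c ⟨k + 1, by omega⟩) : adj r k ∈ K := by
  rw [hK.mem_iff]
  intro p
  rw [adj, Equiv.swap_apply_def]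
  split_ifs with h1 h2
  · rw [h1, h]
  · rw [h2, h]
  · rfl

theorem eq_of_adj_mem (hK : IsYoung K c) {k : Fin (r - 1)} (h : adj r k ∈ K) :
    c ⟨k, by omega⟩ = c ⟨k + 1, by omega⟩ := by
  have := (hK.mem_iff _).1 h ⟨k, by omega⟩
  rw [← this]
  simp [adj]

theorem lt_of_forall_adj (hK : IsYoung K c) {w : Equiv.Perm (Fin r)}
    (hw : ∀ k : Fin (r - 1), adj r k ∈ K → length w < length (adj r k * w)) (i j : Fin r)
    (hij : i < j) (hc : c i = c j) : w⁻¹ i < w⁻¹ j := by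
  obtain ⟨j, hj⟩ := j
  induction j with
  | zero => exact absurd hij (Nat.not_lt_zero _)
  | succ j ih =>
    have hle : i ≤ ⟨j, by omega⟩ := Nat.lt_succ_iff.1 hij
    have hc' : c i = c ⟨j, by omega⟩ := hK.convex _ _ _ hle (Nat.le_succ j) hc
    have h1 : w⁻¹ ⟨j, by omega⟩ < w⁻¹ ⟨j + 1, hj⟩ :=
      (length_lt_adj_mul w ⟨j, by omega⟩).1
        (hw ⟨j, by omega⟩ (hK.adj_mem ⟨j, by omega⟩ (hc'.symm.trans hc)))
    rcases hle.lt_or_eq with h2 | h2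
    · exact (ih (by omega) h2 hc').trans h1
    · rw [h2]
      exact h1

theorem length_mul_of_forall_lt (hK : IsYoung K c) {x w : Equiv.Perm (Fin r)} (hx : x ∈ K)
    (hw : ∀ i j, i < j → c i = c j → w⁻¹ i < w⁻¹ j) :
    length (x * w) = length x + length w := by
  refine length_mul_of_forall x w fun i j hij hlt => hw i j hij ?_
  by_contra hc
  exact lt_asymm hlt (hK.lt_of_ne hx hij hc)

/-- The shortest coset representatives are the permutations whose inverse is increasing on each
fibre of the labelling. -/
theorem mem_shortest_iff (hK : IsYoung K c) {w : Equiv.Perm (Fin r)} :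
    w ∈ shortest K ↔ ∀ i j, i < j → c i = c j → w⁻¹ i < w⁻¹ j := by
  constructor
  · intro h
    refine hK.lt_of_forall_adj fun k hk => ?_
    rw [length_lt_adj_mul]
    rcases adj_trichotomy w⁻¹ k with h1 | h1
    · exact h1
    · have h2 := h _ hk
      have h3 := inversions_mul_adj' w⁻¹ k h1
      rw [← length_eq_card_inversions, ← length_eq_card_inversions, length_inv, ← length_inv,
        mul_inv_rev, adj_inv, inv_inv] at h3
      omega
  · intro h x hx
    rw [hK.length_mul_of_forall_lt hx h]
    omega

theorem mem_shortest_of_forall_adj (hK : IsYoung K c) {w : Equiv.Perm (Fin r)}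
    (hw : ∀ k : Fin (r - 1), adj r k ∈ K → length w < length (adj r k * w)) : w ∈ shortest K :=
  hK.mem_shortest_iff.2 (hK.lt_of_forall_adj hw)

theorem length_mul (hK : IsYoung K c) {x w : Equiv.Perm (Fin r)} (hx : x ∈ K)
    (hw : w ∈ shortest K) : length (x * w) = length x + length w :=
  hK.length_mul_of_forall_lt hx (hK.mem_shortest_iff.1 hw)

theorem length_mul' (hK : IsYoung K c) {x w : Equiv.Perm (Fin r)} (hx : x ∈ K)
    (hw : w⁻¹ ∈ shortest K) : length (w * x) = length w + length x := by
  rw [← length_inv, mul_inv_rev, hK.length_mul (K.inv_mem hx) hw, length_inv, length_inv, add_comm]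

/-- A coset contains only one shortest element. -/
theorem eq_one_of_mem_shortest (hK : IsYoung K c) {x w : Equiv.Perm (Fin r)} (hx : x ∈ K)
    (hw : w ∈ shortest K) (hxw : x * w ∈ shortest K) : x = 1 := by
  have h1 := hK.length_mul hx hw
  have h2 := hxw x⁻¹ (K.inv_mem hx)
  rw [inv_mul_cancel_left] at h2
  exact eq_one_of_length_eq_zero (by omega)

end IsYoung

end Young

/-! ### Blocks and matrices of double cosets -/

section Blocks

variable {N r : ℕ}

/-- The sum of the first `a` parts of `l`. -/
def partialSum (l : Fin N → ℕ) (a : ℕ) : ℕ :=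
  ∑ j ∈ Finset.univ.filter (fun j : Fin N => (j : ℕ) < a), l j

theorem partialSum_mono (l : Fin N → ℕ) : Monotone (partialSum l) := fun a b hab =>
  Finset.sum_le_sum_of_subset fun j hj => by
    simp only [Finset.mem_filter, Finset.mem_univ, true_and] at hj ⊢
    omega

theorem partialSum_succ (l : Fin N → ℕ) (i : Fin N) :
    partialSum l (i + 1) = partialSum l i + l i := by
  rw [partialSum, partialSum]
  have : (Finset.univ.filter fun j : Fin N => (j : ℕ) < i + 1) =
      insert i (Finset.univ.filter fun j : Fin N => (j : ℕ) < i) := by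
    ext j
    simp only [Finset.mem_filter, Finset.mem_univ, true_and, Finset.mem_insert, Fin.ext_iff]
    omega
  rw [this, Finset.sum_insert (by simp), add_comm]

theorem partialSum_card (l : Composition N r) : partialSum l.1 N = r := by
  rw [partialSum, Finset.filter_true_of_mem fun j _ => j.2]
  exact l.2

theorem mem_block {l : Composition N r} {i : Fin N} {p : Fin r} :
    p ∈ block l i ↔ partialSum l.1 i ≤ p ∧ (p : ℕ) < partialSum l.1 (i + 1) := by
  have h1 : Finset.Iio i = Finset.univ.filter fun j : Fin N => (j : ℕ) < i := by
    ext j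
    rw [Finset.mem_Iio, Finset.mem_filter, Fin.lt_def]
    simp
  have h2 : Finset.Iic i = Finset.univ.filter fun j : Fin N => (j : ℕ) < i + 1 := by
    ext j
    rw [Finset.mem_Iic, Finset.mem_filter, Fin.le_def, Nat.lt_succ_iff]
    simp
  rw [block, Finset.mem_filter, h1, h2]
  simp [partialSum]

theorem exists_mem_block (l : Composition N r) (p : Fin r) : ∃ i, p ∈ block l i := by
  have hex : ∃ a, (p : ℕ) < partialSum l.1 a := ⟨N, by rw [partialSum_card]; exact p.2⟩
  classical
  have h1 := Nat.find_spec hex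
  have h2 : Nat.find hex ≤ N := Nat.find_min' hex (by rw [partialSum_card]; exact p.2)
  have h3 : Nat.find hex ≠ 0 := fun h => by
    rw [h] at h1
    simp [partialSum] at h1
  obtain ⟨a, ha⟩ := Nat.exists_eq_succ_of_ne_zero h3
  refine ⟨⟨a, by omega⟩, mem_block.2 ⟨?_, by simpa [ha] using h1⟩⟩
  exact not_lt.1 (Nat.find_min hex (m := a) (by omega))

/-- The index of the block containing the letter `p`. -/
noncomputable def row (l : Composition N r) (p : Fin r) : Fin N := (exists_mem_block l p).choose

theorem mem_block_row (l : Composition N r) (p : Fin r) : p ∈ block l (row l p) :=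
  (exists_mem_block l p).choose_spec

theorem le_of_mem_block {l : Composition N r} {i j : Fin N} {p p' : Fin r} (hp : p ∈ block l i)
    (hp' : p' ∈ block l j) (h : p ≤ p') : i ≤ j := by
  by_contra hij
  have h1 := partialSum_mono l.1 (show (j : ℕ) + 1 ≤ i by rw [not_le, Fin.lt_def] at hij; omega)
  rw [mem_block] at hp hp'
  rw [Fin.le_def] at h
  omega

theorem row_eq_iff {l : Composition N r} {p : Fin r} {i : Fin N} : row l p = i ↔ p ∈ block l i :=
  ⟨fun h => h ▸ mem_block_row l p, fun h =>
    le_antisymm (le_of_mem_block (mem_block_row l p) h le_rfl)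
      (le_of_mem_block h (mem_block_row l p) le_rfl)⟩

theorem row_mono (l : Composition N r) : Monotone (row l) := fun p p' h =>
  le_of_mem_block (mem_block_row l p) (mem_block_row l p') h

theorem row_lt_iff {l : Composition N r} {p : Fin r} {a : ℕ} :
    (row l p : ℕ) < a ↔ (p : ℕ) < partialSum l.1 a := by
  have h := mem_block.1 (mem_block_row l p)
  constructor
  · intro h1
    exact h.2.trans_le (partialSum_mono l.1 h1)
  · intro h1
    by_contra h2
    have := partialSum_mono l.1 (not_lt.1 h2)
    omega

theorem isYoung_parabolic (l : Composition N r) : IsYoung (parabolic l) (row l) where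
  mem_iff w := by
    constructor
    · intro h p
      exact row_eq_iff.2 ((h _ p).2 (mem_block_row l p))
    · intro h i p
      rw [← row_eq_iff, ← row_eq_iff, h]
  convex i j k hij hjk h :=
    le_antisymm (row_mono l hij) (h ▸ row_mono l hjk)

theorem card_block (l : Composition N r) (i : Fin N) : (block l i).card = l.1 i := by
  have h : (block l i).map Fin.valEmbedding =
      Finset.Ico (partialSum l.1 i) (partialSum l.1 (i + 1)) := by
    ext a
    simp only [Finset.mem_map, mem_block, Fin.valEmbedding_apply, Finset.mem_Ico]
    constructor
    · rintro ⟨p, hp, rfl⟩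
      exact hp
    · intro ha
      have h1 := partialSum_mono l.1 (Nat.succ_le_of_lt i.2)
      rw [partialSum_card] at h1
      exact ⟨⟨a, ha.2.trans_le h1⟩, ha, rfl⟩
  rw [← Finset.card_map, h, Nat.card_Ico, partialSum_succ]
  omega

theorem mem_doubleShortest_iff {l u : Composition N r} {d : Equiv.Perm (Fin r)} :
    d ∈ doubleShortest l u ↔ (∀ i j, i < j → row l i = row l j → d⁻¹ i < d⁻¹ j) ∧
      ∀ i j, i < j → row u i = row u j → d i < d j := by
  rw [doubleShortest, Set.mem_ofPred_eq, (isYoung_parabolic l).mem_shortest_iff,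
    (isYoung_parabolic u).mem_shortest_iff, inv_inv]

theorem isYoung_inf {l u : Composition N r} {d : Equiv.Perm (Fin r)}
    (hd : d ∈ doubleShortest l u) :
    IsYoung (conjBy (parabolic l) d ⊓ parabolic u) fun p => (row l (d p), row u p) where
  mem_iff w := by
    have h : w ∈ conjBy (parabolic l) d ↔ ∀ p, row l (d (w p)) = row l (d p) := by
      change d * w * d⁻¹ ∈ parabolic l ↔ _
      rw [(isYoung_parabolic l).mem_iff]
      constructor
      · intro h p
        simpa using h (d p)
      · intro h p
        simpa using h (d⁻¹ p)
    rw [Subgroup.mem_inf, h, (isYoung_parabolic u).mem_iff]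
    simp only [Prod.mk.injEq, forall_and]
  convex i j k hij hjk h := by
    simp only [Prod.mk.injEq] at h ⊢
    have hu := (isYoung_parabolic u).convex i j k hij hjk h.2
    refine ⟨?_, hu⟩
    have hd' := (mem_doubleShortest_iff.1 hd).2
    have h1 : d i ≤ d j := by
      rcases hij.lt_or_eq with h1 | h1
      · exact (hd' i j h1 hu).le
      · rw [h1]
    have h2 : d j ≤ d k := by
      rcases hjk.lt_or_eq with h2 | h2
      · exact (hd' j k h2 (hu.symm.trans h.2)).le
      · rw [h2]
    exact (isYoung_parabolic l).convex _ _ _ h1 h2 h.1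

theorem cosetMatrix_apply (l : Composition N r) (d : Equiv.Perm (Fin r)) (u : Composition N r)
    (i j : Fin N) : cosetMatrix l d u i j =
      (Finset.univ.filter fun p => row l (d p) = i ∧ row u p = j).card := by
  symm
  rw [cosetMatrix, Matrix.of_apply, ← Finset.card_map d.toEmbedding]
  congr 1
  ext p
  simp only [Finset.mem_inter, Finset.mem_image, Finset.mem_map, Finset.mem_filter,
    Finset.mem_univ, true_and, Equiv.coe_toEmbedding, row_eq_iff]
  constructor
  · rintro ⟨p, ⟨h1, h2⟩, rfl⟩
    exact ⟨h1, p, h2, rfl⟩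
  · rintro ⟨h1, p, h2, rfl⟩
    exact ⟨p, ⟨h1, h2⟩, rfl⟩

theorem sum_cosetMatrix_row (l : Composition N r) (d : Equiv.Perm (Fin r)) (u : Composition N r)
    (i : Fin N) : ∑ j, cosetMatrix l d u i j = l.1 i := by
  simp only [cosetMatrix_apply]
  rw [← card_block l i, ← Finset.card_map d⁻¹.toEmbedding,
    Finset.card_eq_sum_card_fiberwise (f := row u) (t := Finset.univ) (by simp)]
  refine Finset.sum_congr rfl fun j _ => congrArg Finset.card ?_
  ext p
  simp only [Finset.mem_filter, Finset.mem_univ, true_and, Finset.mem_map_equiv, row_eq_iff]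
  rfl

theorem sum_cosetMatrix_col (l : Composition N r) (d : Equiv.Perm (Fin r)) (u : Composition N r)
    (j : Fin N) : ∑ i, cosetMatrix l d u i j = u.1 j := by
  simp only [cosetMatrix_apply]
  rw [← card_block u j, Finset.card_eq_sum_card_fiberwise (f := fun p => row l (d p))
    (t := Finset.univ) (by simp)]
  refine Finset.sum_congr rfl fun i _ => congrArg Finset.card ?_
  ext p
  simp only [Finset.mem_filter, Finset.mem_univ, true_and, row_eq_iff, and_comm]

theorem cosetMatrix_mul_right (l : Composition N r) (d : Equiv.Perm (Fin r))
    {u : Composition N r} {y : Equiv.Perm (Fin r)} (hy : y ∈ parabolic u) :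
    cosetMatrix l (d * y) u = cosetMatrix l d u := by
  ext i j
  rw [cosetMatrix_apply, cosetMatrix_apply, ← Finset.card_map y.toEmbedding]
  congr 1
  ext p
  simp only [Finset.mem_filter, Finset.mem_univ, true_and, Finset.mem_map_equiv]
  rw [← (isYoung_parabolic u).mem_iff y |>.1 hy (y.symm p)]
  simp

theorem cosetMatrix_mul_left {l : Composition N r} (d : Equiv.Perm (Fin r))
    (u : Composition N r) {x : Equiv.Perm (Fin r)} (hx : x ∈ parabolic l) :
    cosetMatrix l (x * d) u = cosetMatrix l d u := by
  ext i j
  simp only [cosetMatrix_apply, Equiv.Perm.mul_apply, (isYoung_parabolic l).mem_iff x |>.1 hx]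

theorem cosetMatrix_inv (l : Composition N r) (d : Equiv.Perm (Fin r)) (u : Composition N r) :
    cosetMatrix u d⁻¹ l = (cosetMatrix l d u).transpose := by
  ext i j
  rw [Matrix.transpose_apply, cosetMatrix_apply, cosetMatrix_apply,
    ← Finset.card_map d⁻¹.toEmbedding]
  congr 1
  ext p
  simp only [Finset.mem_map_equiv, Finset.mem_filter, Finset.mem_univ, true_and]
  change row u (d⁻¹ (d p)) = i ∧ row l (d p) = j ↔ _
  rw [inv_apply_self, and_comm]

/-- A permutation `d` that is increasing on the blocks of `u` distributes the letters of every
block of `u` to the blocks of `l` in increasing order, so that the matrix determines the block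
of `d p` for every letter `p`. -/
theorem row_eq_of_cosetMatrix_eq {l u : Composition N r} {d d' : Equiv.Perm (Fin r)}
    (hd : d⁻¹ ∈ shortest (parabolic u)) (hd' : d'⁻¹ ∈ shortest (parabolic u))
    (h : cosetMatrix l d u = cosetMatrix l d' u) (p : Fin r) : row l (d p) = row l (d' p) := by
  rw [(isYoung_parabolic u).mem_shortest_iff, inv_inv] at hd hd'
  have key : ∀ d : Equiv.Perm (Fin r), ∀ i,
      (Finset.univ.filter fun p' => row u p' = row u p ∧ row l (d p') ≤ i).card =
        ∑ i' ∈ Finset.Iic i, cosetMatrix l d u i' (row u p) := by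
    intro d i
    simp only [cosetMatrix_apply]
    rw [Finset.card_eq_sum_card_fiberwise (f := fun p => row l (d p)) (t := Finset.Iic i)]
    · refine Finset.sum_congr rfl fun i' hi' => congrArg Finset.card ?_
      ext p'
      simp only [Finset.mem_filter, Finset.mem_univ, true_and, Finset.mem_Iic] at hi' ⊢
      constructor
      · rintro ⟨⟨h1, -⟩, h2⟩
        exact ⟨h2, h1⟩
      · rintro ⟨h1, h2⟩
        exact ⟨⟨h2, h1 ▸ hi'⟩, h1⟩
    · intro p' hp'
      simpa using (Finset.mem_filter.1 hp').2.2
  have step : ∀ d d' : Equiv.Perm (Fin r), (∀ i j, i < j → row u i = row u j → d i < d j) →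
      (∀ i j, i < j → row u i = row u j → d' i < d' j) →
      cosetMatrix l d u = cosetMatrix l d' u → row l (d' p) ≤ row l (d p) := by
    intro d d' hd hd' h
    by_contra hlt
    rw [not_le] at hlt
    refine absurd ((key d (row l (d p))).trans (h ▸ (key d' (row l (d p))).symm)) (ne_of_gt ?_)
    refine Finset.card_lt_card (Finset.ssubset_iff_subset_ne.2 ⟨?_, ?_⟩)
    · intro p' hp'
      simp only [Finset.mem_filter, Finset.mem_univ, true_and] at hp' ⊢
      refine ⟨hp'.1, row_mono l ?_⟩
      rcases lt_trichotomy p' p with h1 | h1 | h1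
      · exact (hd _ _ h1 hp'.1).le
      · rw [h1]
      · have h2 := row_mono l (hd' _ _ h1 hp'.1.symm).le
        exact absurd (h2.trans hp'.2) (not_le.2 hlt)
    · intro he
      have : p ∈ Finset.univ.filter fun p' => row u p' = row u p ∧ row l (d' p') ≤ row l (d p) := by
        rw [he]
        simp
      simp only [Finset.mem_filter, Finset.mem_univ, true_and] at this
      exact absurd this (not_le.2 hlt)
  exact le_antisymm (step d' d hd' hd h.symm) (step d d' hd hd' h)

theorem eq_of_cosetMatrix_eq {l u : Composition N r} {d d' : Equiv.Perm (Fin r)}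
    (hd : d ∈ doubleShortest l u) (hd' : d' ∈ doubleShortest l u)
    (h : cosetMatrix l d u = cosetMatrix l d' u) : d = d' := by
  have h1 : d' * d⁻¹ ∈ parabolic l := by
    rw [(isYoung_parabolic l).mem_iff]
    intro p
    have := row_eq_of_cosetMatrix_eq hd.2 hd'.2 h (d⁻¹ p)
    rw [apply_inv_self] at this
    exact this.symm
  have h2 := (isYoung_parabolic l).eq_one_of_mem_shortest h1 hd.1
    (by rw [inv_mul_cancel_right]; exact hd'.1)
  exact (mul_inv_eq_one.1 h2).symm

end Blocks

section Parity

variable {m n r : ℕ}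

theorem lt_evenSize_iff {l : Composition (m + n) r} {p : Fin r} :
    (p : ℕ) < evenSize l ↔ (row l p : ℕ) < m := by
  rw [row_lt_iff, evenSize, partialSum]
  have : (Finset.univ.filter fun j : Fin (m + n) => (j : ℕ) < m) =
      Finset.univ.map (Fin.castAddEmb n) := by
    ext j
    simp only [Finset.mem_filter, Finset.mem_univ, true_and, Finset.mem_map]
    constructor
    · intro h
      exact ⟨⟨j, h⟩, rfl⟩
    · rintro ⟨a, rfl⟩
      exact a.2
  rw [this, Finset.sum_map]
  rfl

theorem mem_evenParabolic {l : Composition (m + n) r} {x : Equiv.Perm (Fin r)} :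
    x ∈ evenParabolic l ↔ x ∈ parabolic l ∧ ∀ p, m ≤ (row l p : ℕ) → x p = p := by
  rw [evenParabolic, Subgroup.mem_inf]
  refine and_congr_right fun _ => forall_congr' fun p => ?_
  rw [Set.mem_ofPred_eq, lt_evenSize_iff, not_lt]

theorem mem_oddParabolic {l : Composition (m + n) r} {x : Equiv.Perm (Fin r)} :
    x ∈ oddParabolic l ↔ x ∈ parabolic l ∧ ∀ p, (row l p : ℕ) < m → x p = p := by
  rw [oddParabolic, Subgroup.mem_inf]
  refine and_congr_right fun _ => forall_congr' fun p => ?_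
  rw [Set.mem_ofPred_eq, ← not_lt, not_not, lt_evenSize_iff]

/-- Two letters in a common block of `u` with images in a common block of `l` exist only for
blocks of the same parity. -/
def ParityCompatible (l : Composition (m + n) r) (v : Equiv.Perm (Fin r))
    (u : Composition (m + n) r) : Prop :=
  ∀ p p', p ≠ p' → row u p = row u p' → row l (v p) = row l (v p') →
    ((row u p : ℕ) < m ↔ (row l (v p) : ℕ) < m)

theorem mem_superShortest_iff {l u : Composition (m + n) r} {d : Equiv.Perm (Fin r)} :
    d ∈ superShortest l u ↔ d ∈ doubleShortest l u ∧ ParityCompatible l d u := by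
  refine and_congr_right fun hd => ?_
  have mem_conj : ∀ (K : Subgroup (Equiv.Perm (Fin r))) x,
      x ∈ conjBy K d ↔ d * x * d⁻¹ ∈ K := fun K x => Iff.rfl
  constructor
  · rintro ⟨h1, h2⟩ p p' hne hu hl
    have hsu : Equiv.swap p p' ∈ parabolic u := by
      rw [(isYoung_parabolic u).mem_iff]
      intro i
      rw [Equiv.swap_apply_def]
      split_ifs with h3 h4
      · rw [h3, hu]
      · rw [h4, hu]
      · rfl
    have hsl : Equiv.swap (d p) (d p') ∈ parabolic l := by
      rw [(isYoung_parabolic l).mem_iff]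
      intro i
      rw [Equiv.swap_apply_def]
      split_ifs with h3 h4
      · rw [h3, hl]
      · rw [h4, hl]
      · rfl
    have hconj : d * Equiv.swap p p' * d⁻¹ = Equiv.swap (d p) (d p') := by
      rw [Equiv.mul_swap_eq_swap_mul, mul_inv_cancel_right]
    have hone : Equiv.swap p p' ≠ 1 := by
      intro h
      have := Equiv.congr_fun h p
      rw [Equiv.swap_apply_left, Equiv.Perm.one_apply] at this
      exact hne this.symm
    by_cases hpu : (row u p : ℕ) < m <;> by_cases hpl : (row l (d p) : ℕ) < m <;>
      simp only [hpu, hpl, iff_true, iff_false, not_true_eq_false]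
    · refine hone ((Subgroup.eq_bot_iff_forall _).1 h2 _ ⟨?_, ?_⟩)
      · refine (mem_conj _ _).2 (hconj ▸ mem_oddParabolic.2 ⟨hsl, fun i hi => ?_⟩)
        refine Equiv.swap_apply_of_ne_of_ne ?_ ?_
        · rintro rfl
          exact hpl hi
        · rintro rfl
          exact hpl (hl ▸ hi)
      · refine mem_evenParabolic.2 ⟨hsu, fun i hi => ?_⟩
        refine Equiv.swap_apply_of_ne_of_ne ?_ ?_
        · rintro rfl
          omega
        · rintro rfl
          rw [hu] at hpu
          omega
    · refine hone ((Subgroup.eq_bot_iff_forall _).1 h1 _ ⟨?_, ?_⟩)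
      · refine (mem_conj _ _).2 (hconj ▸ mem_evenParabolic.2 ⟨hsl, fun i hi => ?_⟩)
        refine Equiv.swap_apply_of_ne_of_ne ?_ ?_
        · rintro rfl
          omega
        · rintro rfl
          rw [hl] at hpl
          omega
      · refine mem_oddParabolic.2 ⟨hsu, fun i hi => ?_⟩
        refine Equiv.swap_apply_of_ne_of_ne ?_ ?_
        · rintro rfl
          exact hpu hi
        · rintro rfl
          exact hpu (hu ▸ hi)
  · intro h
    constructor
    · rw [Subgroup.eq_bot_iff_forall]
      rintro x ⟨hx1, hx2⟩
      have hx1 := mem_evenParabolic.1 ((mem_conj _ _).1 hx1)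
      have hx2 := mem_oddParabolic.1 hx2
      ext p
      by_contra hne
      have hne : x p ≠ p := fun h => hne (by rw [h]; rfl)
      have hl := (isYoung_parabolic l).mem_iff _ |>.1 hx1.1 (d p)
      have hu := (isYoung_parabolic u).mem_iff _ |>.1 hx2.1 p
      simp only [Equiv.Perm.mul_apply, inv_apply_self] at hl
      have h1 := h p (x p) hne.symm hu.symm hl.symm
      have h2 : ¬ (row u p : ℕ) < m := fun h3 => hne (hx2.2 p h3)
      have h3 : (row l (d p) : ℕ) < m := by
        by_contra h4
        have := hx1.2 (d p) (not_lt.1 h4)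
        simp only [Equiv.Perm.mul_apply, inv_apply_self] at this
        exact hne (d.injective this)
      exact h2 (h1.2 h3)
    · rw [Subgroup.eq_bot_iff_forall]
      rintro x ⟨hx1, hx2⟩
      have hx1 := mem_oddParabolic.1 ((mem_conj _ _).1 hx1)
      have hx2 := mem_evenParabolic.1 hx2
      ext p
      by_contra hne
      have hne : x p ≠ p := fun h => hne (by rw [h]; rfl)
      have hl := (isYoung_parabolic l).mem_iff _ |>.1 hx1.1 (d p)
      have hu := (isYoung_parabolic u).mem_iff _ |>.1 hx2.1 p
      simp only [Equiv.Perm.mul_apply, inv_apply_self] at hl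
      have h1 := h p (x p) hne.symm hu.symm hl.symm
      have h2 : (row u p : ℕ) < m := by
        by_contra h3
        exact hne (hx2.2 p (not_lt.1 h3))
      have h3 : ¬ (row l (d p) : ℕ) < m := by
        intro h4
        have := hx1.2 (d p) h4
        simp only [Equiv.Perm.mul_apply, inv_apply_self] at this
        exact hne (d.injective this)
      exact h3 (h1.1 h2)

/-- Parity compatibility only depends on the matrix: an entry of mixed parity is at most one. -/
theorem parityCompatible_iff {l u : Composition (m + n) r} {v : Equiv.Perm (Fin r)} :
    ParityCompatible l v u ↔
      ∀ i j : Fin (m + n), 1 < cosetMatrix l v u i j → ((j : ℕ) < m ↔ (i : ℕ) < m) := by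
  constructor
  · intro h i j hij
    rw [cosetMatrix_apply, Finset.one_lt_card] at hij
    obtain ⟨p, hp, p', hp', hne⟩ := hij
    simp only [Finset.mem_filter, Finset.mem_univ, true_and] at hp hp'
    rw [← hp.1, ← hp.2]
    exact h p p' hne (hp.2.trans hp'.2.symm) (hp.1.trans hp'.1.symm)
  · intro h p p' hne hu hl
    refine h _ _ ?_
    rw [cosetMatrix_apply, Finset.one_lt_card]
    exact ⟨p, by simp, p', by simp [hu, hl], hne⟩

end Parity

/-! ### Coefficients in the Hecke algebra -/

section Coefficients

variable {R : Type*} [CommRing R] {q : Rˣ} {r : ℕ}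

open Hecke

/-- The coefficient of `T_w`. -/
noncomputable def coeff (w : Equiv.Perm (Fin r)) : Hecke q r →ₗ[R] R := (basis q r).coord w

theorem coeff_T (v w : Equiv.Perm (Fin r)) : coeff v (T q w) = if w = v then 1 else 0 := by
  rw [coeff, Module.Basis.coord_apply, T, Module.Basis.repr_self, Finsupp.single_apply]

theorem ext_coeff {x y : Hecke q r} (h : ∀ w, coeff w x = coeff w y) : x = y :=
  (basis q r).ext_elem h

theorem length_adj_mul_of_not_lt {w : Equiv.Perm (Fin r)} {k : Fin (r - 1)}
    (h : ¬ length w < length (adj r k * w)) :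
    length (adj r k * w) < length (adj r k * (adj r k * w)) := by
  rw [length_lt_adj_mul] at h ⊢
  have := (adj_trichotomy w⁻¹ k).resolve_left h
  rw [mul_inv_rev, adj_inv]
  simpa [adj] using this

theorem length_mul_adj_of_not_lt {w : Equiv.Perm (Fin r)} {k : Fin (r - 1)}
    (h : ¬ length w < length (w * adj r k)) :
    length (w * adj r k) < length (w * adj r k * adj r k) := by
  rw [length_lt_mul_adj] at h ⊢
  have := (adj_trichotomy w k).resolve_left h
  simpa [adj] using this

theorem T_adj_mul (k : Fin (r - 1)) (x : Hecke q r) : T q (adj r k) * x = opL q r k x := by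
  have h1 : opL q r k (T q 1) = T q (adj r k) := by
    rw [opL_T, if_pos, mul_one]
    rw [length_lt_adj_mul]
    exact Nat.lt_succ_self _
  have h2 : ∀ w, T q (adj r k) * T q w = opL q r k (T q w) := fun w => by
    rw [Hecke.mul_def, mulHom_T_right, ← h1, ← mulRight_one w]
    exact (prod_opL_comm [k] _ (T q 1)).symm
  exact LinearMap.congr_fun (f := mulHom (T q (adj r k))) (g := opL q r k)
    ((basis q r).ext fun w => h2 w) x

theorem mul_T_adj (k : Fin (r - 1)) (x : Hecke q r) : x * T q (adj r k) = opR q r k x := by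
  refine LinearMap.congr_fun (f := mulHom.flip (T q (adj r k))) (g := opR q r k)
    ((basis q r).ext fun w => ?_) x
  exact (T_mul_T_adj w k).trans (opR_T k w).symm

theorem T_mul_T_adj_of_lt {w : Equiv.Perm (Fin r)} {k : Fin (r - 1)}
    (h : length w < length (w * adj r k)) : T q w * T q (adj r k) = T q (w * adj r k) := by
  rw [T_mul_T_adj, if_pos h]

theorem coeff_T_adj_mul (k : Fin (r - 1)) (w : Equiv.Perm (Fin r)) (x : Hecke q r) :
    coeff w (T q (adj r k) * x) = if length w < length (adj r k * w) then
      (q : R) * coeff (adj r k * w) x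
      else coeff (adj r k * w) x + ((q : R) - 1) * coeff w x := by
  rw [T_adj_mul]
  have hs : ∀ v w : Equiv.Perm (Fin r), adj r k * v = w ↔ v = adj r k * w := fun v w => by
    rw [← adj_inv k, inv_mul_eq_iff_eq_mul, adj_inv]
  have key : (coeff w) ∘ₗ opL q r k = if length w < length (adj r k * w) then
      (q : R) • coeff (adj r k * w) else coeff (adj r k * w) + ((q : R) - 1) • coeff w := by
    refine (basis q r).ext fun v => ?_
    change coeff w (opL q r k (T q v)) = (ite _ _ _ : Hecke q r →ₗ[R] R) (T q v)
    rw [opL_T]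
    by_cases h1 : v = w
    · subst h1
      have h2 : adj r k * v ≠ v := fun h => by
        rw [mul_eq_right] at h
        have := congrArg (fun f => (f ⟨k, by omega⟩ : ℕ)) h
        simp [adj] at this
      split_ifs <;> simp [coeff_T, h2, h2.symm]
    · by_cases h2 : v = adj r k * w
      · subst h2
        by_cases h3 : length w < length (adj r k * w)
        · have h4 : ¬ length (adj r k * w) < length (adj r k * (adj r k * w)) := by
            rw [← mul_assoc, adj_mul_adj, one_mul]
            exact h3.not_gt
          rw [if_neg h4, if_pos h3]
          simp [coeff_T, h1, ← mul_assoc, adj_mul_adj]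
        · rw [if_pos (length_adj_mul_of_not_lt h3), if_neg h3]
          simp [coeff_T, h1, ← mul_assoc, adj_mul_adj]
      · split_ifs <;> simp [coeff_T, h1, h2, hs]
  have := LinearMap.congr_fun key x
  rw [LinearMap.comp_apply] at this
  rw [this]
  split_ifs <;> rfl

theorem coeff_mul_T_adj (k : Fin (r - 1)) (w : Equiv.Perm (Fin r)) (x : Hecke q r) :
    coeff w (x * T q (adj r k)) = if length w < length (w * adj r k) then
      (q : R) * coeff (w * adj r k) x
      else coeff (w * adj r k) x + ((q : R) - 1) * coeff w x := by
  rw [mul_T_adj]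
  have hs : ∀ v w : Equiv.Perm (Fin r), v * adj r k = w ↔ v = w * adj r k := fun v w => by
    rw [← eq_mul_inv_iff_mul_eq, adj_inv]
  have key : (coeff w) ∘ₗ opR q r k = if length w < length (w * adj r k) then
      (q : R) • coeff (w * adj r k) else coeff (w * adj r k) + ((q : R) - 1) • coeff w := by
    refine (basis q r).ext fun v => ?_
    change coeff w (opR q r k (T q v)) = (ite _ _ _ : Hecke q r →ₗ[R] R) (T q v)
    rw [opR_T]
    by_cases h1 : v = w
    · subst h1
      have h2 : v * adj r k ≠ v := fun h => by
        rw [mul_eq_left] at h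
        have := congrArg (fun f => (f ⟨k, by omega⟩ : ℕ)) h
        simp [adj] at this
      split_ifs <;> simp [coeff_T, h2, h2.symm]
    · by_cases h2 : v = w * adj r k
      · subst h2
        by_cases h3 : length w < length (w * adj r k)
        · have h4 : ¬ length (w * adj r k) < length (w * adj r k * adj r k) := by
            rw [mul_assoc, adj_mul_adj, mul_one]
            exact h3.not_gt
          rw [if_neg h4, if_pos h3]
          simp [coeff_T, h1, mul_assoc, adj_mul_adj]
        · rw [if_pos (length_mul_adj_of_not_lt h3), if_neg h3]
          simp [coeff_T, h1, mul_assoc, adj_mul_adj]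
      · split_ifs <;> simp [coeff_T, h1, h2, hs]
  have := LinearMap.congr_fun key x
  rw [LinearMap.comp_apply] at this
  rw [this]
  split_ifs <;> rfl

theorem length_mul_le (x y : Equiv.Perm (Fin r)) : length (x * y) ≤ length x + length y := by
  obtain ⟨l, rfl, hl⟩ := exists_reduced_word x
  obtain ⟨l', rfl, hl'⟩ := exists_reduced_word y
  have := length_prod_le (l ++ l')
  rw [List.map_append, List.prod_append, List.length_append] at this
  omega

theorem length_adj (k : Fin (r - 1)) : length (adj r k) ≤ 1 := by
  simpa using length_prod_le [k]

/-- A nontrivial permutation is a product of a shorter one and a basic transposition. -/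
theorem exists_eq_mul_adj {w : Equiv.Perm (Fin r)} {a : ℕ} (h : length w = a + 1) :
    ∃ (v : Equiv.Perm (Fin r)) (k : Fin (r - 1)), w = v * adj r k ∧ length v = a := by
  obtain ⟨l, rfl, hl⟩ := exists_reduced_word w
  induction l using List.reverseRecOn with
  | nil =>
    rw [List.map_nil, List.prod_nil, length_one] at h
    omega
  | append_singleton l k _ =>
    refine ⟨(l.map (adj r)).prod, k, by simp, ?_⟩
    have h1 := length_prod_le l
    have h2 := length_mul_le (l.map (adj r)).prod (adj r k)
    have h3 := length_adj k
    simp only [List.map_append, List.prod_append, List.map_cons, List.map_nil, List.prod_cons,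
      List.prod_nil, mul_one, List.length_append, List.length_cons, List.length_nil] at hl h
    omega

theorem T_mul_T {x w : Equiv.Perm (Fin r)} (h : length (x * w) = length x + length w) :
    T q x * T q w = T q (x * w) := by
  induction ha : length w generalizing w with
  | zero =>
    rw [eq_one_of_length_eq_zero ha, mul_one, ← Hecke.one_def, mul_one]
  | succ a ih =>
    obtain ⟨v, k, rfl, hv⟩ := exists_eq_mul_adj ha
    have h1 := length_mul_le x v
    have h2 := length_mul_le (x * v) (adj r k)
    have h3 := length_adj k
    rw [mul_assoc] at h2
    rw [← T_mul_T_adj_of_lt (by omega), ← mul_assoc, ih (by omega) hv, T_mul_T_adj_of_lt, mul_assoc]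
    rw [mul_assoc]
    omega

/-- The coefficient of `T_d` in `T_w x` involves only one coefficient of `x` if `w⁻¹ d` is a
reduced product. -/
theorem coeff_T_mul {w d : Equiv.Perm (Fin r)} (h : length (w⁻¹ * d) = length w + length d)
    (x : Hecke q r) : coeff d (T q w * x) = (q : R) ^ length w * coeff (w⁻¹ * d) x := by
  induction ha : length w generalizing w x with
  | zero =>
    rw [eq_one_of_length_eq_zero ha, ← Hecke.one_def, one_mul, inv_one, one_mul, pow_zero, one_mul]
  | succ a ih =>
    obtain ⟨v, k, rfl, hv⟩ := exists_eq_mul_adj ha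
    rw [mul_inv_rev, adj_inv, mul_assoc] at h ⊢
    have h1 := length_mul_le v⁻¹ d
    have h2 := length_mul_le (adj r k) (v⁻¹ * d)
    have h3 := length_adj k
    rw [length_inv] at h1
    rw [← T_mul_T_adj_of_lt (by omega), mul_assoc, ih (by omega) _ hv, coeff_T_adj_mul,
      if_pos (by omega), pow_succ, mul_assoc]

end Coefficients

/-! ### Eigenvectors of parabolic subalgebras -/

section Eigen

variable {R : Type*} [CommRing R] (q : Rˣ) {m n r : ℕ}

open Hecke

/-- The factor by which the coefficients of an eigenvector change when the length goes up along a
basic transposition of the `i`-th block. -/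
noncomputable def ratio (m : ℕ) (a : ℕ) : Rˣ := if a < m then 1 else (-q)⁻¹

theorem ratio_quadratic (m a : ℕ) :
    (q : R) * (ratio q m a : R) * (ratio q m a : R) = 1 + ((q : R) - 1) * (ratio q m a : R) := by
  rw [ratio]
  split_ifs
  · simp
  · have h : (q : R) * ((-q)⁻¹ : Rˣ) = -1 := by
      rw [inv_neg, Units.val_neg, mul_neg, Units.mul_inv]
    linear_combination (((-q)⁻¹ : Rˣ) : R) * h - h

variable {q}

theorem T_adj_mul_eq_smul_iff {c : R} (hc : (q : R) * c * c = 1 + ((q : R) - 1) * c)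
    (k : Fin (r - 1)) (z : Hecke q r) :
    T q (adj r k) * z = ((q : R) * c) • z ↔ ∀ w, length w < length (adj r k * w) →
      coeff (adj r k * w) z = c * coeff w z := by
  constructor
  · intro h w hw
    have h1 := congrArg (coeff w) h
    rw [coeff_T_adj_mul, if_pos hw, map_smul, smul_eq_mul, mul_assoc] at h1
    exact q.isUnit.mul_left_cancel h1
  · intro h
    refine ext_coeff fun w => ?_
    rw [coeff_T_adj_mul, map_smul, smul_eq_mul]
    split_ifs with hw
    · rw [h w hw, mul_assoc]
    · have h1 := h _ (length_adj_mul_of_not_lt hw)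
      rw [← mul_assoc, adj_mul_adj, one_mul] at h1
      rw [h1]
      linear_combination -(coeff (adj r k * w) z) * hc

theorem mul_T_adj_eq_smul_iff {c : R} (hc : (q : R) * c * c = 1 + ((q : R) - 1) * c)
    (k : Fin (r - 1)) (z : Hecke q r) :
    z * T q (adj r k) = ((q : R) * c) • z ↔ ∀ w, length w < length (w * adj r k) →
      coeff (w * adj r k) z = c * coeff w z := by
  constructor
  · intro h w hw
    have h1 := congrArg (coeff w) h
    rw [coeff_mul_T_adj, if_pos hw, map_smul, smul_eq_mul, mul_assoc] at h1
    exact q.isUnit.mul_left_cancel h1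
  · intro h
    refine ext_coeff fun w => ?_
    rw [coeff_mul_T_adj, map_smul, smul_eq_mul]
    split_ifs with hw
    · rw [h w hw, mul_assoc]
    · have h1 := h _ (length_mul_adj_of_not_lt hw)
      rw [mul_assoc, adj_mul_adj, mul_one] at h1
      rw [h1]
      linear_combination -(coeff (w * adj r k) z) * hc

/-- The `z` with `T_s z = q z` for every basic transposition `s` of the even part of `W_l` and
`T_s z = -z` for every basic transposition `s` of the odd part. Both eigenvalues are written as
`q` times the `ratio`. -/
noncomputable def leftEigen (l : Composition (m + n) r) : Submodule R (Hecke q r) where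
  carrier := {z | ∀ k : Fin (r - 1), adj r k ∈ parabolic l →
    T q (adj r k) * z = ((q : R) * (ratio q m (row l ⟨k, by omega⟩) : R)) • z}
  add_mem' h1 h2 k hk := by rw [mul_add, h1 k hk, h2 k hk, smul_add]
  zero_mem' k hk := by rw [mul_zero, smul_zero]
  smul_mem' a z hz k hk := by rw [mul_smul_comm, hz k hk, smul_comm]

/-- The right-handed analogue of `leftEigen`. -/
noncomputable def rightEigen (u : Composition (m + n) r) : Submodule R (Hecke q r) where
  carrier := {z | ∀ k : Fin (r - 1), adj r k ∈ parabolic u →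
    z * T q (adj r k) = ((q : R) * (ratio q m (row u ⟨k, by omega⟩) : R)) • z}
  add_mem' h1 h2 k hk := by rw [add_mul, h1 k hk, h2 k hk, smul_add]
  zero_mem' k hk := by rw [zero_mul, smul_zero]
  smul_mem' a z hz k hk := by rw [smul_mul_assoc, hz k hk, smul_comm]

theorem mul_mem_leftEigen {l : Composition (m + n) r} {z : Hecke q r} (hz : z ∈ leftEigen l)
    (x : Hecke q r) : z * x ∈ leftEigen l := fun k hk => by
  rw [← mul_assoc, hz k hk, smul_mul_assoc]

theorem mul_mem_rightEigen {u : Composition (m + n) r} {z : Hecke q r} (hz : z ∈ rightEigen u)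
    (x : Hecke q r) : x * z ∈ rightEigen u := fun k hk => by
  rw [mul_assoc, hz k hk, mul_smul_comm]

theorem mem_leftEigen_iff {l : Composition (m + n) r} {z : Hecke q r} :
    z ∈ leftEigen l ↔ ∀ k : Fin (r - 1), adj r k ∈ parabolic l →
      ∀ w, length w < length (adj r k * w) →
        coeff (adj r k * w) z = (ratio q m (row l ⟨k, by omega⟩) : R) * coeff w z :=
  forall_congr' fun k => imp_congr_right fun _ => T_adj_mul_eq_smul_iff (ratio_quadratic q _ _) k z

theorem mem_rightEigen_iff {u : Composition (m + n) r} {z : Hecke q r} :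
    z ∈ rightEigen u ↔ ∀ k : Fin (r - 1), adj r k ∈ parabolic u →
      ∀ w, length w < length (w * adj r k) →
        coeff (w * adj r k) z = (ratio q m (row u ⟨k, by omega⟩) : R) * coeff w z :=
  forall_congr' fun k => imp_congr_right fun _ => mul_T_adj_eq_smul_iff (ratio_quadratic q _ _) k z

theorem coeff_eq_zero_of_leftEigen {l : Composition (m + n) r} {z : Hecke q r}
    (hz : z ∈ leftEigen l) {w : Equiv.Perm (Fin r)}
    (h : ∀ v, length v < length w → coeff v z = 0) (hw : w ∉ shortest (parabolic l)) :
    coeff w z = 0 := by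
  by_contra hne
  refine hw ((isYoung_parabolic l).mem_shortest_of_forall_adj fun k hk => ?_)
  by_contra hlt
  have h1 := length_adj_mul_of_not_lt hlt
  have h2 := mem_leftEigen_iff.1 hz k hk _ h1
  rw [← mul_assoc, adj_mul_adj, one_mul] at h1 h2
  exact hne (by rw [h2, h _ h1, mul_zero])

theorem coeff_eq_zero_of_rightEigen {u : Composition (m + n) r} {z : Hecke q r}
    (hz : z ∈ rightEigen u) {w : Equiv.Perm (Fin r)}
    (h : ∀ v, length v < length w → coeff v z = 0) (hw : w⁻¹ ∉ shortest (parabolic u)) :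
    coeff w z = 0 := by
  by_contra hne
  refine hw ((isYoung_parabolic u).mem_shortest_of_forall_adj fun k hk => ?_)
  rw [length_inv, ← adj_inv, ← mul_inv_rev, length_inv]
  by_contra hlt
  have h1 := length_mul_adj_of_not_lt hlt
  have h2 := mem_rightEigen_iff.1 hz k hk _ h1
  rw [mul_assoc, adj_mul_adj, mul_one] at h1 h2
  exact hne (by rw [h2, h _ h1, mul_zero])

theorem eq_of_leftEigen {l : Composition (m + n) r} {z z' : Hecke q r} (hz : z ∈ leftEigen l)
    (hz' : z' ∈ leftEigen l) (h : ∀ w ∈ shortest (parabolic l), coeff w z = coeff w z') :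
    z = z' := by
  rw [← sub_eq_zero]
  have hs := sub_mem hz hz'
  refine ext_coeff fun w => ?_
  rw [map_zero]
  induction ha : length w using Nat.strong_induction_on generalizing w with
  | _ a ih =>
    by_cases hw : w ∈ shortest (parabolic l)
    · rw [map_sub, h w hw, sub_self]
    · exact coeff_eq_zero_of_leftEigen hs (fun v hv => ih _ (ha ▸ hv) v rfl) hw

theorem eq_of_rightEigen {u : Composition (m + n) r} {z z' : Hecke q r} (hz : z ∈ rightEigen u)
    (hz' : z' ∈ rightEigen u) (h : ∀ w, w⁻¹ ∈ shortest (parabolic u) → coeff w z = coeff w z') :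
    z = z' := by
  rw [← sub_eq_zero]
  have hs := sub_mem hz hz'
  refine ext_coeff fun w => ?_
  rw [map_zero]
  induction ha : length w using Nat.strong_induction_on generalizing w with
  | _ a ih =>
    by_cases hw : w⁻¹ ∈ shortest (parabolic u)
    · rw [map_sub, h w hw, sub_self]
    · exact coeff_eq_zero_of_rightEigen hs (fun v hv => ih _ (ha ▸ hv) v rfl) hw

/-- For a shortest double coset representative of mixed parity, two neighbouring letters of an odd
block have neighbouring images in an even block, or conversely; the corresponding coefficient `a`
of a bi-eigenvector then satisfies `a = -q⁻¹ a`. -/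
theorem coeff_eq_zero_of_not_parityCompatible (hq : 1 + (q : R) ∈ nonZeroDivisors R)
    {l u : Composition (m + n) r} {z : Hecke q r} (hl : z ∈ leftEigen l) (hu : z ∈ rightEigen u)
    {d : Equiv.Perm (Fin r)} (hd : d ∈ doubleShortest l u) (hc : ¬ ParityCompatible l d u) :
    coeff d z = 0 := by
  obtain ⟨hd1, hd2⟩ := mem_doubleShortest_iff.1 hd
  have hex : ∃ p p' : Fin r, p < p' ∧ row u p = row u p' ∧ row l (d p) = row l (d p') ∧
      ¬ ((row u p : ℕ) < m ↔ (row l (d p) : ℕ) < m) := by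
    rw [ParityCompatible] at hc
    push Not at hc
    obtain ⟨p, p', hne, h1, h2, h3⟩ := hc
    rcases hne.lt_or_gt with h | h
    · exact ⟨p, p', h, h1, h2, by omega⟩
    · exact ⟨p', p, h, h1.symm, h2.symm, by rw [← h1, ← h2]; omega⟩
  obtain ⟨p, p', hlt, hpu, hpl, hpar⟩ := hex
  have hp' : (p : ℕ) + 1 ≤ p' := hlt
  have hk : (p : ℕ) < r - 1 := by have := p'.2; omega
  have hyu := isYoung_parabolic u
  have hyl := isYoung_parabolic l
  -- the successor of `p` serves as well as `p'`
  obtain ⟨s, hs⟩ : ∃ s : Fin r, (s : ℕ) = p + 1 := ⟨⟨p + 1, by omega⟩, rfl⟩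
  have hps : p < s := by rw [Fin.lt_def]; omega
  have hsu : row u p = row u s := hyu.convex _ _ _ hps.le (by rw [Fin.le_def]; omega) hpu
  have hds : d p < d s := hd2 _ _ hps hsu
  have hds' : d s ≤ d p' := by
    rcases (show s ≤ p' by rw [Fin.le_def]; omega).lt_or_eq with h | h
    · exact (hd2 _ _ h (hsu.symm.trans hpu)).le
    · rw [h]
  have hsl : row l (d p) = row l (d s) := hyl.convex _ _ _ hds.le hds' hpl
  -- the images of `p` and `s` are neighbours
  have hnext : (d s : ℕ) = d p + 1 := by
    by_contra hne
    obtain ⟨t, ht⟩ : ∃ t : Fin r, (t : ℕ) = d p + 1 :=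
      ⟨⟨d p + 1, by have := (d s).2; rw [Fin.lt_def] at hds; omega⟩, rfl⟩
    have h1 : d p < t := by rw [Fin.lt_def]; omega
    have h2 : t < d s := by rw [Fin.lt_def] at hds ⊢; omega
    have h3 : row l (d p) = row l t := hyl.convex _ _ _ h1.le h2.le hsl
    have h4 := hd1 _ _ h1 h3
    have h5 := hd1 _ _ h2 (h3.symm.trans hsl)
    rw [inv_apply_self, Fin.lt_def] at h4 h5
    omega
  have hku : adj r ⟨p, hk⟩ ∈ parabolic u := hyu.adj_mem _ (by
    convert hsu using 2
    exact Fin.ext hs.symm)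
  have hkl' : (d p : ℕ) < r - 1 := by have := (d s).2; omega
  have hkl : adj r ⟨d p, hkl'⟩ ∈ parabolic l := hyl.adj_mem _ (by
    convert hsl using 2
    exact Fin.ext hnext.symm)
  have hcomm : adj r ⟨d p, hkl'⟩ * d = d * adj r ⟨p, hk⟩ := by
    have hs' : (⟨(p : ℕ) + 1, by omega⟩ : Fin r) = s := Fin.ext hs.symm
    exact adj_mul_eq_mul_adj d _ _ (Or.inl ⟨rfl, (congrArg d hs').trans (Fin.ext hnext)⟩)
  have hlen : length d < length (d * adj r ⟨p, hk⟩) := by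
    rw [length_lt_mul_adj]
    convert hds using 2
    exact Fin.ext hs.symm
  have e1 := mem_leftEigen_iff.1 hl _ hkl d (by rw [hcomm]; exact hlen)
  have e2 := mem_rightEigen_iff.1 hu _ hku d hlen
  rw [hcomm, e2] at e1
  have hqq : (q : R) * ((-q)⁻¹ : Rˣ) = -1 := by
    rw [inv_neg, Units.val_neg, mul_neg, Units.mul_inv]
  refine (mem_nonZeroDivisors_iff.1 hq).1 _ ?_
  simp only [Fin.eta, ratio] at e1
  by_cases h1 : (row u p : ℕ) < m <;> by_cases h2 : (row l (d p) : ℕ) < m <;>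
    simp only [h1, h2, if_true, if_false, Units.val_one, one_mul, iff_true, iff_false,
      not_true_eq_false] at e1 hpar
  · linear_combination (q : R) * e1 + coeff d z * hqq
  · linear_combination -(q : R) * e1 + coeff d z * hqq

/-- A bi-eigenvector is determined by its coefficients at `superShortest l u`. -/
theorem eq_of_leftEigen_of_rightEigen (hq : 1 + (q : R) ∈ nonZeroDivisors R)
    {l u : Composition (m + n) r} {z z' : Hecke q r}
    (hzl : z ∈ leftEigen l) (hzl' : z' ∈ leftEigen l)
    (hzu : z ∈ rightEigen u) (hzu' : z' ∈ rightEigen u)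
    (h : ∀ d ∈ superShortest l u, coeff d z = coeff d z') : z = z' := by
  rw [← sub_eq_zero]
  have hsl := sub_mem hzl hzl'
  have hsu := sub_mem hzu hzu'
  refine ext_coeff fun w => ?_
  rw [map_zero]
  induction ha : length w using Nat.strong_induction_on generalizing w with
  | _ a ih =>
    have ih' := fun v hv => ih _ (ha ▸ hv) v rfl
    by_cases h1 : w ∈ shortest (parabolic l)
    · by_cases h2 : w⁻¹ ∈ shortest (parabolic u)
      · by_cases h3 : ParityCompatible l w u
        · rw [map_sub, h w (mem_superShortest_iff.2 ⟨⟨h1, h2⟩, h3⟩), sub_self]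
        · exact coeff_eq_zero_of_not_parityCompatible hq hsl hsu ⟨h1, h2⟩ h3
      · exact coeff_eq_zero_of_rightEigen hsu ih' h2
    · exact coeff_eq_zero_of_leftEigen hsl ih' h1

end Eigen

/-! ### Odd inversions and bi-eigenvectors -/

section OddInversions

variable {m n r : ℕ}

/-- The inversions of `v` between two letters of a common odd block of `u`, or between two letters
with images in a common odd block of `l`. -/
noncomputable def oddInv (l : Composition (m + n) r) (v : Equiv.Perm (Fin r))
    (u : Composition (m + n) r) : Finset (Fin r × Fin r) :=
  (inversions v).filter fun p => (row u p.1 = row u p.2 ∧ m ≤ (row u p.1 : ℕ)) ∨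
    (row l (v p.1) = row l (v p.2) ∧ m ≤ (row l (v p.1) : ℕ))

theorem mem_oddInv {l u : Composition (m + n) r} {v : Equiv.Perm (Fin r)} {i j : Fin r} :
    (i, j) ∈ oddInv l v u ↔ (i < j ∧ v j < v i) ∧ ((row u i = row u j ∧ m ≤ (row u i : ℕ)) ∨
      (row l (v i) = row l (v j) ∧ m ≤ (row l (v i) : ℕ))) := by
  rw [oddInv, Finset.mem_filter, mem_inversions]

theorem card_oddInv_inv (l : Composition (m + n) r) (v : Equiv.Perm (Fin r))
    (u : Composition (m + n) r) : (oddInv u v⁻¹ l).card = (oddInv l v u).card := by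
  symm
  rw [← Finset.card_map ((v.prodCongr v).trans (Equiv.prodComm _ _)).toEmbedding]
  congr 1
  ext ⟨i, j⟩
  rw [Finset.mem_map_equiv]
  refine (mem_oddInv (i := v⁻¹ j) (j := v⁻¹ i)).trans (Iff.trans ?_ mem_oddInv.symm)
  rw [apply_inv_self, apply_inv_self, or_comm, eq_comm (a := row u (v⁻¹ i)),
    eq_comm (a := row l i), and_comm (a := i < j)]
  refine and_congr_right fun _ => or_congr (and_congr_right fun h => ?_)
    (and_congr_right fun h => ?_) <;> rw [h]

theorem ParityCompatible.inv {l u : Composition (m + n) r} {v : Equiv.Perm (Fin r)}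
    (h : ParityCompatible l v u) : ParityCompatible u v⁻¹ l := by
  intro p p' hne hl hu
  have := h (v⁻¹ p) (v⁻¹ p') (fun h => hne (v⁻¹.injective h)) hu
    (by rwa [apply_inv_self, apply_inv_self])
  rw [apply_inv_self] at this
  exact this.symm

theorem inversions_adj_mul (w : Equiv.Perm (Fin r)) (k : Fin (r - 1))
    (h : w⁻¹ ⟨k, by omega⟩ < w⁻¹ ⟨k + 1, by omega⟩) :
    inversions (adj r k * w) =
      insert (w⁻¹ ⟨k, by omega⟩, w⁻¹ ⟨k + 1, by omega⟩) (inversions w) := by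
  ext ⟨i, j⟩
  rw [Finset.mem_insert, mem_inversions, mem_inversions, Prod.mk.injEq, Equiv.Perm.mul_apply,
    Equiv.Perm.mul_apply, Equiv.Perm.eq_inv_iff_eq, Equiv.Perm.eq_inv_iff_eq]
  by_cases hp : w i = ⟨k, by omega⟩ ∧ w j = ⟨k + 1, by omega⟩
  · refine iff_of_true ⟨?_, ?_⟩ (Or.inl hp)
    · rwa [← hp.1, ← hp.2, inv_apply_self, inv_apply_self] at h
    · rw [hp.1, hp.2]
      simp [adj]
  · simp only [hp, false_or]
    refine and_congr_right fun hij => ⟨fun h1 => ?_, fun h1 => adj_lt k h1 ?_⟩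
    · by_contra h2
      have h3 : w i < w j := lt_of_le_of_ne (not_lt.1 h2) fun h4 => hij.ne (w.injective h4)
      exact lt_asymm h1 (adj_lt k h3 hp)
    · rintro ⟨h2, h3⟩
      rw [← h2, ← h3, inv_apply_self, inv_apply_self] at h
      exact lt_asymm hij h

theorem card_oddInv_adj_mul {l u : Composition (m + n) r} {w : Equiv.Perm (Fin r)}
    (hw : ParityCompatible l w u) {k : Fin (r - 1)} (hk : adj r k ∈ parabolic l)
    (hlt : length w < length (adj r k * w)) :
    (oddInv l (adj r k * w) u).card =
      (oddInv l w u).card + if (row l ⟨k, by omega⟩ : ℕ) < m then 0 else 1 := by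
  rw [length_lt_adj_mul] at hlt
  have hrow := (isYoung_parabolic l).eq_of_adj_mem hk
  have hne : w⁻¹ ⟨k, by omega⟩ ≠ w⁻¹ ⟨k + 1, by omega⟩ := hlt.ne
  have hpar := hw _ _ hne
  rw [apply_inv_self, apply_inv_self] at hpar
  have hnot : (w⁻¹ ⟨k, by omega⟩, w⁻¹ ⟨k + 1, by omega⟩) ∉ inversions w := fun h => by
    have := (mem_inversions.1 h).2
    rw [apply_inv_self, apply_inv_self, Fin.lt_def] at this
    simp at this
  simp only [oddInv, Equiv.Perm.mul_apply, (isYoung_parabolic l).mem_iff _ |>.1 hk]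
  rw [inversions_adj_mul w k hlt, Finset.filter_insert]
  simp only [apply_inv_self]
  split_ifs with h1 h2 h2
  · rcases h1 with h1 | h1
    · have := (hpar h1.1 hrow).2 h2
      omega
    · omega
  · rw [Finset.card_insert_of_notMem fun h => hnot (Finset.mem_of_mem_filter _ h)]
  · rfl
  · exact absurd (Or.inr ⟨hrow, not_lt.1 h2⟩) h1

theorem card_oddInv_mul_adj {l u : Composition (m + n) r} {w : Equiv.Perm (Fin r)}
    (hw : ParityCompatible l w u) {k : Fin (r - 1)} (hk : adj r k ∈ parabolic u)
    (hlt : length w < length (w * adj r k)) :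
    (oddInv l (w * adj r k) u).card =
      (oddInv l w u).card + if (row u ⟨k, by omega⟩ : ℕ) < m then 0 else 1 := by
  rw [← card_oddInv_inv, ← card_oddInv_inv l w, mul_inv_rev, adj_inv]
  refine card_oddInv_adj_mul hw.inv hk ?_
  rwa [length_inv, ← length_inv (_ * _), mul_inv_rev, inv_inv, adj_inv]

theorem oddInv_one (l u : Composition (m + n) r) : oddInv l 1 u = ∅ := by
  rw [oddInv, inversions_one, Finset.filter_empty]

/-- A shortest double coset representative has no odd inversions. -/
theorem oddInv_eq_empty {l u : Composition (m + n) r} {d : Equiv.Perm (Fin r)}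
    (hd : d ∈ doubleShortest l u) : oddInv l d u = ∅ := by
  obtain ⟨h1, h2⟩ := mem_doubleShortest_iff.1 hd
  rw [Finset.eq_empty_iff_forall_notMem]
  rintro ⟨i, j⟩ h
  obtain ⟨⟨hij, hlt⟩, h3 | h3⟩ := mem_oddInv.1 h
  · exact lt_asymm hlt (h2 _ _ hij h3.1)
  · have := h1 _ _ hlt h3.1.symm
    rw [inv_apply_self, inv_apply_self] at this
    exact lt_asymm hij this

end OddInversions

section SuperSum

variable {R : Type*} [CommRing R] {q : Rˣ} {m n r : ℕ}

open Hecke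

variable (q) in
open scoped Classical in
/-- The sum of the `(-q)^{-a} T_v` over `v ∈ S`, where `a` is the number of odd inversions of
`v`. -/
noncomputable def superSum (l u : Composition (m + n) r) (S : Set (Equiv.Perm (Fin r))) :
    Hecke q r :=
  ∑ v ∈ Finset.univ.filter (fun v => v ∈ S),
    (((-q)⁻¹ ^ (oddInv l v u).card : Rˣ) : R) • T q v

open scoped Classical in
theorem coeff_superSum (l u : Composition (m + n) r) (S : Set (Equiv.Perm (Fin r)))
    (v : Equiv.Perm (Fin r)) : coeff v (superSum q l u S) =
      if v ∈ S then (((-q)⁻¹ ^ (oddInv l v u).card : Rˣ) : R) else 0 := by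
  simp only [superSum, map_sum, map_smul, coeff_T, smul_eq_mul, mul_ite, mul_one, mul_zero]
  rw [Finset.sum_ite_eq']
  simp

theorem superSum_mem_leftEigen {l u : Composition (m + n) r} {S : Set (Equiv.Perm (Fin r))}
    (hS : ∀ x ∈ parabolic l, ∀ w ∈ S, x * w ∈ S) (hpar : ∀ w ∈ S, ParityCompatible l w u) :
    superSum q l u S ∈ leftEigen l := by
  rw [mem_leftEigen_iff]
  intro k hk w hw
  rw [coeff_superSum, coeff_superSum]
  by_cases h : w ∈ S
  · rw [if_pos h, if_pos (hS _ hk _ h), card_oddInv_adj_mul (hpar w h) hk hw, ratio]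
    split_ifs
    · simp
    · rw [pow_succ, mul_comm, Units.val_mul]
  · rw [if_neg h, if_neg, mul_zero]
    intro h1
    have := hS _ hk _ h1
    rw [← mul_assoc, adj_mul_adj, one_mul] at this
    exact h this

theorem superSum_mem_rightEigen {l u : Composition (m + n) r} {S : Set (Equiv.Perm (Fin r))}
    (hS : ∀ x ∈ parabolic u, ∀ w ∈ S, w * x ∈ S) (hpar : ∀ w ∈ S, ParityCompatible l w u) :
    superSum q l u S ∈ rightEigen u := by
  rw [mem_rightEigen_iff]
  intro k hk w hw
  rw [coeff_superSum, coeff_superSum]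
  by_cases h : w ∈ S
  · rw [if_pos h, if_pos (hS _ hk _ h), card_oddInv_mul_adj (hpar w h) hk hw, ratio]
    split_ifs
    · simp
    · rw [pow_succ, mul_comm, Units.val_mul]
  · rw [if_neg h, if_neg, mul_zero]
    intro h1
    have := hS _ hk _ h1
    rw [mul_assoc, adj_mul_adj, mul_one] at this
    exact h this

theorem row_lt_of_mem_parabolic {u : Composition (m + n) r} {y : Equiv.Perm (Fin r)}
    (hy : y ∈ parabolic u) (p : Fin r) : (row u (y p) : ℕ) < m ↔ (row u p : ℕ) < m := by
  rw [(isYoung_parabolic u).mem_iff _ |>.1 hy]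

/-- Every element of a parabolic subgroup is a product of an even and an odd element. -/
theorem exists_even_mul_odd {u : Composition (m + n) r} {y : Equiv.Perm (Fin r)}
    (hy : y ∈ parabolic u) : ∃ y₀ ∈ evenParabolic u, ∃ y₁ ∈ oddParabolic u, y₀ * y₁ = y := by
  have hiff := row_lt_of_mem_parabolic hy
  have hyu := isYoung_parabolic u
  have hy' := (hyu.mem_iff y).1 hy
  set y₀ : Equiv.Perm (Fin r) :=
    Equiv.Perm.ofSubtype (Equiv.Perm.subtypePerm (p := fun p => (row u p : ℕ) < m) y hiff) with hy₀
  have h1 : ∀ p, (row u p : ℕ) < m → y₀ p = y p := fun p hp => by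
    rw [hy₀, Equiv.Perm.ofSubtype_apply_of_mem (p := fun p => (row u p : ℕ) < m) _ hp]
    rfl
  have h2 : ∀ p, m ≤ (row u p : ℕ) → y₀ p = p := fun p hp =>
    Equiv.Perm.ofSubtype_apply_of_not_mem (p := fun p => (row u p : ℕ) < m) _ (not_lt.2 hp)
  have h3 : y₀ ∈ parabolic u := by
    rw [hyu.mem_iff]
    intro p
    rcases lt_or_ge (row u p : ℕ) m with hp | hp
    · rw [h1 p hp, hy']
    · rw [h2 p hp]
  refine ⟨y₀, mem_evenParabolic.2 ⟨h3, h2⟩, y₀⁻¹ * y, mem_oddParabolic.2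
    ⟨mul_mem (inv_mem h3) hy, fun p hp => ?_⟩, mul_inv_cancel_left _ _⟩
  rw [Equiv.Perm.mul_apply, ← h1 p hp, inv_apply_self]

section EvenOdd

variable {u : Composition (m + n) r} {y₀ y₁ : Equiv.Perm (Fin r)}

theorem even_inv_apply (h0 : y₀ ∈ evenParabolic u) {p : Fin r} (hp : m ≤ (row u p : ℕ)) :
    y₀⁻¹ p = p := (mem_evenParabolic.1 (inv_mem h0)).2 p hp

theorem odd_inv_apply (h1 : y₁ ∈ oddParabolic u) {p : Fin r} (hp : (row u p : ℕ) < m) :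
    y₁⁻¹ p = p := (mem_oddParabolic.1 (inv_mem h1)).2 p hp

theorem even_mul_odd_apply_of_le (h0 : y₀ ∈ evenParabolic u) (h1 : y₁ ∈ oddParabolic u)
    {p : Fin r} (hp : m ≤ (row u p : ℕ)) : (y₀ * y₁) p = y₁ p := by
  rw [Equiv.Perm.mul_apply]
  refine (mem_evenParabolic.1 h0).2 _ ?_
  rwa [(isYoung_parabolic u).mem_iff _ |>.1 (mem_oddParabolic.1 h1).1]

theorem length_even_mul_odd (h0 : y₀ ∈ evenParabolic u) (h1 : y₁ ∈ oddParabolic u) :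
    length (y₀ * y₁) = length y₀ + length y₁ := by
  refine length_mul_of_forall _ _ fun i j hij hlt => ?_
  have hy0 := mem_evenParabolic.1 h0
  have hrow : row u i = row u j := by
    by_contra hne
    exact lt_asymm hlt ((isYoung_parabolic u).lt_of_ne hy0.1 hij hne)
  rcases lt_or_ge (row u i : ℕ) m with hi | hi
  · rwa [odd_inv_apply h1 hi, odd_inv_apply h1 (hrow ▸ hi)]
  · rw [hy0.2 i hi, hy0.2 j (hrow ▸ hi)] at hlt
    exact absurd hlt hij.not_gt

theorem card_oddInv_even_mul_odd (h0 : y₀ ∈ evenParabolic u) (h1 : y₁ ∈ oddParabolic u) :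
    (oddInv u (y₀ * y₁) u).card = length y₁ := by
  rw [length_eq_card_inversions]
  congr 1
  ext ⟨i, j⟩
  have hy1 := mem_oddParabolic.1 h1
  have hy := mul_mem (mem_evenParabolic.1 h0).1 hy1.1
  rw [mem_oddInv, mem_inversions, (isYoung_parabolic u).mem_iff _ |>.1 hy,
    (isYoung_parabolic u).mem_iff _ |>.1 hy, or_self]
  constructor
  · rintro ⟨⟨hij, hlt⟩, hrow, hi⟩
    rw [even_mul_odd_apply_of_le h0 h1 hi, even_mul_odd_apply_of_le h0 h1 (hrow ▸ hi)] at hlt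
    exact ⟨hij, hlt⟩
  · rintro ⟨hij, hlt⟩
    have hrow : row u i = row u j := by
      by_contra hne
      exact lt_asymm hlt ((isYoung_parabolic u).lt_of_ne hy1.1 hij hne)
    have hi : m ≤ (row u i : ℕ) := by
      by_contra hi
      rw [not_le] at hi
      rw [hy1.2 i hi, hy1.2 j (hrow ▸ hi)] at hlt
      exact lt_asymm hij hlt
    rw [even_mul_odd_apply_of_le h0 h1 hi, even_mul_odd_apply_of_le h0 h1 (hrow ▸ hi)]
    exact ⟨⟨hij, hlt⟩, hrow, hi⟩

end EvenOdd

theorem plainSum_mul_signedSum (u : Composition (m + n) r) {X : Set (Equiv.Perm (Fin r))}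
    (hX : ∀ y₀ ∈ evenParabolic u, ∀ y₁ ∈ oddParabolic u, y₀ * y₁ ∈ X ↔ y₀ ∈ X ∧ y₁ ∈ X) :
    plainSum q (X ∩ evenParabolic u) * signedSum q (X ∩ oddParabolic u) =
      superSum q u u (X ∩ parabolic u) := by
  classical
  rw [plainSum, signedSum, superSum, Finset.sum_mul_sum, ← Finset.sum_product']
  refine Finset.sum_bij (fun y _ => y.1 * y.2) ?_ ?_ ?_ ?_
  · rintro ⟨y₀, y₁⟩ hy
    simp only [Finset.mem_product, Finset.mem_filter, Finset.mem_univ, true_and,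
      Set.mem_inter_iff, SetLike.mem_coe] at hy ⊢
    exact ⟨(hX _ hy.1.2 _ hy.2.2).2 ⟨hy.1.1, hy.2.1⟩,
      mul_mem (mem_evenParabolic.1 hy.1.2).1 (mem_oddParabolic.1 hy.2.2).1⟩
  · rintro ⟨y₀, y₁⟩ hy ⟨z₀, z₁⟩ hz h
    simp only [Finset.mem_product, Finset.mem_filter, Finset.mem_univ, true_and,
      Set.mem_inter_iff, SetLike.mem_coe] at hy hz h
    have h1 : y₁ = z₁ := by
      refine Equiv.ext fun p => ?_
      rcases lt_or_ge (row u p : ℕ) m with hp | hp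
      · rw [(mem_oddParabolic.1 hy.2.2).2 p hp, (mem_oddParabolic.1 hz.2.2).2 p hp]
      · rw [← even_mul_odd_apply_of_le hy.1.2 hy.2.2 hp, h,
          even_mul_odd_apply_of_le hz.1.2 hz.2.2 hp]
    subst h1
    rw [mul_right_cancel h]
  · intro y hy
    simp only [Finset.mem_filter, Finset.mem_univ, true_and, Set.mem_inter_iff,
      SetLike.mem_coe] at hy
    obtain ⟨y₀, h0, y₁, h1, rfl⟩ := exists_even_mul_odd hy.2
    have := (hX _ h0 _ h1).1 hy.1
    exact ⟨(y₀, y₁), by simp [h0, h1, this.1, this.2], rfl⟩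
  · rintro ⟨y₀, y₁⟩ hy
    simp only [Finset.mem_product, Finset.mem_filter, Finset.mem_univ, true_and,
      Set.mem_inter_iff, SetLike.mem_coe] at hy
    rw [mul_smul_comm, T_mul_T (length_even_mul_odd hy.1.2 hy.2.2),
      card_oddInv_even_mul_odd hy.1.2 hy.2.2]

theorem xy_eq_superSum (l : Composition (m + n) r) : xy q l = superSum q l l (parabolic l) := by
  have := plainSum_mul_signedSum (q := q) l (X := Set.univ) (by simp)
  rwa [Set.univ_inter, Set.univ_inter, Set.univ_inter] at this

theorem tailSum_eq_superSum {l u : Composition (m + n) r} {d : Equiv.Perm (Fin r)}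
    (hd : d ∈ doubleShortest l u) : tailSum q l d u =
      superSum q u u (shortest (conjBy (parabolic l) d ⊓ parabolic u) ∩ parabolic u) := by
  refine plainSum_mul_signedSum u fun y₀ h0 y₁ h1 => ?_
  simp only [(isYoung_inf hd).mem_shortest_iff, Prod.mk.injEq]
  have hy0 := mem_evenParabolic.1 (inv_mem h0)
  have e1 : ∀ p, (row u p : ℕ) < m → (y₀ * y₁)⁻¹ p = y₀⁻¹ p := fun p hp => by
    rw [mul_inv_rev, Equiv.Perm.mul_apply]
    exact odd_inv_apply h1 ((row_lt_of_mem_parabolic hy0.1 p).2 hp)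
  have e2 : ∀ p, m ≤ (row u p : ℕ) → (y₀ * y₁)⁻¹ p = y₁⁻¹ p := fun p hp => by
    rw [mul_inv_rev, Equiv.Perm.mul_apply, even_inv_apply h0 hp]
  rw [← forall_and]
  refine forall_congr' fun i => ?_
  rw [← forall_and]
  refine forall_congr' fun j => ?_
  rw [← imp_and, ← imp_and]
  refine imp_congr_right fun hij => imp_congr_right fun hrow => ?_
  rcases lt_or_ge (row u i : ℕ) m with hi | hi
  · have hj : (row u j : ℕ) < m := hrow.2 ▸ hi
    rw [e1 i hi, e1 j hj, odd_inv_apply h1 hi, odd_inv_apply h1 hj]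
    simp [hij]
  · have hj : m ≤ (row u j : ℕ) := hrow.2 ▸ hi
    rw [e2 i hi, e2 j hj, even_inv_apply h0 hi, even_inv_apply h0 hj]
    simp [hij]

theorem parityCompatible_of_mem_parabolic {l : Composition (m + n) r} {x : Equiv.Perm (Fin r)}
    (hx : x ∈ parabolic l) : ParityCompatible l x l := fun p p' _ _ _ => by
  rw [(isYoung_parabolic l).mem_iff _ |>.1 hx]

theorem xy_mem_leftEigen (l : Composition (m + n) r) : xy q l ∈ leftEigen l := by
  rw [xy_eq_superSum]
  exact superSum_mem_leftEigen (fun x hx w hw => mul_mem hx hw)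
    fun w hw => parityCompatible_of_mem_parabolic hw

theorem xy_mem_rightEigen (l : Composition (m + n) r) : xy q l ∈ rightEigen l := by
  rw [xy_eq_superSum]
  exact superSum_mem_rightEigen (fun x hx w hw => mul_mem hw hx)
    fun w hw => parityCompatible_of_mem_parabolic hw

theorem coeff_T_mul_superSum {u : Composition (m + n) r} {d : Equiv.Perm (Fin r)}
    (hd : d⁻¹ ∈ shortest (parabolic u)) {S : Set (Equiv.Perm (Fin r))} (hS : S ⊆ parabolic u)
    (w : Equiv.Perm (Fin r)) :
    coeff w (T q d * superSum q u u S) = coeff (d⁻¹ * w) (superSum q u u S) := by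
  classical
  rw [superSum, Finset.mul_sum, map_sum, map_sum]
  refine Finset.sum_congr rfl fun y hy => ?_
  rw [Finset.mem_filter] at hy
  rw [mul_smul_comm, map_smul, map_smul,
    T_mul_T ((isYoung_parabolic u).length_mul' (hS hy.2) hd), coeff_T, coeff_T]
  simp only [eq_inv_mul_iff_mul_eq]

/-- The double coset `W_l d W_u`, as the set of permutations with the matrix of `d`. -/
def cosetSet (l : Composition (m + n) r) (d : Equiv.Perm (Fin r))
    (u : Composition (m + n) r) : Set (Equiv.Perm (Fin r)) :=
  {v | cosetMatrix l v u = cosetMatrix l d u}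

theorem cosetSet_parityCompatible {l u : Composition (m + n) r} {d : Equiv.Perm (Fin r)}
    (hd : d ∈ superShortest l u) : ∀ v ∈ cosetSet l d u, ParityCompatible l v u := fun v hv => by
  have := parityCompatible_iff.1 (mem_superShortest_iff.1 hd).2
  rw [← show cosetMatrix l v u = cosetMatrix l d u from hv] at this
  exact parityCompatible_iff.2 this

theorem superSum_cosetSet_mem_leftEigen {l u : Composition (m + n) r} {d : Equiv.Perm (Fin r)}
    (hd : d ∈ superShortest l u) : superSum q l u (cosetSet l d u) ∈ leftEigen l :=
  superSum_mem_leftEigen (fun _ hx _ hw => (cosetMatrix_mul_left _ _ hx).trans hw)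
    (cosetSet_parityCompatible hd)

theorem superSum_cosetSet_mem_rightEigen {l u : Composition (m + n) r} {d : Equiv.Perm (Fin r)}
    (hd : d ∈ superShortest l u) : superSum q l u (cosetSet l d u) ∈ rightEigen u :=
  superSum_mem_rightEigen (fun _ hx _ hw => (cosetMatrix_mul_right _ _ hx).trans hw)
    (cosetSet_parityCompatible hd)

theorem coeff_xy_mul {l : Composition (m + n) r} {v : Equiv.Perm (Fin r)}
    (hv : v ∈ shortest (parabolic l)) (z : Hecke q r)
    (hz : ∀ x ∈ parabolic l, x ≠ 1 → coeff (x⁻¹ * v) z = 0) :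
    coeff v (xy q l * z) = coeff v z := by
  classical
  rw [xy_eq_superSum, superSum, Finset.sum_mul, map_sum, Finset.sum_eq_single 1]
  · rw [oddInv_one, Finset.card_empty, pow_zero, Units.val_one, one_smul, ← Hecke.one_def, one_mul]
  · intro x hx hne
    rw [Finset.mem_filter] at hx
    have hlen := (isYoung_parabolic l).length_mul (inv_mem hx.2) hv
    rw [length_inv] at hlen
    rw [smul_mul_assoc, map_smul, coeff_T_mul hlen, hz x hx.2 hne, mul_zero, smul_zero]
  · intro h
    exact absurd (by simp [one_mem]) h

/-- For `y ∈ W_u` the product `d * y` is shortest for `W_l` if `y` is shortest for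
`d⁻¹ W_l d ∩ W_u`, and conversely. -/
theorem mul_mem_shortest_iff {l u : Composition (m + n) r} {d y : Equiv.Perm (Fin r)}
    (hd : d ∈ doubleShortest l u) (hy : y ∈ parabolic u) :
    d * y ∈ shortest (parabolic l) ↔ y ∈ shortest (conjBy (parabolic l) d ⊓ parabolic u) := by
  have hd' := mem_doubleShortest_iff.1 hd
  rw [(isYoung_parabolic l).mem_shortest_iff, (isYoung_inf hd).mem_shortest_iff]
  simp only [mul_inv_rev, Equiv.Perm.mul_apply, Prod.mk.injEq]
  constructor
  · rintro h i j hij ⟨hl, hu⟩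
    have := h _ _ (hd'.2 _ _ hij hu) hl
    rwa [inv_apply_self, inv_apply_self] at this
  · intro h i j hij hl
    have h1 := hd'.1 _ _ hij hl
    by_cases hu : row u (d⁻¹ i) = row u (d⁻¹ j)
    · exact h _ _ h1 ⟨by rwa [apply_inv_self, apply_inv_self], hu⟩
    · exact (isYoung_parabolic u).lt_of_ne (inv_mem hy) h1 hu

/-- The coefficients of `T_{W_l d W_u}`. -/
theorem cosetSum_eq_superSum {l u : Composition (m + n) r} {d : Equiv.Perm (Fin r)}
    (hd : d ∈ superShortest l u) : cosetSum q l d u = superSum q l u (cosetSet l d u) := by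
  have hds := hd.1
  have hyl := isYoung_parabolic l
  have hyu := isYoung_parabolic u
  rw [cosetSum, mul_assoc]
  refine eq_of_leftEigen (mul_mem_leftEigen (xy_mem_leftEigen l) _)
    (superSum_cosetSet_mem_leftEigen hd) fun v hv => ?_
  have htail : ∀ w, coeff w (T q d * tailSum q l d u) = coeff (d⁻¹ * w) (tailSum q l d u) := by
    intro w
    rw [tailSum_eq_superSum hds]
    exact coeff_T_mul_superSum hds.2 Set.inter_subset_right w
  rw [coeff_xy_mul hv, htail, tailSum_eq_superSum hds, coeff_superSum, coeff_superSum]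
  · by_cases hy : d⁻¹ * v ∈ parabolic u
    · have hdy : d * (d⁻¹ * v) = v := mul_inv_cancel_left d v
      have h1 := (mul_mem_shortest_iff hds hy).1 (by rwa [hdy])
      rw [if_pos ⟨h1, hy⟩, if_pos]
      · congr 3
        ext ⟨i, j⟩
        have hv' := hyl.mem_shortest_iff.1 hv
        have hrow := hyu.mem_iff _ |>.1 hy
        rw [mem_oddInv, mem_oddInv, hrow, hrow, or_self]
        have hd2 := (mem_doubleShortest_iff.1 hds).2
        have hiff : row u i = row u j → ((d⁻¹ * v) j < (d⁻¹ * v) i ↔ v j < v i) := by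
          intro h
          have e : ∀ p, v p = d ((d⁻¹ * v) p) := fun p => by
            rw [Equiv.Perm.mul_apply, apply_inv_self]
          rw [e i, e j]
          constructor
          · exact fun h1 => hd2 _ _ h1 (by rw [hrow, hrow, h])
          · intro h1
            by_contra h2
            rcases (not_lt.1 h2).lt_or_eq with h3 | h3
            · exact lt_asymm h1 (hd2 _ _ h3 (by rw [hrow, hrow, h]))
            · rw [h3] at h1
              exact lt_irrefl _ h1
        constructor
        · rintro ⟨⟨hij, hlt⟩, h2⟩
          exact ⟨⟨hij, (hiff h2.1).1 hlt⟩, Or.inl h2⟩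
        · rintro ⟨⟨hij, hlt⟩, h2 | h2⟩
          · exact ⟨⟨hij, (hiff h2.1).2 hlt⟩, h2⟩
          · have h3 := hv' _ _ hlt h2.1.symm
            rw [inv_apply_self, inv_apply_self] at h3
            exact absurd hij h3.not_gt
      · have := cosetMatrix_mul_right l d hy
        rwa [hdy] at this
    · rw [if_neg fun h => hy h.2, if_neg]
      intro h
      refine hy (hyu.mem_iff _ |>.2 fun p => ?_)
      have h1 := row_eq_of_cosetMatrix_eq (l := u) (u := l) (d := v⁻¹) (d' := d⁻¹)
        (by rwa [inv_inv]) (by rw [inv_inv]; exact hds.1)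
        (by rw [cosetMatrix_inv, cosetMatrix_inv, show cosetMatrix l v u = _ from h]) (v p)
      rw [inv_apply_self] at h1
      exact h1.symm
  · intro x hx hne
    rw [htail, tailSum_eq_superSum hds, coeff_superSum, if_neg]
    rintro ⟨h1, h2⟩
    have h3 := (mul_mem_shortest_iff hds h2).2 h1
    rw [mul_inv_cancel_left] at h3
    exact hne (inv_eq_one.1 (hyl.eq_one_of_mem_shortest (inv_mem hx) hv h3))

theorem cosetSum_mem_rightEigen {l u : Composition (m + n) r} {d : Equiv.Perm (Fin r)}
    (hd : d ∈ superShortest l u) : cosetSum q l d u ∈ rightEigen u := by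
  rw [cosetSum_eq_superSum hd]
  exact superSum_cosetSet_mem_rightEigen hd

theorem cosetSum_mem_leftEigen (l : Composition (m + n) r) (d : Equiv.Perm (Fin r))
    (u : Composition (m + n) r) : cosetSum q l d u ∈ leftEigen l := by
  rw [cosetSum, mul_assoc]
  exact mul_mem_leftEigen (xy_mem_leftEigen l) _

open scoped Classical in
/-- The part of `z` supported at the shortest representatives of the left cosets of
`W_u`. -/
noncomputable def leftFactor (u : Composition (m + n) r) (z : Hecke q r) : Hecke q r :=
  ∑ w ∈ Finset.univ.filter (fun w => w⁻¹ ∈ shortest (parabolic u)), coeff w z • T q w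

/-- The eigenvectors in `rightEigen u` are the left multiples of `xy q u`. -/
theorem leftFactor_mul_xy {u : Composition (m + n) r} {z : Hecke q r} (hz : z ∈ rightEigen u) :
    leftFactor u z * xy q u = z := by
  classical
  refine eq_of_rightEigen (mul_mem_rightEigen (xy_mem_rightEigen u) _) hz fun v hv => ?_
  rw [leftFactor, Finset.sum_mul, map_sum, Finset.sum_eq_single v]
  · rw [smul_mul_assoc, map_smul, xy_eq_superSum, coeff_T_mul_superSum hv le_rfl, coeff_superSum,
      inv_mul_cancel, if_pos (SetLike.mem_coe.2 (one_mem (parabolic u))), oddInv_one]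
    simp
  · intro w hw hne
    rw [Finset.mem_filter] at hw
    rw [smul_mul_assoc, map_smul, xy_eq_superSum, coeff_T_mul_superSum hw.2 le_rfl,
      coeff_superSum, if_neg, smul_zero]
    intro h
    have h1 := (isYoung_parabolic u).eq_one_of_mem_shortest (inv_mem h) hw.2
      (by rwa [mul_inv_rev, inv_inv, mul_inv_cancel_right])
    exact hne (inv_mul_eq_one.1 (inv_eq_one.1 h1))
  · intro h
    exact absurd (by simpa using hv) h

end SuperSum

/-! ### Double coset maps -/

section CosetMap

variable {R : Type*} [CommRing R] {q : Rˣ} {m n r : ℕ}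

/-- Left multiplication by `h`, as a map between two of the ideals generated by the `xy q l`. -/
noncomputable def mulLeftIdeal {l u : Composition (m + n) r} (h : Hecke q r)
    (hmem : h * xy q u ∈ xyIdeal q l) : xyIdeal q u →ₗ[(Hecke q r)ᵐᵒᵖ] xyIdeal q l where
  toFun y := ⟨h * y, by
    obtain ⟨y, hy⟩ := y
    obtain ⟨c, rfl⟩ := Submodule.mem_span_singleton.mp hy
    have := Submodule.smul_mem _ c hmem
    rwa [MulOpposite.smul_eq_mul_unop, mul_assoc] at this⟩
  map_add' x y := Subtype.ext (mul_add _ _ _)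
  map_smul' c y := Subtype.ext (by
    simp only [Submodule.coe_smul, MulOpposite.smul_eq_mul_unop, RingHom.id_apply, mul_assoc])

theorem exists_isCosetMap {l u : Composition (m + n) r} {d : Equiv.Perm (Fin r)}
    (hd : d ∈ superShortest l u) : ∃ f : SchurSuperalgebra q m n r, IsCosetMap q l d u f := by
  classical
  have hz := leftFactor_mul_xy (cosetSum_mem_rightEigen (q := q) hd)
  have hmem : leftFactor u (cosetSum q l d u) * xy q u ∈ xyIdeal q l := by
    rw [hz, ← mul_one (cosetSum q l d u)]
    exact cosetSum_mul_mem q l d u 1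
  refine ⟨DirectSum.lof _ _ (fun l => xyIdeal q l) l ∘ₗ mulLeftIdeal _ hmem ∘ₗ
    DirectSum.component _ _ (fun l => xyIdeal q l) u, fun a x => ?_⟩
  rw [← DirectSum.lof_eq_of (Hecke q r)ᵐᵒᵖ, ← DirectSum.lof_eq_of (Hecke q r)ᵐᵒᵖ]
  simp only [LinearMap.comp_apply]
  by_cases h : u = a
  · subst h
    rw [if_pos rfl, DirectSum.component.lof_self]
    congr 1
    refine Subtype.ext ?_
    change leftFactor u (cosetSum q l d u) * (xy q u * x) = cosetSum q l d u * x
    rw [← mul_assoc, hz]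
  · rw [if_neg h, DirectSum.component.of, dif_neg (Ne.symm h), map_zero, map_zero]

theorem isCosetMap_cosetMap {l u : Composition (m + n) r} {d : Equiv.Perm (Fin r)}
    (hd : d ∈ superShortest l u) : IsCosetMap q l d u (cosetMap q l d u) := by
  rw [cosetMap, dif_pos (exists_isCosetMap hd)]
  exact (exists_isCosetMap hd).choose_spec

theorem composition_eq_of_cosetMatrix_eq {l l' u u' : Composition (m + n) r}
    {d d' : Equiv.Perm (Fin r)} (h : cosetMatrix l d u = cosetMatrix l' d' u') :
    l = l' ∧ u = u' := by
  constructor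
  · refine Subtype.ext (funext fun i => ?_)
    rw [← sum_cosetMatrix_row l d u, h, sum_cosetMatrix_row]
  · refine Subtype.ext (funext fun i => ?_)
    rw [← sum_cosetMatrix_col l d u, h, sum_cosetMatrix_col]

theorem isCosetMap_phi {l u : Composition (m + n) r} {d : Equiv.Perm (Fin r)}
    (hd : d ∈ superShortest l u) : IsCosetMap q l d u (phi q r (cosetMatrix l d u)) := by
  have hex : ∃ t : Composition (m + n) r × Equiv.Perm (Fin r) × Composition (m + n) r,
      t.2.1 ∈ superShortest t.1 t.2.2 ∧ cosetMatrix t.1 t.2.1 t.2.2 = cosetMatrix l d u :=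
    ⟨(l, d, u), hd, rfl⟩
  rw [phi, dif_pos hex]
  obtain ⟨h1, h2⟩ := hex.choose_spec
  generalize hex.choose = t at h1 h2 ⊢
  obtain ⟨l', d', u'⟩ := t
  simp only at h1 h2 ⊢
  obtain ⟨rfl, rfl⟩ := composition_eq_of_cosetMatrix_eq h2
  obtain rfl := eq_of_cosetMatrix_eq h1.1 hd.1 h2
  exact isCosetMap_cosetMap hd

theorem phi_eq_zero {A : Matrix (Fin (m + n)) (Fin (m + n)) ℕ} (hA : A ∉ superMatrices m n r) :
    phi q r A = 0 := by
  rw [phi, dif_neg]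
  rintro ⟨t, h1, h2⟩
  exact hA ⟨t.1, t.2.2, t.2.1, h1, h2⟩

end CosetMap

/-! ### Moving one letter to a neighbouring block -/

section Cycle

variable {r : ℕ}

/-- The value of `cyc b t` at `p`, as a natural number. -/
def cycVal (b t p : ℕ) : ℕ :=
  if p = b then t else if p < b ∧ t ≤ p then p + 1 else if b < p ∧ p ≤ t then p - 1 else p

theorem cycVal_cycVal (b t p : ℕ) : cycVal t b (cycVal b t p) = p := by
  unfold cycVal
  split_ifs <;> omega

theorem cycVal_lt {b t p : ℕ} (hb : b < r) (ht : t < r) (hp : p < r) : cycVal b t p < r := by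
  unfold cycVal
  split_ifs <;> omega

/-- The permutation that takes `b` to `t` and is increasing on the other letters. -/
def cyc (b t : Fin r) : Equiv.Perm (Fin r) where
  toFun p := ⟨cycVal b t p, cycVal_lt b.2 t.2 p.2⟩
  invFun p := ⟨cycVal t b p, cycVal_lt t.2 b.2 p.2⟩
  left_inv p := Fin.ext (cycVal_cycVal b t p)
  right_inv p := Fin.ext (cycVal_cycVal t b p)

theorem cyc_inv (b t : Fin r) : (cyc b t)⁻¹ = cyc t b := rfl

theorem val_cyc (b t p : Fin r) : (cyc b t p : ℕ) = cycVal b t p := rfl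

theorem cyc_self (b t : Fin r) : cyc b t b = t := Fin.ext (by simp [val_cyc, cycVal])

theorem cyc_lt_cyc {b t i j : Fin r} (hi : i ≠ b) (hj : j ≠ b) (hij : i < j) :
    cyc b t i < cyc b t j := by
  rw [Fin.lt_def, val_cyc, val_cyc]
  rw [Fin.lt_def] at hij
  rw [ne_eq, Fin.ext_iff] at hi hj
  unfold cycVal
  split_ifs <;> omega

/-- The order `<` if `σ` is true, and the opposite order otherwise. It serves to treat a move of
a letter to the next block and a move to the previous block at once. -/
def Before {α : Type*} [LT α] (σ : Bool) (i j : α) : Prop :=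
  (σ = true ∧ i < j) ∨ (σ = false ∧ j < i)

instance {α : Type*} [LT α] [DecidableRel (α := α) (· < ·)] (σ : Bool) (i j : α) :
    Decidable (Before σ i j) :=
  inferInstanceAs (Decidable ((σ = true ∧ i < j) ∨ (σ = false ∧ j < i)))

section Before

variable {α : Type*} [LinearOrder α] {σ : Bool} {i j k : α}

theorem before_true : Before true i j ↔ i < j := by simp [Before]

theorem before_false : Before false i j ↔ j < i := by simp [Before]

theorem Before.trans (h1 : Before σ i j) (h2 : Before σ j k) : Before σ i k := by
  cases σ
  · rw [before_false] at *
    exact h2.trans h1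
  · rw [before_true] at *
    exact h1.trans h2

theorem Before.ne (h : Before σ i j) : i ≠ j := by
  cases σ
  · rw [before_false] at h
    exact h.ne'
  · rw [before_true] at h
    exact h.ne

theorem Before.asymm (h1 : Before σ i j) : ¬ Before σ j i := fun h2 => (h1.trans h2).ne rfl

theorem before_trichotomy (σ : Bool) (i j : α) : Before σ i j ∨ i = j ∨ Before σ j i := by
  cases σ
  · simp only [before_false]
    rcases lt_trichotomy i j with h | h | h
    · exact Or.inr (Or.inr h)
    · exact Or.inr (Or.inl h)
    · exact Or.inl h
  · simp only [before_true]
    exact lt_trichotomy i j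

theorem lt_iff_before_or (σ : Bool) (f : α → α) :
    (i < j ∧ f j < f i) ∨ (j < i ∧ f i < f j) ↔
      (Before σ i j ∧ Before σ (f j) (f i)) ∨ (Before σ j i ∧ Before σ (f i) (f j)) := by
  cases σ
  · simp only [before_false]
    tauto
  · simp only [before_true]

theorem Before.map {β : Type*} [LinearOrder β] {f : α → β}
    (hf : i < j → f i < f j) (hf' : j < i → f j < f i) (h : Before σ i j) :
    Before σ (f i) (f j) := by
  cases σ
  · rw [before_false] at *
    exact hf' h
  · rw [before_true] at *
    exact hf h

theorem Before.of_monotone {β : Type*} [LinearOrder β] {f : α → β} (hf : Monotone f)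
    (h : Before σ (f i) (f j)) : Before σ i j := by
  cases σ
  · rw [before_false] at *
    exact hf.reflect_lt h
  · rw [before_true] at *
    exact hf.reflect_lt h

/-- A set of pairs of letters that all involve the letter `P` is counted by the other letters. -/
theorem card_eq_of_pivot {F : Finset (α × α)} {Q : Finset α} (P : α)
    (hlt : ∀ i j, (i, j) ∈ F → i < j) (hP : ∀ i j, (i, j) ∈ F → i = P ∨ j = P)
    (hQ : ∀ i, i ∈ Q ↔ (i, P) ∈ F ∨ (P, i) ∈ F) : F.card = Q.card := by
  symm
  refine Finset.card_bij (fun i _ => if i < P then (i, P) else (P, i)) ?_ ?_ ?_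
  · intro i hi
    rcases (hQ i).1 hi with h | h
    · rwa [if_pos (hlt _ _ h)]
    · rwa [if_neg (hlt _ _ h).not_gt]
  · intro i hi j hj h
    by_cases h1 : i < P <;> by_cases h2 : j < P <;>
      simp only [h1, h2, if_true, if_false, Prod.mk.injEq, and_true, true_and] at h
    · exact h
    · exact absurd h.1 h1.ne
    · exact absurd h.1.symm h2.ne
    · exact h
  · rintro ⟨i, j⟩ h
    have h1 := hlt _ _ h
    rcases hP _ _ h with h2 | h2
    · subst h2
      exact ⟨j, (hQ j).2 (Or.inr h), by rw [if_neg h1.not_gt]⟩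
    · subst h2
      exact ⟨i, (hQ i).2 (Or.inl h), by rw [if_pos h1]⟩

/-- Summing a function of the number of later elements of a finite set. -/
theorem sum_card_before {M : Type*} [AddCommMonoid M] (σ : Bool) (S : Finset α) (f : ℕ → M) :
    ∑ t ∈ S, f (S.filter fun s => Before σ t s).card = ∑ i ∈ Finset.range S.card, f i := by
  have key : ∀ t ∈ S, ∀ s ∈ S, Before σ t s →
      (S.filter fun s' => Before σ s s').card < (S.filter fun s' => Before σ t s').card := by
    intro t ht s hs hts
    refine Finset.card_lt_card (Finset.ssubset_iff_subset_ne.2 ⟨fun s' hs' => ?_, fun he => ?_⟩)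
    · rw [Finset.mem_filter] at hs' ⊢
      exact ⟨hs'.1, hts.trans hs'.2⟩
    · have : s ∈ S.filter fun s' => Before σ t s' := Finset.mem_filter.2 ⟨hs, hts⟩
      rw [← he, Finset.mem_filter] at this
      exact this.2.ne rfl
  have hinj : Set.InjOn (fun t => (S.filter fun s => Before σ t s).card) S := by
    intro t ht s hs h
    rcases before_trichotomy σ t s with h1 | h1 | h1
    · exact absurd h (key t ht s hs h1).ne'
    · exact h1
    · exact absurd h (key s hs t ht h1).ne
  have hmaps : ∀ t ∈ S, (S.filter fun s => Before σ t s).card ∈ Finset.range S.card := by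
    intro t ht
    rw [Finset.mem_range]
    exact Finset.card_lt_card (Finset.filter_ssubset.2 ⟨t, ht, fun h => h.ne rfl⟩)
  -- an injective map between finite sets of equal size is surjective
  exact Finset.sum_nbij _ hmaps hinj
    (Finset.surjOn_of_injOn_of_card_le _ hmaps hinj (by simp)) fun _ _ => rfl

end Before

end Cycle

section MoveLetter

variable {N r : ℕ}

/-- The compositions `l` and `e` differ in that the letter `b` belongs to the `x`-th block of `l`
and to the `y`-th block of `e`. -/
structure MoveLetter (l e : Composition N r) (x y : Fin N) (b : Fin r) : Prop where
  row_left : row l b = x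
  row_right : row e b = y
  row_eq : ∀ p, p ≠ b → row e p = row l p

theorem MoveLetter.symm {l e : Composition N r} {x y : Fin N} {b : Fin r}
    (M : MoveLetter l e x y b) : MoveLetter e l y x b :=
  ⟨M.row_right, M.row_left, fun p hp => (M.row_eq p hp).symm⟩

theorem partialSum_add_ite {l e : Composition N r} {x y : Fin N}
    (h : ∀ i, l.1 i + (if i = y then 1 else 0) = e.1 i + if i = x then 1 else 0) (a : ℕ) :
    partialSum l.1 a + (if (y : ℕ) < a then 1 else 0) =
      partialSum e.1 a + if (x : ℕ) < a then 1 else 0 := by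
  have := Finset.sum_congr (rfl : Finset.univ.filter (fun j : Fin N => (j : ℕ) < a) = _)
    fun i _ => h i
  rw [Finset.sum_add_distrib, Finset.sum_add_distrib, Finset.sum_ite_eq',
    Finset.sum_ite_eq'] at this
  simpa [partialSum] using this

theorem exists_moveLetter_of_succ {l e : Composition N r} {x y : Fin N}
    (h : ∀ i, l.1 i + (if i = y then 1 else 0) = e.1 i + if i = x then 1 else 0)
    (hxy : (x : ℕ) + 1 = y) : ∃ b, MoveLetter l e x y b := by
  have hP : ∀ a, partialSum l.1 a = partialSum e.1 a + if a = y then 1 else 0 := by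
    intro a
    have := partialSum_add_ite h a
    split_ifs at this ⊢ <;> omega
  have hy := h y
  rw [if_pos rfl, if_neg (by rintro rfl; omega)] at hy
  have hPy := hP y
  rw [if_pos rfl] at hPy
  have hr := partialSum_mono l.1 y.2.le
  rw [partialSum_card] at hr
  have h1 := partialSum_succ e.1 y
  have h2 := hP x
  have h3 := partialSum_mono e.1 (show (x : ℕ) ≤ y by omega)
  refine ⟨⟨partialSum e.1 y, by omega⟩, row_eq_iff.2 (mem_block.2 ?_),
    row_eq_iff.2 (mem_block.2 ?_), fun p hp => Eq.symm (row_eq_iff.2 (mem_block.2 ?_))⟩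
  · rw [hxy]
    split_ifs at h2
    · omega
    · constructor
      · change _ ≤ partialSum e.1 y
        omega
      · change partialSum e.1 y < _
        omega
  · constructor
    · exact le_rfl
    · change partialSum e.1 y < _
      omega
  · have h4 := mem_block.1 (mem_block_row e p)
    rw [hP, hP]
    rw [ne_eq, Fin.ext_iff] at hp
    change ¬ (p : ℕ) = partialSum e.1 y at hp
    refine ⟨?_, h4.2.trans_le (Nat.le_add_right _ _)⟩
    split_ifs with h5
    · rw [h5] at h4 ⊢
      omega
    · exact h4.1

theorem exists_moveLetter {l e : Composition N r} {x y : Fin N}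
    (h : ∀ i, l.1 i + (if i = y then 1 else 0) = e.1 i + if i = x then 1 else 0)
    (hxy : (x : ℕ) + 1 = y ∨ (y : ℕ) + 1 = x) : ∃ b, MoveLetter l e x y b := by
  rcases hxy with hxy | hxy
  · exact exists_moveLetter_of_succ h hxy
  · obtain ⟨b, M⟩ := exists_moveLetter_of_succ (fun i => (h i).symm) hxy
    exact ⟨b, M.symm⟩

namespace MoveLetter

variable {l e : Composition N r} {x y : Fin N} {b t : Fin r} {σ : Bool}

theorem eq_or_before (M : MoveLetter l e x y b) (hσ : Before σ x y) {s : Fin r}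
    (hs : row l s = x) : s = b ∨ Before σ s b := by
  by_cases h : s = b
  · exact Or.inl h
  · refine Or.inr (Before.of_monotone (row_mono e) ?_)
    rwa [M.row_eq s h, hs, M.row_right]

theorem row_eq_of_before (M : MoveLetter l e x y b) {s : Fin r} (ht : row l t = x)
    (hts : Before σ t s) (hsb : s = b ∨ Before σ s b) : row l s = x := by
  rcases hsb with rfl | hsb
  · exact M.row_left
  · have hb := M.row_left
    cases σ
    · rw [before_false] at hts hsb
      exact ((isYoung_parabolic l).convex _ _ _ hsb.le hts.le (hb.trans ht.symm)).symm.trans hb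
    · rw [before_true] at hts hsb
      exact ((isYoung_parabolic l).convex _ _ _ hts.le hsb.le (ht.trans hb.symm)).symm.trans ht

theorem cyc_mem (M : MoveLetter l e x y b) (ht : row l t = x) : cyc b t ∈ parabolic l := by
  rw [(isYoung_parabolic l).mem_iff]
  intro p
  have hb := M.row_left
  have hmid : ∀ s : Fin r, (b ≤ s ∧ s ≤ t) ∨ (t ≤ s ∧ s ≤ b) → row l s = x := by
    rintro s (⟨h1, h2⟩ | ⟨h1, h2⟩)
    · exact ((isYoung_parabolic l).convex _ _ _ h1 h2 (hb.trans ht.symm)).symm.trans hb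
    · exact ((isYoung_parabolic l).convex _ _ _ h1 h2 (ht.trans hb.symm)).symm.trans ht
  by_cases h : cyc b t p = p
  · rw [h]
  · rw [Fin.ext_iff, val_cyc] at h
    rw [hmid p, hmid (cyc b t p)]
    · simp only [Fin.le_def, val_cyc]
      unfold cycVal at h ⊢
      split_ifs at h ⊢ <;> omega
    · simp only [Fin.le_def]
      unfold cycVal at h
      split_ifs at h <;> omega

theorem row_cyc_of_ne (M : MoveLetter l e x y b) (ht : row l t = x) {s : Fin r} (hs : s ≠ t) :
    row e (cyc t b s) = row l s := by
  rw [M.row_eq, ← cyc_inv, (isYoung_parabolic l).mem_iff _ |>.1 (inv_mem (M.cyc_mem ht))]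
  intro h
  exact hs ((cyc t b).injective (h.trans (cyc_self t b).symm))

theorem before_cyc_iff (h : t = b ∨ Before σ t b) {s : Fin r} (hs : s ≠ t) :
    Before σ (cyc t b s) b ↔ s = b ∨ Before σ s b := by
  rw [ne_eq, Fin.ext_iff] at hs
  cases σ <;> simp only [before_false, before_true, Fin.ext_iff, Fin.lt_def, val_cyc] at h ⊢ <;>
    unfold cycVal <;> split_ifs <;> omega

theorem before_cyc_iff' (h : t = b ∨ Before σ t b) {s : Fin r} (hs : s ≠ t) :
    Before σ b (cyc t b s) ↔ Before σ b s := by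
  rw [ne_eq, Fin.ext_iff] at hs
  cases σ <;> simp only [before_false, before_true, Fin.ext_iff, Fin.lt_def, val_cyc] at h ⊢ <;>
    unfold cycVal <;> split_ifs <;> omega

theorem length_cyc (M : MoveLetter l e x y b) (hσ : Before σ x y) (ht : row l t = x) :
    length (cyc b t) = (Finset.univ.filter fun s => row l s = x ∧ Before σ t s).card := by
  rw [← length_inv, cyc_inv, length_eq_card_inversions]
  have htb := M.eq_or_before hσ ht
  refine card_eq_of_pivot t (fun i j h => (mem_inversions.1 h).1) (fun i j h => ?_) fun s => ?_
  · by_contra hne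
    rw [not_or] at hne
    have := mem_inversions.1 h
    exact lt_asymm this.2 (cyc_lt_cyc hne.1 hne.2 this.1)
  · rw [mem_inversions, mem_inversions, Finset.mem_filter, lt_iff_before_or σ, cyc_self]
    by_cases hs : s = t
    · subst hs
      simp only [Finset.mem_univ, true_and]
      exact iff_of_false (fun h => h.2.ne rfl) fun h => by
        rcases h with h | h <;> exact h.1.ne rfl
    · rw [before_cyc_iff htb hs, before_cyc_iff' htb hs]
      simp only [Finset.mem_univ, true_and]
      constructor
      · rintro ⟨h1, h2⟩
        exact Or.inr ⟨h2, M.eq_or_before hσ h1⟩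
      · rintro (⟨h1, h2⟩ | ⟨h1, h2⟩)
        · rcases htb with rfl | htb
          · exact absurd h2 h1.asymm
          · exact absurd h2 (h1.trans htb).asymm
        · exact ⟨M.row_eq_of_before ht h1 h2, h1⟩

theorem cyc_lt_of_row_eq (M : MoveLetter l e x y b) (hxy : x ≠ y) (ht : row l t = x)
    {i j : Fin r} (hij : i < j) (hrow : row e i = row e j) : cyc b t i < cyc b t j := by
  by_cases hi : i = b
  · subst hi
    rw [M.row_right] at hrow
    have hj : row l j = y := by rw [← M.row_eq j hij.ne', hrow]
    have h1 : x < y := lt_of_le_of_ne (by rw [← M.row_left, ← hj]; exact row_mono l hij.le) hxy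
    have h2 := M.eq_or_before (σ := true) (before_true.2 h1) ht
    rw [before_true] at h2
    rw [cyc_self, Fin.lt_def, val_cyc]
    rw [Fin.ext_iff, Fin.lt_def] at h2
    rw [Fin.lt_def] at hij
    unfold cycVal
    split_ifs <;> omega
  · by_cases hj : j = b
    · subst hj
      rw [M.row_right, M.row_eq i hi] at hrow
      have h1 : y < x := lt_of_le_of_ne (by rw [← M.row_left, ← hrow]; exact row_mono l hij.le)
        hxy.symm
      have h2 := M.eq_or_before (σ := false) (before_false.2 h1) ht
      rw [before_false] at h2
      rw [cyc_self, Fin.lt_def, val_cyc]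
      rw [Fin.ext_iff, Fin.lt_def] at h2
      rw [Fin.lt_def] at hij
      unfold cycVal
      split_ifs <;> omega
    · exact cyc_lt_cyc hi hj hij

theorem cyc_inv_mem_shortest (M : MoveLetter l e x y b) (hxy : x ≠ y) (ht : row l t = x) :
    (cyc b t)⁻¹ ∈ shortest (parabolic e) := by
  rw [(isYoung_parabolic e).mem_shortest_iff, inv_inv]
  exact fun i j => M.cyc_lt_of_row_eq hxy ht

/-- The shortest representatives of the left cosets of `W_l ∩ W_e` in `W_l`. -/
theorem eq_cyc (M : MoveLetter l e x y b) (hxy : x ≠ y) {w : Equiv.Perm (Fin r)}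
    (hw : w ∈ parabolic l) (hw' : w⁻¹ ∈ shortest (parabolic e)) : w = cyc b (w b) := by
  have hl := (isYoung_parabolic l).mem_iff
  have ht : row l (w b) = x := by rw [(hl w).1 hw, M.row_left]
  have h1 := M.cyc_inv_mem_shortest hxy ht
  have hmem : w⁻¹ * cyc b (w b) ∈ parabolic e := by
    rw [(isYoung_parabolic e).mem_iff]
    intro p
    have hfix : (w⁻¹ * cyc b (w b)) b = b := by
      rw [Equiv.Perm.mul_apply, cyc_self, inv_apply_self]
    by_cases hp : p = b
    · rw [hp, hfix]
    · rw [M.row_eq p hp, M.row_eq, (hl _).1 (mul_mem (inv_mem hw) (M.cyc_mem ht))]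
      intro h
      exact hp ((w⁻¹ * cyc b (w b)).injective (h.trans hfix.symm))
  have := (isYoung_parabolic e).eq_one_of_mem_shortest hmem h1 (by rwa [mul_inv_cancel_right])
  exact inv_mul_eq_one.1 this

end MoveLetter

end MoveLetter

/-! ### Coefficients of a product -/

theorem exists_right_factor {R : Type*} [CommRing R] {q : Rˣ} {m n r : ℕ}
    (l : Composition (m + n) r) (d : Equiv.Perm (Fin r))
    (u : Composition (m + n) r) : ∃ h, cosetSum q l d u = xy q l * h :=
  ⟨Hecke.T q d * tailSum q l d u, by rw [cosetSum, mul_assoc]⟩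

theorem moveUnit_eq_iff {N : ℕ} {A B : Matrix (Fin N) (Fin N) ℕ} {x y k : Fin N} (hxy : x ≠ y) :
    B + Matrix.single y k 1 = A + Matrix.single x k 1 ↔ 1 ≤ A y k ∧ B = moveUnit A y x k := by
  have hval : ∀ i j, Matrix.single y k 1 i j = if y = i ∧ k = j then 1 else 0 :=
    fun i j => Matrix.single_apply ..
  have hval' : ∀ i j, Matrix.single x k 1 i j = if x = i ∧ k = j then 1 else 0 :=
    fun i j => Matrix.single_apply ..
  have hone : 1 ≤ A y k → ∀ i j, (y = i ∧ k = j) → 1 ≤ A i j := by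
    rintro h i j ⟨rfl, rfl⟩
    exact h
  constructor
  · intro h
    have hentry : ∀ i j, B i j + (if y = i ∧ k = j then 1 else 0) =
        A i j + if x = i ∧ k = j then 1 else 0 := fun i j => by
      have := congrFun (congrFun h i) j
      rwa [Matrix.add_apply, Matrix.add_apply, hval, hval'] at this
    refine ⟨?_, ?_⟩
    · have := hentry y k
      rw [if_pos ⟨rfl, rfl⟩, if_neg fun h => hxy h.1] at this
      omega
    · ext i j
      rw [moveUnit, Matrix.sub_apply, Matrix.add_apply, hval, hval', ← hentry, Nat.add_sub_cancel]
  · rintro ⟨h1, rfl⟩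
    ext i j
    rw [Matrix.add_apply, Matrix.add_apply, moveUnit, Matrix.sub_apply, Matrix.add_apply, hval,
      hval']
    have := hone h1 i j
    split_ifs <;> omega

namespace MoveLetter

section Counting

variable {m n r : ℕ} {l e u : Composition (m + n) r} {x y : Fin (m + n)} {b t : Fin r} {σ : Bool}
  {d : Equiv.Perm (Fin r)}

/-- Moving the letter `t` of the `x`-th block out to the position `b`, one changes the matrix of
`d` in the column of `t` only. -/
theorem cosetMatrix_cyc (M : MoveLetter l e x y b) (ht : row l t = x) :
    cosetMatrix e ((cyc b t)⁻¹ * d) u + Matrix.single x (row u (d⁻¹ t)) 1 =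
      cosetMatrix l d u + Matrix.single y (row u (d⁻¹ t)) 1 := by
  ext i j
  rw [Matrix.add_apply, Matrix.add_apply, cosetMatrix_apply, cosetMatrix_apply,
    Finset.card_filter, Finset.card_filter, ← Finset.add_sum_erase _ _ (Finset.mem_univ (d⁻¹ t)),
    ← Finset.add_sum_erase _ (fun p => if row l (d p) = i ∧ row u p = j then 1 else 0)
      (Finset.mem_univ (d⁻¹ t))]
  have h1 : ∀ p ∈ Finset.univ.erase (d⁻¹ t),
      (if row e (((cyc b t)⁻¹ * d) p) = i ∧ row u p = j then 1 else 0) =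
        if row l (d p) = i ∧ row u p = j then 1 else 0 := by
    intro p hp
    have hne : d p ≠ t := fun h => (Finset.mem_erase.1 hp).1 (by rw [← h, inv_apply_self])
    rw [Equiv.Perm.mul_apply, cyc_inv, M.row_cyc_of_ne ht hne]
  rw [Finset.sum_congr rfl h1, Equiv.Perm.mul_apply, apply_inv_self, cyc_inv, cyc_self, M.row_right,
    ht, Matrix.single_apply, Matrix.single_apply]
  omega

/-- The length counts the letters of the `x`-th block that come after `t` in the order `Before σ`;
they are sorted here by their columns. -/
theorem length_cyc_eq (M : MoveLetter l e x y b) (hσ : Before σ x y) (ht : row l t = x)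
    (hd : d ∈ doubleShortest l u) :
    length (cyc b t) = ∑ j ∈ Finset.univ.filter (fun j => Before σ (row u (d⁻¹ t)) j),
        cosetMatrix l d u x j +
      (Finset.univ.filter fun s => (row l s = x ∧ row u (d⁻¹ s) = row u (d⁻¹ t)) ∧
        Before σ t s).card := by
  rw [M.length_cyc hσ ht]
  have hd1 := (mem_doubleShortest_iff.1 hd).1
  rw [← Finset.card_filter_add_card_filter_not fun s => Before σ (row u (d⁻¹ t)) (row u (d⁻¹ s))]
  congr 1
  · rw [Finset.filter_filter, ← Finset.card_map d⁻¹.toEmbedding,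
      Finset.card_eq_sum_card_fiberwise (f := row u)
        (t := Finset.univ.filter fun j => Before σ (row u (d⁻¹ t)) j)]
    · refine Finset.sum_congr rfl fun j hj => ?_
      rw [Finset.mem_filter] at hj
      rw [cosetMatrix_apply]
      congr 1
      ext p
      rw [Finset.mem_filter, Finset.mem_map_equiv, Finset.mem_filter, Finset.mem_filter]
      change ((_ ∧ (row l (d p) = x ∧ Before σ t (d p)) ∧
        Before σ (row u (d⁻¹ t)) (row u (d⁻¹ (d p)))) ∧ row u p = j) ↔ _
      rw [inv_apply_self]
      constructor
      · rintro ⟨⟨-, ⟨h1, -⟩, -⟩, h2⟩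
        exact ⟨Finset.mem_univ _, h1, h2⟩
      · rintro ⟨-, h1, h2⟩
        have h3 : Before σ (d⁻¹ t) p := Before.of_monotone (row_mono u) (h2 ▸ hj.2)
        refine ⟨⟨Finset.mem_univ _, ⟨h1, ?_⟩, h2 ▸ hj.2⟩, h2⟩
        rcases before_trichotomy σ t (d p) with h4 | h4 | h4
        · exact h4
        · rw [h4, inv_apply_self] at h3
          exact absurd rfl h3.ne
        · have h5 : Before σ (d⁻¹ (d p)) (d⁻¹ t) :=
            h4.map (fun h => hd1 _ _ h (h1.trans ht.symm)) fun h => hd1 _ _ h (ht.trans h1.symm)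
          rw [inv_apply_self] at h5
          exact absurd h3 h5.asymm
    · intro p hp
      have hp := Finset.mem_coe.1 hp
      rw [Finset.mem_map_equiv, Finset.mem_filter] at hp
      have h1 : Before σ (row u (d⁻¹ t)) (row u (d⁻¹ (d p))) := hp.2.2
      rw [inv_apply_self] at h1
      simpa using h1
  · congr 1
    ext s
    simp only [Finset.mem_filter, Finset.mem_univ, true_and]
    constructor
    · rintro ⟨⟨h1, h2⟩, h3⟩
      refine ⟨⟨h1, ?_⟩, h2⟩
      rcases before_trichotomy σ (row u (d⁻¹ t)) (row u (d⁻¹ s)) with h4 | h4 | h4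
      · exact absurd h4 h3
      · exact h4.symm
      · have h5 : Before σ (d⁻¹ t) (d⁻¹ s) :=
          h2.map (fun h => hd1 _ _ h (ht.trans h1.symm)) fun h => hd1 _ _ h (h1.trans ht.symm)
        exact absurd h5 (Before.of_monotone (row_mono u) h4).asymm
    · rintro ⟨⟨h1, h2⟩, h3⟩
      exact ⟨⟨h1, h3⟩, fun h => h.ne h2.symm⟩

/-- The odd inversions of `(cyc b t)⁻¹ d` all involve the letter `d⁻¹ t`. Its partners are the
letters of the `y`-th block in the columns before that of `t`, if `y` is odd, and the letters of
the `x`-th block in the same column that come after `t`, if that column is odd; the order is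
`Before σ` in both cases. -/
theorem card_oddInv_cyc (M : MoveLetter l e x y b) (hσ : Before σ x y) (ht : row l t = x)
    (hd : d ∈ doubleShortest l u) :
    (oddInv e ((cyc b t)⁻¹ * d) u).card =
      (if (y : ℕ) < m then 0 else ∑ j ∈ Finset.univ.filter
          (fun j => Before σ j (row u (d⁻¹ t))), cosetMatrix l d u y j) +
      if (row u (d⁻¹ t) : ℕ) < m then 0 else
        (Finset.univ.filter fun s => (row l s = x ∧ row u (d⁻¹ s) = row u (d⁻¹ t)) ∧
          Before σ t s).card := by
  have hd1 := (mem_doubleShortest_iff.1 hd).1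
  have hd2 := (mem_doubleShortest_iff.1 hd).2
  have htb := M.eq_or_before hσ ht
  set P := d⁻¹ t with hP
  have hdP : d P = t := apply_inv_self d t
  have hvP : ((cyc b t)⁻¹ * d) P = b := by rw [Equiv.Perm.mul_apply, hdP, cyc_inv, cyc_self]
  have hdne : ∀ p, p ≠ P → d p ≠ t := fun p hp h => hp (by rw [hP, ← h, inv_apply_self])
  have hrow : ∀ p, p ≠ P → row e (((cyc b t)⁻¹ * d) p) = row l (d p) := fun p hp => by
    rw [Equiv.Perm.mul_apply, cyc_inv, M.row_cyc_of_ne ht (hdne p hp)]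
  -- the two kinds of partners of `P`
  set Q₁ : Finset (Fin r) :=
    Finset.univ.filter fun p => ¬ (y : ℕ) < m ∧ row l (d p) = y ∧ Before σ p P with hQ₁
  set Q₂ : Finset (Fin r) := Finset.univ.filter fun p => ¬ (row u P : ℕ) < m ∧
    (row l (d p) = x ∧ row u p = row u P) ∧ Before σ t (d p) with hQ₂
  have hdisj : Disjoint Q₁ Q₂ := by
    rw [Finset.disjoint_left]
    intro p h1 h2
    rw [hQ₁, Finset.mem_filter] at h1
    rw [hQ₂, Finset.mem_filter] at h2
    exact hσ.ne (h2.2.2.1.1.symm.trans h1.2.2.1)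
  have hbefore : ∀ p, row u p = row u P → Before σ p P → Before σ (d p) t := fun p hu h => by
    rw [← hdP]
    exact h.map (fun h' => hd2 _ _ h' hu) fun h' => hd2 _ _ h' hu.symm
  have hbefore' : ∀ p, row u p = row u P → Before σ P p → Before σ t (d p) := fun p hu h => by
    rw [← hdP]
    exact h.map (fun h' => hd2 _ _ h' hu.symm) fun h' => hd2 _ _ h' hu
  have hcard : (oddInv e ((cyc b t)⁻¹ * d) u).card = (Q₁ ∪ Q₂).card := by
    refine card_eq_of_pivot P (fun i j h => (mem_oddInv.1 h).1.1) (fun i j h => ?_) fun p => ?_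
    · by_contra hne
      rw [not_or] at hne
      obtain ⟨⟨hij, hlt⟩, h⟩ := mem_oddInv.1 h
      rw [hrow i hne.1, hrow j hne.2] at h
      have h1 : d j < d i := by
        by_contra h1
        rcases (not_lt.1 h1).lt_or_eq with h2 | h2
        · have := cyc_lt_cyc (t := b) (hdne i hne.1) (hdne j hne.2) h2
          exact lt_asymm this hlt
        · exact hij.ne (d.injective h2)
      rcases h with h | h
      · exact lt_asymm h1 (hd2 _ _ hij h.1)
      · have := hd1 _ _ h1 h.1.symm
        rw [inv_apply_self, inv_apply_self] at this
        exact lt_asymm hij this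
    · by_cases hp : p = P
      · refine iff_of_false (fun h => ?_) fun h => ?_
        · rw [Finset.mem_union, hQ₁, hQ₂, Finset.mem_filter, Finset.mem_filter, hp, hdP] at h
          rcases h with h | h
          · exact h.2.2.2.ne rfl
          · exact h.2.2.2.ne rfl
        · rw [hp] at h
          rcases h with h | h <;> exact (mem_oddInv.1 h).1.1.ne rfl
      · have hinv : ((p, P) ∈ oddInv e ((cyc b t)⁻¹ * d) u ∨
            (P, p) ∈ oddInv e ((cyc b t)⁻¹ * d) u) ↔
            ((Before σ p P ∧ Before σ b (d p)) ∨
              (Before σ P p ∧ (d p = b ∨ Before σ (d p) b))) ∧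
            ((row u p = row u P ∧ m ≤ (row u P : ℕ)) ∨ (row l (d p) = y ∧ m ≤ (y : ℕ))) := by
          have e1 : ((cyc b t)⁻¹ * d) p = cyc t b (d p) := rfl
          have := lt_iff_before_or (i := p) (j := P) σ (DFunLike.coe ((cyc b t)⁻¹ * d))
          rw [hvP, e1, before_cyc_iff htb (hdne p hp), before_cyc_iff' htb (hdne p hp)] at this
          rw [← this, mem_oddInv, mem_oddInv, hrow p hp, hvP, M.row_right, e1,
            eq_comm (a := row u P), eq_comm (a := y), or_and_right]
          refine or_congr (and_congr_right fun _ => or_congr (and_congr_right fun h => ?_)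
            (and_congr_right fun h => ?_)) Iff.rfl <;> rw [h]
        rw [hinv, Finset.mem_union, hQ₁, hQ₂, Finset.mem_filter, Finset.mem_filter]
        simp only [Finset.mem_univ, true_and, not_lt]
        constructor
        · rintro (⟨h1, h2, h3⟩ | ⟨h1, ⟨h2, h3⟩, h4⟩)
          · refine ⟨Or.inl ⟨h3, Before.of_monotone (row_mono l) ?_⟩, Or.inr ⟨h2, h1⟩⟩
            rwa [h2, M.row_left]
          · refine ⟨Or.inr ⟨?_, M.eq_or_before hσ h2⟩, Or.inl ⟨h3, h1⟩⟩
            rcases before_trichotomy σ P p with h5 | h5 | h5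
            · exact h5
            · exact absurd h5.symm hp
            · exact absurd h4 (hbefore p h3 h5).asymm
        · rintro ⟨h1, ⟨h2, h3⟩ | ⟨h2, h3⟩⟩
          · rcases h1 with ⟨h1, h4⟩ | ⟨h1, h4⟩
            · have h5 := hbefore p h2 h1
              rcases htb with rfl | htb
              · exact absurd h4 h5.asymm
              · exact absurd h4 (h5.trans htb).asymm
            · have h5 := hbefore' p h2 h1
              exact Or.inr ⟨h3, ⟨M.row_eq_of_before ht h5 h4, h2⟩, h5⟩
          · rcases h1 with ⟨h1, h4⟩ | ⟨h1, h4⟩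
            · exact Or.inl ⟨h3, h2, h1⟩
            · exfalso
              rcases h4 with h4 | h4
              · rw [h4, M.row_left] at h2
                exact hσ.ne h2
              · have h5 : Before σ b (d p) := Before.of_monotone (row_mono l) (by
                  rwa [h2, M.row_left])
                exact h4.asymm h5
  rw [hcard, Finset.card_union_of_disjoint hdisj]
  congr 1
  · split_ifs with hy
    · rw [Finset.card_eq_zero, hQ₁, Finset.filter_eq_empty_iff]
      exact fun p _ h => h.1 hy
    · rw [Finset.card_eq_sum_card_fiberwise (f := row u)
        (t := Finset.univ.filter fun j => Before σ j (row u P))]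
      · refine Finset.sum_congr rfl fun j hj => ?_
        rw [Finset.mem_filter] at hj
        rw [cosetMatrix_apply]
        congr 1
        ext p
        rw [hQ₁, Finset.mem_filter, Finset.mem_filter, Finset.mem_filter]
        constructor
        · rintro ⟨⟨h0, -, h1, -⟩, h2⟩
          exact ⟨h0, h1, h2⟩
        · rintro ⟨h0, h1, h2⟩
          exact ⟨⟨h0, hy, h1, Before.of_monotone (row_mono u) (h2 ▸ hj.2)⟩, h2⟩
      · intro p hp
        rw [Finset.mem_coe, hQ₁, Finset.mem_filter] at hp
        obtain ⟨-, -, h1, h2⟩ := hp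
        suffices h : Before σ (row u p) (row u P) by simpa using h
        rcases before_trichotomy σ (row u p) (row u P) with h3 | h3 | h3
        · exact h3
        · have h4 := hbefore p h3 h2
          have h5 : Before σ t (d p) := Before.of_monotone (row_mono l) (by rwa [ht, h1])
          exact absurd h5 h4.asymm
        · exact absurd (Before.of_monotone (row_mono u) h3) h2.asymm
  · split_ifs with hk
    · rw [Finset.card_eq_zero, hQ₂, Finset.filter_eq_empty_iff]
      exact fun p _ h => h.1 hk
    · rw [← Finset.card_map d.toEmbedding]
      congr 1
      ext s
      rw [Finset.mem_map_equiv, hQ₂, Finset.mem_filter, Finset.mem_filter]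
      change (_ ∧ _ ∧ (row l (d (d⁻¹ s)) = x ∧ row u (d⁻¹ s) = _) ∧ Before σ t (d (d⁻¹ s))) ↔ _
      rw [apply_inv_self]
      simp only [Finset.mem_univ, true_and, hk, not_false_eq_true]

theorem cosetMatrix_one (M : MoveLetter l e x y b) (i j : Fin (m + n)) (hij : i ≠ j) :
    cosetMatrix l 1 e i j = if i = x ∧ j = y then 1 else 0 := by
  rw [cosetMatrix_apply]
  split_ifs with h
  · rw [Finset.card_eq_one]
    refine ⟨b, ?_⟩
    ext p
    rw [Finset.mem_filter, Finset.mem_singleton, Equiv.Perm.one_apply]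
    simp only [Finset.mem_univ, true_and]
    constructor
    · rintro ⟨h1, h2⟩
      by_contra hp
      exact hij (h1.symm.trans ((M.row_eq p hp).symm.trans h2))
    · rintro rfl
      rw [M.row_left, M.row_right, h.1, h.2]
      exact ⟨rfl, rfl⟩
  · rw [Finset.card_eq_zero, Finset.filter_eq_empty_iff]
    rintro p - ⟨h1, h2⟩
    rw [Equiv.Perm.one_apply] at h1
    by_cases hp : p = b
    · subst hp
      exact h ⟨h1.symm.trans M.row_left, h2.symm.trans M.row_right⟩
    · exact hij (h1.symm.trans ((M.row_eq p hp).symm.trans h2))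

theorem one_mem_superShortest (M : MoveLetter l e x y b) : 1 ∈ superShortest l e := by
  rw [mem_superShortest_iff]
  refine ⟨⟨fun w _ => ?_, fun w _ => ?_⟩, fun p p' hne he hl => ?_⟩
  · rw [length_one]
    exact Nat.zero_le _
  · rw [inv_one, length_one]
    exact Nat.zero_le _
  · rw [Equiv.Perm.one_apply, Equiv.Perm.one_apply] at hl
    rw [Equiv.Perm.one_apply]
    by_cases hp : p = b
    · have hp' : p' ≠ b := fun h => hne (hp.trans h.symm)
      rw [hl, he, M.row_eq p' hp']
    · rw [M.row_eq p hp]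

theorem oddInv_cyc (M : MoveLetter l e x y b) (hxy : x ≠ y) (ht : row l t = x) :
    (oddInv l (cyc b t) e).card = if (x : ℕ) < m then 0 else length (cyc b t) := by
  have hrow := (isYoung_parabolic l).mem_iff _ |>.1 (M.cyc_mem ht)
  have hinv : ∀ i j, (i, j) ∈ inversions (cyc b t) → row l i = x ∧ row l j = x := by
    intro i j h
    obtain ⟨hij, hlt⟩ := mem_inversions.1 h
    have h1 : row l i = row l j := by
      by_contra hne
      exact lt_asymm hlt ((isYoung_parabolic l).lt_of_ne (M.cyc_mem ht) hij hne)
    by_cases hi : i = b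
    · rw [← h1, hi, M.row_left]
      exact ⟨rfl, rfl⟩
    · by_cases hj : j = b
      · rw [h1, hj, M.row_left]
        exact ⟨rfl, rfl⟩
      · exact absurd hlt (cyc_lt_cyc hi hj hij).not_gt
  split_ifs with hx
  · rw [Finset.card_eq_zero, Finset.eq_empty_iff_forall_notMem]
    rintro ⟨i, j⟩ h
    obtain ⟨h1, h2 | h2⟩ := mem_oddInv.1 h
    · exact lt_asymm h1.2 (M.cyc_lt_of_row_eq hxy ht h1.1 h2.1)
    · rw [hrow, (hinv i j (mem_inversions.2 h1)).1] at h2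
      omega
  · rw [length_eq_card_inversions]
    congr 1
    ext ⟨i, j⟩
    refine ⟨fun h => mem_inversions.2 (mem_oddInv.1 h).1, fun h => mem_oddInv.2
      ⟨mem_inversions.1 h, Or.inr ?_⟩⟩
    obtain ⟨h1, h2⟩ := hinv i j h
    rw [hrow, hrow, h1, h2]
    exact ⟨rfl, not_lt.1 hx⟩

end Counting

section Product

variable {R : Type*} [CommRing R] {q : Rˣ} {m n r : ℕ} {l e u : Composition (m + n) r}
  {x y : Fin (m + n)} {b : Fin r} {σ : Bool} {d : Equiv.Perm (Fin r)}

theorem ratio_pow (a c : ℕ) : ratio q m a ^ c = (-q)⁻¹ ^ (if a < m then 0 else c) := by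
  rw [ratio]
  split_ifs
  · rw [one_pow, pow_zero]
  · rfl

/-- Multiplication by the left factor of `T_{W_l W_e}` on a coefficient at a shortest
representative: only the shortest representatives of the left cosets of `W_l ∩ W_e` in `W_l`
contribute. -/
theorem coeff_leftFactor_mul (M : MoveLetter l e x y b) (hxy : x ≠ y)
    (hd : d ∈ shortest (parabolic l)) (z : Hecke q r) :
    coeff d (leftFactor e (cosetSum q l 1 e) * z) =
      ∑ t ∈ Finset.univ.filter (fun t => row l t = x),
        ((q : R) * (ratio q m x : R)) ^ length (cyc b t) * coeff ((cyc b t)⁻¹ * d) z := by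
  classical
  have h1 := M.one_mem_superShortest
  have hl := (isYoung_parabolic l).mem_iff
  rw [leftFactor, Finset.sum_mul, map_sum]
  symm
  refine Finset.sum_of_injOn (fun t => cyc b t) ?_ ?_ ?_ ?_
  · intro t _ s _ h
    have := Equiv.congr_fun h b
    rwa [cyc_self, cyc_self] at this
  · intro t ht
    rw [Finset.mem_coe, Finset.mem_filter] at ht
    rw [Finset.mem_coe, Finset.mem_filter]
    exact ⟨Finset.mem_univ _, M.cyc_inv_mem_shortest hxy ht.2⟩
  · intro w hw hne
    rw [Finset.mem_filter] at hw
    rw [smul_mul_assoc, map_smul, cosetSum_eq_superSum h1, coeff_superSum, if_neg, zero_smul]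
    intro hmem
    have hwl : w ∈ parabolic l := (hl w).2 fun p =>
      row_eq_of_cosetMatrix_eq hw.2 h1.1.2 hmem p
    refine hne ⟨w b, ?_, (M.eq_cyc hxy hwl hw.2).symm⟩
    rw [Finset.mem_coe, Finset.mem_filter, (hl w).1 hwl, M.row_left]
    exact ⟨Finset.mem_univ _, rfl⟩
  · intro t ht
    have ht := (Finset.mem_filter.1 ht).2
    have hmem := M.cyc_mem ht
    have hlen := (isYoung_parabolic l).length_mul (inv_mem hmem) hd
    rw [length_inv] at hlen
    have hcoset : cyc b t ∈ cosetSet l 1 e := by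
      have := cosetMatrix_mul_left 1 e hmem
      rwa [mul_one] at this
    rw [smul_mul_assoc, map_smul, coeff_T_mul hlen, cosetSum_eq_superSum h1, coeff_superSum,
      if_pos hcoset, M.oddInv_cyc hxy ht, ← ratio_pow, smul_eq_mul, mul_pow,
      Units.val_pow_eq_pow_val]
    ring

theorem product_mem_leftEigen (M : MoveLetter l e x y b) :
    leftFactor e (cosetSum q l 1 e) * cosetSum q e d u ∈ leftEigen l := by
  obtain ⟨h, hh⟩ := exists_right_factor (q := q) e d u
  rw [hh, ← mul_assoc, leftFactor_mul_xy (cosetSum_mem_rightEigen M.one_mem_superShortest)]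
  exact mul_mem_leftEigen (cosetSum_mem_leftEigen _ _ _) _

/-- The coefficients of the product of two double coset elements of which the first belongs to a
move of one letter. -/
theorem coeff_product (M : MoveLetter l e x y b) (hσ : Before σ x y) {d' : Equiv.Perm (Fin r)}
    (hd : d ∈ superShortest e u) (hd' : d' ∈ superShortest l u) :
    coeff d' (leftFactor e (cosetSum q l 1 e) * cosetSum q e d u) =
      ∑ k ∈ Finset.univ.filter (fun k => 1 ≤ cosetMatrix e d u y k),
        ((ratio q m y : R) ^ (∑ j ∈ Finset.univ.filter (fun j => Before σ j k),
            cosetMatrix e d u y j) *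
          ((q : R) * (ratio q m x : R)) ^ (∑ j ∈ Finset.univ.filter (fun j => Before σ k j),
            cosetMatrix e d u x j) *
          ∑ i ∈ Finset.range (cosetMatrix e d u x k + 1),
            ((q : R) * (ratio q m x : R) * (ratio q m x : R)) ^ i) *
        if cosetMatrix l d' u = moveUnit (cosetMatrix e d u) y x k then 1 else 0 := by
  set A := cosetMatrix e d u with hA
  set B := cosetMatrix l d' u with hB
  rw [M.coeff_leftFactor_mul hσ.ne hd'.1.1, cosetSum_eq_superSum hd,
    ← Finset.sum_fiberwise _ fun t => row u (d'⁻¹ t), Finset.sum_filter]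
  refine Finset.sum_congr rfl fun k _ => ?_
  have hmem : ∀ t, row l t = x → row u (d'⁻¹ t) = k → ((cyc b t)⁻¹ * d' ∈ cosetSet e d u ↔
      1 ≤ A y k ∧ B = moveUnit A y x k) := by
    intro t ht hk
    rw [← moveUnit_eq_iff hσ.ne]
    have h := M.cosetMatrix_cyc (d := d') (u := u) ht
    rw [hk] at h
    change cosetMatrix e ((cyc b t)⁻¹ * d') u = A ↔ _
    constructor
    · intro h1
      rw [← h, h1]
    · intro h1
      rw [← hB, h1] at h
      exact add_right_cancel h
  have hterm : ∀ t ∈ Finset.univ.filter (fun t => row l t = x) |>.filter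
      (fun t => row u (d'⁻¹ t) = k), row l t = x ∧ row u (d'⁻¹ t) = k := fun t ht => by
    rw [Finset.mem_filter, Finset.mem_filter] at ht
    exact ⟨ht.1.2, ht.2⟩
  by_cases hAB : 1 ≤ A y k ∧ B = moveUnit A y x k
  · rw [if_pos hAB.1, if_pos hAB.2, mul_one]
    have hentry : ∀ i j, B i j + (if y = i ∧ k = j then 1 else 0) =
        A i j + if x = i ∧ k = j then 1 else 0 := fun i j => by
      have := congrFun (congrFun ((moveUnit_eq_iff hσ.ne).2 hAB) i) j
      rwa [Matrix.add_apply, Matrix.add_apply, Matrix.single_apply, Matrix.single_apply] at this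
    have hBx : B x k = A x k + 1 := by
      have := hentry x k
      simpa [hσ.ne.symm] using this
    have hBy : ∀ i j, j ≠ k → B i j = A i j := fun i j hj => by
      have := hentry i j
      rwa [if_neg fun h => hj h.2.symm, if_neg fun h => hj h.2.symm] at this
    set S := Finset.univ.filter (fun s => row l s = x ∧ row u (d'⁻¹ s) = k) with hS
    have hScard : S.card = A x k + 1 := by
      rw [← hBx, hB, cosetMatrix_apply, ← Finset.card_map d'⁻¹.toEmbedding]
      congr 1
      ext p
      rw [hS, Finset.mem_map_equiv, Finset.mem_filter, Finset.mem_filter]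
      change (_ ∧ row l (d' p) = x ∧ row u (d'⁻¹ (d' p)) = k) ↔ _
      rw [inv_apply_self]
      simp
    rw [Finset.filter_filter, ← hScard, ← sum_card_before σ S, Finset.mul_sum]
    refine Finset.sum_congr rfl fun t htS => ?_
    obtain ⟨ht, hk⟩ := (Finset.mem_filter.1 htS).2
    have htau : (Finset.univ.filter fun s => (row l s = x ∧ row u (d'⁻¹ s) = k) ∧
        Before σ t s) = S.filter fun s => Before σ t s := by
      rw [hS, Finset.filter_filter]
    have hlen := M.length_cyc_eq hσ ht hd'.1
    have hodd := M.card_oddInv_cyc hσ ht hd'.1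
    rw [hk, htau] at hlen hodd
    rw [coeff_superSum, if_pos ((hmem t ht hk).2 hAB), hlen, hodd, ← hB,
      Finset.sum_congr rfl fun j hj => hBy x j (Finset.mem_filter.1 hj).2.ne.symm,
      Finset.sum_congr rfl fun j hj => hBy y j (Finset.mem_filter.1 hj).2.ne, pow_add (-q)⁻¹,
      ← ratio_pow, ← ratio_pow, Units.val_mul, Units.val_pow_eq_pow_val, Units.val_pow_eq_pow_val]
    -- an entry of mixed parity contributes one letter only
    have hratio : (ratio q m k : R) ^ (S.filter fun s => Before σ t s).card =
        (ratio q m x : R) ^ (S.filter fun s => Before σ t s).card := by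
      have hlt : (S.filter fun s => Before σ t s).card < A x k + 1 := by
        rw [← hScard]
        exact Finset.card_lt_card (Finset.filter_ssubset.2 ⟨t, htS, fun h => h.ne rfl⟩)
      by_cases h0 : (S.filter fun s => Before σ t s).card = 0
      · rw [h0, pow_zero, pow_zero]
      · have := parityCompatible_iff.1 (mem_superShortest_iff.1 hd').2 x k (by rw [← hB]; omega)
        rw [ratio, ratio]
        simp only [this]
    rw [hratio]
    ring
  · rw [Finset.sum_eq_zero]
    · split_ifs with h1 h2
      · exact absurd ⟨h1, h2⟩ hAB
      · rw [mul_zero]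
      · rfl
    · intro t ht
      obtain ⟨ht, hk⟩ := hterm t ht
      rw [coeff_superSum, if_neg fun h => hAB ((hmem t ht hk).1 h), mul_zero]

end Product

end MoveLetter

/-! ### The multiplication formulas -/

section Represents

variable {R : Type*} [CommRing R] {q : Rˣ} {m n r : ℕ}

open scoped Classical in
/-- The endomorphism `f` sends `[xy]_u h` to `z h`, an element of the summand of `l`, and vanishes
on the summands other than that of `u`. -/
def Represents (l : Composition (m + n) r) (z : Hecke q r) (u : Composition (m + n) r)
    (f : SchurSuperalgebra q m n r) : Prop :=
  ∃ hz : ∀ x, z * x ∈ xyIdeal q l, ∀ (a : Composition (m + n) r) (x : Hecke q r),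
    f (DirectSum.of (fun l => xyIdeal q l) a ⟨xy q a * x, xy_mul_mem q a x⟩) =
      if u = a then DirectSum.of (fun l => xyIdeal q l) l ⟨z * x, hz x⟩ else 0

variable {l e u : Composition (m + n) r} {z z' : Hecke q r} {f g : SchurSuperalgebra q m n r}

theorem IsCosetMap.represents {d : Equiv.Perm (Fin r)} (h : IsCosetMap q l d u f) :
    Represents l (cosetSum q l d u) u f :=
  ⟨cosetSum_mul_mem q l d u, h⟩

theorem Represents.zero : Represents l (0 : Hecke q r) u 0 := by
  refine ⟨fun x => by rw [zero_mul]; exact zero_mem _, fun a x => ?_⟩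
  split_ifs
  · have : (⟨0 * x, by rw [zero_mul]; exact zero_mem _⟩ : xyIdeal q l) = 0 :=
      Subtype.ext (zero_mul x)
    rw [LinearMap.zero_apply, this, map_zero]
  · rfl

theorem Represents.add (hf : Represents l z u f) (hg : Represents l z' u g) :
    Represents l (z + z') u (f + g) := by
  obtain ⟨hz, hf⟩ := hf
  obtain ⟨hz', hg⟩ := hg
  refine ⟨fun x => by rw [add_mul]; exact add_mem (hz x) (hz' x), fun a x => ?_⟩
  rw [LinearMap.add_apply, hf, hg]
  split_ifs
  · rw [← map_add]
    congr 1
    exact Subtype.ext (add_mul z z' x).symm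
  · exact add_zero 0

theorem Represents.smul (c : R) (hf : Represents l z u f) : Represents l (c • z) u (c • f) := by
  obtain ⟨hz, hf⟩ := hf
  refine ⟨fun x => by
    rw [smul_mul_assoc]
    exact Submodule.smul_of_tower_mem (xyIdeal q l) c (hz x), fun a x => ?_⟩
  rw [LinearMap.smul_apply, hf]
  split_ifs
  · rw [← DirectSum.lof_eq_of R]
    exact (map_smul (DirectSum.lof R _ (fun l => xyIdeal q l) l) c _).symm.trans
      (congrArg _ (Subtype.ext (smul_mul_assoc c z x).symm))
  · exact smul_zero c

theorem Represents.sum {ι : Type*} (s : Finset ι) (c : ι → R) (z : ι → Hecke q r)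
    (f : ι → SchurSuperalgebra q m n r) (h : ∀ k ∈ s, Represents l (z k) u (f k)) :
    Represents l (∑ k ∈ s, c k • z k) u (∑ k ∈ s, c k • f k) := by
  classical
  induction s using Finset.induction_on with
  | empty => exact Represents.zero
  | insert k s hk ih =>
    rw [Finset.sum_insert hk, Finset.sum_insert hk]
    exact ((h k (Finset.mem_insert_self k s)).smul (c k)).add
      (ih fun j hj => h j (Finset.mem_insert_of_mem hj))

/-- If `g` is represented by `[xy]_e h`, then `f * g` is represented by `z h`, as `f` is a map of
right modules. -/
theorem Represents.mul {h : Hecke q r} (hf : Represents l z e f)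
    (hg : Represents e (xy q e * h) u g) : Represents l (z * h) u (f * g) := by
  obtain ⟨hz, hf⟩ := hf
  obtain ⟨hz', hg⟩ := hg
  refine ⟨fun x => by rw [mul_assoc]; exact hz _, fun a x => ?_⟩
  rw [Module.End.mul_apply, hg]
  split_ifs
  · have : (⟨xy q e * h * x, hz' x⟩ : xyIdeal q e) = ⟨xy q e * (h * x), xy_mul_mem q e _⟩ :=
      Subtype.ext (mul_assoc _ _ _)
    rw [this, hf, if_pos rfl]
    congr 1
    exact Subtype.ext (mul_assoc _ _ _).symm
  · exact map_zero f

theorem Represents.unique (hf : Represents l z u f) (hg : Represents l z u g) : f = g := by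
  obtain ⟨hz, hf⟩ := hf
  obtain ⟨_, hg⟩ := hg
  refine LinearMap.toAddMonoidHom_injective (DirectSum.addHom_ext fun a y => ?_)
  obtain ⟨y, hy⟩ := y
  obtain ⟨c, rfl⟩ := Submodule.mem_span_singleton.mp hy
  exact (hf a c.unop).trans (hg a c.unop).symm

end Represents

section Product

variable {R : Type*} [CommRing R] {q : Rˣ} {m n r : ℕ} {l e u : Composition (m + n) r}
  {x y : Fin (m + n)} {b : Fin r} {σ : Bool} {d : Equiv.Perm (Fin r)}

theorem sum_single_row {N : ℕ} (y k i : Fin N) :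
    ∑ j, Matrix.single y k 1 i j = if i = y then 1 else 0 := by
  simp only [Matrix.single_apply]
  by_cases h : y = i
  · simp [h]
  · simp [h, Ne.symm h]

theorem sum_single_col {N : ℕ} (y k j : Fin N) :
    ∑ i, Matrix.single y k 1 i j = if j = k then 1 else 0 := by
  simp only [Matrix.single_apply]
  by_cases h : k = j
  · simp [h]
  · simp [h, Ne.symm h]

/-- The map of the matrix obtained by moving a unit is represented by the bi-eigenvector whose only
nonzero coefficient at a shortest representative belongs to that matrix, or by zero. -/
theorem exists_represents_moveUnit
    (hle : ∀ i, l.1 i + (if i = y then 1 else 0) = e.1 i + if i = x then 1 else 0) (hxy : x ≠ y)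
    {k : Fin (m + n)} (hk : 1 ≤ cosetMatrix e d u y k) :
    ∃ z : Hecke q r, Represents l z u (phi q r (moveUnit (cosetMatrix e d u) y x k)) ∧
      z ∈ leftEigen l ∧ z ∈ rightEigen u ∧ ∀ d' ∈ superShortest l u, coeff d' z =
        if cosetMatrix l d' u = moveUnit (cosetMatrix e d u) y x k then 1 else 0 := by
  set B := moveUnit (cosetMatrix e d u) y x k with hB
  by_cases hmem : B ∈ superMatrices m n r
  · obtain ⟨l', u', d'', hd'', heq⟩ := hmem
    have hmat := (moveUnit_eq_iff hxy).2 ⟨hk, hB⟩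
    have hl : l' = l := by
      refine Subtype.ext (funext fun i => ?_)
      have h1 : ∑ j, (B + Matrix.single y k 1 : Matrix _ _ ℕ) i j =
          ∑ j, (cosetMatrix e d u + Matrix.single x k 1 : Matrix _ _ ℕ) i j := by rw [hmat]
      simp only [Matrix.add_apply, Finset.sum_add_distrib, sum_single_row] at h1
      rw [← heq, sum_cosetMatrix_row, sum_cosetMatrix_row] at h1
      have := hle i
      omega
    have hu : u' = u := by
      refine Subtype.ext (funext fun j => ?_)
      have h1 : ∑ i, (B + Matrix.single y k 1 : Matrix _ _ ℕ) i j =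
          ∑ i, (cosetMatrix e d u + Matrix.single x k 1 : Matrix _ _ ℕ) i j := by rw [hmat]
      simp only [Matrix.add_apply, Finset.sum_add_distrib, sum_single_col] at h1
      rw [← heq, sum_cosetMatrix_col, sum_cosetMatrix_col] at h1
      omega
    subst hl hu
    rw [← heq]
    refine ⟨cosetSum q l' d'' u', (isCosetMap_phi hd'').represents, cosetSum_mem_leftEigen _ _ _,
      cosetSum_mem_rightEigen hd'', fun d' hd' => ?_⟩
    rw [cosetSum_eq_superSum hd'', coeff_superSum, oddInv_eq_empty hd'.1, Finset.card_empty,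
      pow_zero, Units.val_one]
    by_cases h : cosetMatrix l' d' u' = cosetMatrix l' d'' u'
    · rw [if_pos h]
      exact if_pos h
    · rw [if_neg h]
      exact if_neg h
  · rw [phi_eq_zero hmem]
    refine ⟨0, Represents.zero, zero_mem _, zero_mem _, fun d' hd' => ?_⟩
    rw [map_zero, if_neg]
    intro h
    exact hmem ⟨l, u, d', hd', h⟩

/-- Both sides are represented by bi-eigenvectors, which have the same coefficients at the shortest
representatives by `coeff_product`. -/
theorem phi_mul_phi (hq : 1 + (q : R) ∈ nonZeroDivisors R) (M : MoveLetter l e x y b)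
    (hle : ∀ i, l.1 i + (if i = y then 1 else 0) = e.1 i + if i = x then 1 else 0)
    (hσ : Before σ x y) (hd : d ∈ superShortest e u) :
    phi q r (cosetMatrix l 1 e) * phi q r (cosetMatrix e d u) =
      ∑ k ∈ Finset.univ.filter (fun k => 1 ≤ cosetMatrix e d u y k),
        ((ratio q m y : R) ^ (∑ j ∈ Finset.univ.filter (fun j => Before σ j k),
            cosetMatrix e d u y j) *
          ((q : R) * (ratio q m x : R)) ^ (∑ j ∈ Finset.univ.filter (fun j => Before σ k j),
            cosetMatrix e d u x j) *
          ∑ i ∈ Finset.range (cosetMatrix e d u x k + 1),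
            ((q : R) * (ratio q m x : R) * (ratio q m x : R)) ^ i) •
        phi q r (moveUnit (cosetMatrix e d u) y x k) := by
  have h1 := M.one_mem_superShortest
  obtain ⟨h, hh⟩ := exists_right_factor (q := q) e d u
  have hA := (isCosetMap_phi (q := q) hd).represents
  rw [hh] at hA
  have hprod := (isCosetMap_phi (q := q) h1).represents.mul hA
  rw [← leftFactor_mul_xy (cosetSum_mem_rightEigen h1), mul_assoc, ← hh] at hprod
  have hex : ∀ k : Fin (m + n), ∃ z : Hecke q r, 1 ≤ cosetMatrix e d u y k →
      Represents l z u (phi q r (moveUnit (cosetMatrix e d u) y x k)) ∧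
        z ∈ leftEigen l ∧ z ∈ rightEigen u ∧ ∀ d' ∈ superShortest l u, coeff d' z =
          if cosetMatrix l d' u = moveUnit (cosetMatrix e d u) y x k then 1 else 0 := by
    intro k
    by_cases hk : 1 ≤ cosetMatrix e d u y k
    · obtain ⟨z, hz⟩ := exists_represents_moveUnit (q := q) hle hσ.ne hk
      exact ⟨z, fun _ => hz⟩
    · exact ⟨0, fun h => absurd h hk⟩
  choose z hz using hex
  have hz' : ∀ k ∈ Finset.univ.filter (fun k => 1 ≤ cosetMatrix e d u y k), _ := fun k hk =>
    hz k (Finset.mem_filter.1 hk).2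
  refine Represents.unique (l := l) (u := u) ?_
    (Represents.sum _ _ z _ fun k hk => (hz' k hk).1)
  convert hprod using 1
  refine eq_of_leftEigen_of_rightEigen (l := l) (u := u) hq
    (sum_mem fun k hk => Submodule.smul_mem _ _ (hz' k hk).2.1) M.product_mem_leftEigen
    (sum_mem fun k hk => Submodule.smul_mem _ _ (hz' k hk).2.2.1)
    (mul_mem_rightEigen (cosetSum_mem_rightEigen hd) _) fun d' hd' => ?_
  rw [M.coeff_product hσ hd hd', map_sum]
  refine Finset.sum_congr rfl fun k hk => ?_
  rw [map_smul, smul_eq_mul, (hz' k hk).2.2.2 d' hd']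

end Product

section Final

variable {m n r : ℕ}

theorem one_add_qq_mem_nonZeroDivisors : 1 + (qq : ℤ[T;T⁻¹]) ∈ nonZeroDivisors ℤ[T;T⁻¹] := by
  refine mem_nonZeroDivisors_of_ne_zero fun h => ?_
  have h1 : (qq : ℤ[T;T⁻¹]) = LaurentPolynomial.T 2 := by
    rw [qq, upsilon, Units.val_pow_eq_pow_val, LaurentPolynomial.T_pow]
    norm_num
  rw [h1, ← LaurentPolynomial.T_zero] at h
  have h2 := congrArg (LaurentPolynomial.eval₂ (RingHom.id ℤ) 1) h
  simp at h2

theorem qDot_eq (i : Fin (m + n)) : (qDot i : ℤ[T;T⁻¹]ˣ) = ratio qq m i := by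
  rw [qDot, ratio, inv_neg]

theorem qDDot_eq (i : Fin (m + n)) :
    (qDDot i : ℤ[T;T⁻¹]) = (qq : ℤ[T;T⁻¹]) * (ratio qq m i : ℤ[T;T⁻¹]) := by
  rw [qDDot, ratio, ← Units.val_mul]
  split_ifs
  · rw [mul_one]
  · rw [inv_neg, mul_neg, mul_inv_cancel]

theorem qAt_eq (i : Fin (m + n)) : (qAt i : ℤ[T;T⁻¹]) =
    (qq : ℤ[T;T⁻¹]) * (ratio qq m i : ℤ[T;T⁻¹]) * (ratio qq m i : ℤ[T;T⁻¹]) := by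
  rw [qAt, upsilonAt, ratio, ← Units.val_mul, ← Units.val_mul]
  split_ifs
  · rw [mul_one, mul_one, qq]
  · rw [inv_neg, mul_neg, mul_neg, neg_mul, neg_neg, mul_inv_cancel, one_mul, qq, inv_pow]

/-- The decomposition of `D` as a matrix unit plus a diagonal matrix gives a move of one
letter. -/
theorem exists_moveLetter_of_isDiagPlus {D : Matrix (Fin (m + n)) (Fin (m + n)) ℕ}
    {x y : Fin (m + n)} (hxy : (x : ℕ) + 1 = y ∨ (y : ℕ) + 1 = x) (hD : IsDiagPlus D x y)
    {l e : Composition (m + n) r} (hl : ∀ i, ∑ j, D i j = l.1 i) (he : ∀ i, ∑ j, D j i = e.1 i) :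
    (∀ i, l.1 i + (if i = y then 1 else 0) = e.1 i + if i = x then 1 else 0) ∧
      ∃ b, MoveLetter l e x y b ∧ cosetMatrix l 1 e = D := by
  have hne : x ≠ y := by
    rintro rfl
    omega
  have hoff : ∀ i j, i ≠ j → D i j = if i = x ∧ j = y then 1 else 0 := by
    intro i j hij
    have : (D.map (Nat.cast : ℕ → ℤ) - Matrix.single x y 1 : Matrix _ _ ℤ) i j = 0 := hD hij
    rw [Matrix.sub_apply, Matrix.map_apply, Matrix.single_apply, sub_eq_zero] at this
    simp only [eq_comm (a := x), eq_comm (a := y)] at this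
    split_ifs at this ⊢ <;> exact_mod_cast this
  have hrow : ∀ C : Matrix (Fin (m + n)) (Fin (m + n)) ℕ,
      (∀ i j, i ≠ j → C i j = if i = x ∧ j = y then 1 else 0) →
      ∀ i, ∑ j, C i j = C i i + if i = x then 1 else 0 := by
    intro C hC i
    rw [← Finset.add_sum_erase _ _ (Finset.mem_univ i), Finset.sum_congr rfl fun j hj =>
      hC i j (Finset.ne_of_mem_erase hj).symm]
    congr 1
    by_cases hi : i = x
    · subst hi
      simp [hne.symm]
    · simp [hi]
  have hcol : ∀ i, ∑ j, D j i = D i i + if i = y then 1 else 0 := by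
    intro i
    rw [← Finset.add_sum_erase _ _ (Finset.mem_univ i), Finset.sum_congr rfl fun j hj =>
      hoff j i (Finset.ne_of_mem_erase hj)]
    congr 1
    by_cases hi : i = y
    · subst hi
      simp [hne]
    · simp [hi]
  have hle : ∀ i, l.1 i + (if i = y then 1 else 0) = e.1 i + if i = x then 1 else 0 := by
    intro i
    rw [← hl, ← he, hrow D hoff, hcol]
    omega
  obtain ⟨b, M⟩ := exists_moveLetter hle hxy
  refine ⟨hle, b, M, ?_⟩
  ext i j
  by_cases hij : i = j
  · subst hij
    have h1 := sum_cosetMatrix_row l 1 e i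
    rw [← hl i, hrow D hoff, hrow _ M.cosetMatrix_one] at h1
    omega
  · rw [M.cosetMatrix_one i j hij, hoff i j hij]

/-- The multiplication formula for a unit in position `(x, y)`. -/
theorem phi_mul_phi_of_isDiagPlus {A D : Matrix (Fin (m + n)) (Fin (m + n)) ℕ}
    (hA : A ∈ superMatrices m n r) (hD : D ∈ superMatrices m n r) {x y : Fin (m + n)} {σ : Bool}
    (hxy : (x : ℕ) + 1 = y ∨ (y : ℕ) + 1 = x) (hσ : Before σ x y) (hDp : IsDiagPlus D x y)
    (hsum : ∀ i, ∑ j, D j i = ∑ j, A i j) :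
    phi qq r D * phi qq r A = ∑ k ∈ Finset.univ.filter (fun k => 1 ≤ A y k),
      ((qDot y : ℤ[T;T⁻¹]) ^ (∑ j ∈ Finset.univ.filter (fun j => Before σ j k), A y j) *
        (qDDot x : ℤ[T;T⁻¹]) ^ (∑ j ∈ Finset.univ.filter (fun j => Before σ k j), A x j) *
        gaussInt (A x k + 1) (qAt x)) • phi qq r (moveUnit A y x k) := by
  obtain ⟨e, u, d, hd, rfl⟩ := hA
  obtain ⟨l, e', d₀, -, rfl⟩ := hD
  obtain ⟨hle, b, M, hDeq⟩ := exists_moveLetter_of_isDiagPlus (l := l) (e := e) hxy hDp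
    (sum_cosetMatrix_row _ _ _) fun i => by rw [hsum, sum_cosetMatrix_row]
  rw [← hDeq, phi_mul_phi one_add_qq_mem_nonZeroDivisors M hle hσ hd]
  simp only [qDot_eq, qDDot_eq, qAt_eq, gaussInt]

end Final

end QSchur

theorem mainTheorem2 (m n r : ℕ) :
    (∀ (l u : QSchur.Composition (m + n) r) (d : Equiv.Perm (Fin r)),
      d ∈ QSchur.superShortest l u →
        QSchur.IsCosetMap QSchur.qq l d u
          (QSchur.phi QSchur.qq r (QSchur.cosetMatrix l d u))) ∧
    ∀ A ∈ QSchur.superMatrices m n r, ∀ g h : Fin (m + n), (g : ℕ) = h + 1 →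
      (∀ D ∈ QSchur.superMatrices m n r, QSchur.IsDiagPlus D h g →
        (∀ i, ∑ j, D j i = ∑ j, A i j) →
          QSchur.phi QSchur.qq r D * QSchur.phi QSchur.qq r A =
            ∑ k ∈ Finset.univ.filter (fun k => 1 ≤ A g k),
              ((QSchur.qDot g : ℤ[T;T⁻¹]) ^ (∑ j ∈ Finset.Iio k, A g j) *
                (QSchur.qDDot h : ℤ[T;T⁻¹]) ^ (∑ j ∈ Finset.Ioi k, A h j) *
                QSchur.gaussInt (A h k + 1) (QSchur.qAt h)) •
              QSchur.phi QSchur.qq r (QSchur.moveUnit A g h k)) ∧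
      (∀ D ∈ QSchur.superMatrices m n r, QSchur.IsDiagPlus D g h →
        (∀ i, ∑ j, D j i = ∑ j, A i j) →
          QSchur.phi QSchur.qq r D * QSchur.phi QSchur.qq r A =
            ∑ k ∈ Finset.univ.filter (fun k => 1 ≤ A h k),
              ((QSchur.qDot h : ℤ[T;T⁻¹]) ^ (∑ j ∈ Finset.Ioi k, A h j) *
                (QSchur.qDDot g : ℤ[T;T⁻¹]) ^ (∑ j ∈ Finset.Iio k, A g j) *
                QSchur.gaussInt (A g k + 1) (QSchur.qAt g)) •
              QSchur.phi QSchur.qq r (QSchur.moveUnit A h g k)) := by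
  refine ⟨fun l u d hd => QSchur.isCosetMap_phi hd, fun A hA g h hgh => ⟨fun D hD hDp hsum => ?_,
    fun D hD hDp hsum => ?_⟩⟩
  · have hlt : QSchur.Before true h g := QSchur.before_true.2 (Fin.lt_def.2 (by omega))
    rw [QSchur.phi_mul_phi_of_isDiagPlus hA hD (Or.inl hgh.symm) hlt hDp hsum]
    simp only [QSchur.before_true, Finset.filter_lt_eq_Ioi, Finset.filter_gt_eq_Iio]
  · have hlt : QSchur.Before false g h := QSchur.before_false.2 (Fin.lt_def.2 (by omega))
    rw [QSchur.phi_mul_phi_of_isDiagPlus hA hD (Or.inr hgh.symm) hlt hDp hsum]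
    simp only [QSchur.before_false, Finset.filter_lt_eq_Ioi, Finset.filter_gt_eq_Iio]
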